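/- **Conventions.** Write $\widehat f(\xi)=\int_{\mathbb R^3}f(x)e^{-ix\cdot\xi}\,dx$, $x_h=(x_1,x_2)$, $\Lambda(\xi)=\xi_3/|\xi|$, $\langle t\rangle=(1+t^2)^{1/2}$, $k^+=\max\{0,k\}$, $S=x\cdot\nabla$, $\Omega=-x_2\partial_1+x_1\partial_2$. Fix a smooth even $\psi:\mathbb R\to[0,1]$, non-increasing on $[0,\infty)$, with $\psi=1$ on $[-1.8,1.8]$ and $\psi=0$ outside $[-2,2]$, and let $\varphi(x)=\psi(x)-\psi(2x)$. Fix a smooth $\phi:\mathbb R\to[0,1]$ with $\phi(x)=1$ for $|x|\le 0.55$ and $\phi(x)=0$ for $|x|\ge 0.6$. For $k\in\mathbb Z$ let $P^h_k$, $P^v_k$, $P_k$ be the Fourier multipliers with symbols $$\chi^h_k(\xi)=\phi(\Lambda(\xi))\,\varphi(2^{-k}|\xi_h|),\qquad \chi^v_k(\xi)=(1-\phi(\Lambda(\xi)))\,\varphi(2^{-k}|\xi_3|),\qquad \chi_k=\chi^h_k+\chi^v_k .$$ For $k,l\in\mathbb Z$ let $Z^{(k)}_l$ be multiplication by $\varphi(2^{-l}|x_3|)$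 if $l\ge -k+1$, by $\psi(2^{k}|x_3|)$ if $l=-k$, and by $0$ if $l\le -k-1$; let $H^{(k)}_l$ be defined in the same way with $|x_h|$ in place of $|x_3|$. For $n_1,n_2\in\mathbb N$ and $\beta>0$ set $$\|F\|_{X^{n_1,n_2}_\beta}=\sup_{k,l\in\mathbb Z}\ \sup_{a+b\le n_2}2^{n_1k^++(1+\beta)(l+k)}\|Z^{(k)}_lS^a\Omega^bP^h_kF\|_{L^2},$$ $$\|F\|_{Y^{n_1,n_2}_\beta}=\sup_{k,l\in\mathbb Z}\ \sup_{a+b\le n_2}2^{n_1k^++(1+\beta)(l+k)}\|H^{(k)}_lS^a\Omega^bP^v_kF\|_{L^2}$$ (with $a,b\in\mathbb N$ and values in $[0,\infty]$). **Statement.** Let $\beta>0$. There is a constant $C>0$, depending only on $\beta$ and the fixed cut-offs $\psi,\phi$, such that the following holds for every complex-valued tempered distribution $F$ on $\mathbb R^3$ whose Fourier transform $\widehat F$ is a function that is integrable against every Schwartz function (for instance every $F\in L^2$), for every $t\in\mathbb R$ and each choice of sign, where $e^{\pm it\Lambda}$ is the Fourier multiplier with symbol $e^{\pm it\Lambda(\xi)}$.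 1. For every $k\in\mathbb Z$, $$\|P_ke^{\pm it\Lambda}F\|_{L^\infty}\le C\,\langle t\rangle^{-1}\,2^{\frac32k}\left(\|F\|_{X^{0,3}_\beta}+\|F\|_{Y^{0,3}_\beta}\right).$$ 2. If $\|F\|_{X^{3,3}_\beta}$ and $\|F\|_{Y^{3,3}_\beta}$ are finite, then $e^{\pm it\Lambda}F$ is a bounded function and $$\|e^{\pm it\Lambda}F\|_{L^\infty}\le C\,\langle t\rangle^{-1}\left(\|F\|_{X^{3,3}_\beta}+\|F\|_{Y^{3,3}_\beta}\right).$$ -/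

import Mathlib

open MeasureTheory
open scoped SchwartzMap ENNReal FourierTransform

noncomputable section

namespace RotatingEuler

/-- Physical (and frequency) space `ℝ³` with its Euclidean norm; the coordinates are
`x 0, x 1` (horizontal) and `x 2` (vertical). -/
abbrev E3 := EuclideanSpace ℝ (Fin 3)

/-- `|x_h|`, the length of the horizontal part `x_h = (x₁, x₂)`. -/
def horiz (x : E3) : ℝ := Real.sqrt (x 0 ^ 2 + x 1 ^ 2)

/-- The dispersion relation `Λ(ξ) = ξ₃ / |ξ|`. -/
def Lam (ξ : E3) : ℝ := ξ 2 / ‖ξ‖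

/-- The radial bump function `ψ`: smooth, even, values in `[0,1]`, non-increasing on `[0,∞)`,
equal to `1` on `[-1.8, 1.8]` and supported on `[-2, 2]`. -/
structure IsRadialBump (ψ : ℝ → ℝ) : Prop where
  smooth : ContDiff ℝ (⊤ : ℕ∞) ψ
  mem_Icc : ∀ x, ψ x ∈ Set.Icc (0 : ℝ) 1
  even : ∀ x, ψ (-x) = ψ x
  antitone : AntitoneOn ψ (Set.Ici 0)
  eq_one : ∀ x, |x| ≤ 1.8 → ψ x = 1
  eq_zero : ∀ x, 2 ≤ |x| → ψ x = 0

/-- The smooth cut-off `ϕ` applied to `Λ`: `ϕ(Λ)` lives on `|Λ| ≤ 0.6` and `1 - ϕ(Λ)` lives on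
`|Λ| ≥ 0.55`. -/
structure IsAngularCutoff (ϕ : ℝ → ℝ) : Prop where
  smooth : ContDiff ℝ (⊤ : ℕ∞) ϕ
  mem_Icc : ∀ x, ϕ x ∈ Set.Icc (0 : ℝ) 1
  eq_one : ∀ x, |x| ≤ 0.55 → ϕ x = 1
  eq_zero : ∀ x, 0.6 ≤ |x| → ϕ x = 0

/-- `φ(x) = ψ(x) - ψ(2x)`. -/
def dyadic (ψ : ℝ → ℝ) (x : ℝ) : ℝ := ψ x - ψ (2 * x)

/-- `χ^h_k(ξ) = ϕ(Λ(ξ)) φ(2^{-k}|ξ_h|)`. -/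
def chiH (ψ ϕ : ℝ → ℝ) (k : ℤ) (ξ : E3) : ℝ :=
  ϕ (Lam ξ) * dyadic ψ ((2 : ℝ) ^ (-k) * horiz ξ)

/-- `χ^v_k(ξ) = (1 - ϕ(Λ(ξ))) φ(2^{-k}|ξ₃|)`. -/
def chiV (ψ ϕ : ℝ → ℝ) (k : ℤ) (ξ : E3) : ℝ :=
  (1 - ϕ (Lam ξ)) * dyadic ψ ((2 : ℝ) ^ (-k) * |ξ 2|)

/-- `χ_k = χ^h_k + χ^v_k`. -/
def chi (ψ ϕ : ℝ → ℝ) (k : ℤ) (ξ : E3) : ℝ := chiH ψ ϕ k ξ + chiV ψ ϕ k ξ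

/-- The tempered distribution `F` has the function `Fhat` as its Fourier transform, in the
normalization `Fhat(ξ) = ∫ F(x) e^{-i x·ξ} dx`.  Mathlib's `𝓕` uses the phase `e^{-2πi x·ξ}`, so
that `𝓕 F (ξ) = Fhat(2πξ)`.  (Integrability against all Schwartz functions makes `Fhat` a
locally integrable function.) -/
def HasFourierTransform (F : 𝓢'(E3, ℂ)) (Fhat : E3 → ℂ) : Prop :=
  ∀ g : 𝓢(E3, ℂ), Integrable (fun ξ : E3 => Fhat ((2 * Real.pi) • ξ) * g ξ) ∧
    (𝓕 F) g = ∫ ξ : E3, Fhat ((2 * Real.pi) • ξ) * g ξ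

/-- The inverse Fourier transform `(2π)^{-3} ∫ h(ξ) e^{i x·ξ} dξ` of an integrable `h`. -/
def invFourier (h : E3 → ℂ) (x : E3) : ℂ :=
  (1 / (2 * Real.pi) ^ 3 : ℝ) * ∫ ξ : E3, Complex.exp (Complex.I * (inner ℝ x ξ : ℝ)) * h ξ

/-- The Fourier multiplier `m(D) F` as a function, where `Fhat` is the Fourier transform of `F`.
It is only used for bounded measurable `m` with bounded support, so that `m Fhat` is integrable
and `m(D) F` is a smooth function. -/
def multiplier (m : E3 → ℂ) (Fhat : E3 → ℂ) : E3 → ℂ := invFourier (fun ξ => m ξ * Fhat ξ)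

/-- The symbol `e^{i t Λ(ξ)}`. -/
def propagator (t : ℝ) (ξ : E3) : ℂ := Complex.exp (Complex.I * (t * Lam ξ : ℝ))

/-- `P^h_k F`. -/
def PH (ψ ϕ : ℝ → ℝ) (k : ℤ) (Fhat : E3 → ℂ) : E3 → ℂ :=
  multiplier (fun ξ => (chiH ψ ϕ k ξ : ℂ)) Fhat

/-- `P^v_k F`. -/
def PV (ψ ϕ : ℝ → ℝ) (k : ℤ) (Fhat : E3 → ℂ) : E3 → ℂ :=
  multiplier (fun ξ => (chiV ψ ϕ k ξ : ℂ)) Fhat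

/-- `P_k F`. -/
def PLP (ψ ϕ : ℝ → ℝ) (k : ℤ) (Fhat : E3 → ℂ) : E3 → ℂ :=
  multiplier (fun ξ => (chi ψ ϕ k ξ : ℂ)) Fhat

/-- The scaling field `S f = x · ∇f`. -/
def scal (f : E3 → ℂ) (x : E3) : ℂ := fderiv ℝ f x x

/-- The rotation field `Ω f = x_h^⊥ · ∇_h f = -x₂ ∂₁ f + x₁ ∂₂ f`. -/
def rot (f : E3 → ℂ) (x : E3) : ℂ := fderiv ℝ f x !₂[-x 1, x 0, 0]

/-- The weight of the modified dyadic localization at scale `2^l` (with threshold `l = -k`),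
as a function of `r = |x₃|` or `r = |x_h|`: it is `φ(2^{-l} r)` for `l ≥ -k+1`,
`∑_{j ≤ -k} φ(2^{-j} r) = ψ(2^k r)` for `l = -k`, and `0` for `l ≤ -k-1`. -/
def locWeight (ψ : ℝ → ℝ) (k l : ℤ) (r : ℝ) : ℝ :=
  if -k + 1 ≤ l then dyadic ψ ((2 : ℝ) ^ (-l) * r)
  else if l = -k then ψ ((2 : ℝ) ^ (-l) * r)
  else 0

/-- `Z_l^{(k)} f`, localization in `|x₃|`. -/
def ZL (ψ : ℝ → ℝ) (k l : ℤ) (f : E3 → ℂ) (x : E3) : ℂ := (locWeight ψ k l |x 2| : ℂ) * f x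

/-- `H_l^{(k)} f`, localization in `|x_h|`. -/
def HL (ψ : ℝ → ℝ) (k l : ℤ) (f : E3 → ℂ) (x : E3) : ℂ :=
  (locWeight ψ k l (horiz x) : ℂ) * f x

/-- The weight `2^{n₁ k⁺ + (1+β)(l+k)}`. -/
def normWeight (n₁ : ℕ) (β : ℝ) (k l : ℤ) : ℝ≥0∞ :=
  ENNReal.ofReal ((2 : ℝ) ^ ((n₁ : ℝ) * max 0 (k : ℝ) + (1 + β) * ((l : ℝ) + (k : ℝ))))

/-- `‖F‖_{X^{n₁,n₂}_β}`, with values in `[0,∞]`, for `F` with Fourier transform `Fhat`. -/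
def Xnorm (ψ ϕ : ℝ → ℝ) (n₁ n₂ : ℕ) (β : ℝ) (Fhat : E3 → ℂ) : ℝ≥0∞ :=
  ⨆ (k : ℤ) (l : ℤ) (a : ℕ) (b : ℕ) (_ : a + b ≤ n₂),
    normWeight n₁ β k l * eLpNorm (ZL ψ k l (scal^[a] (rot^[b] (PH ψ ϕ k Fhat)))) 2 volume

/-- `‖F‖_{Y^{n₁,n₂}_β}`, with values in `[0,∞]`, for `F` with Fourier transform `Fhat`. -/
def Ynorm (ψ ϕ : ℝ → ℝ) (n₁ n₂ : ℕ) (β : ℝ) (Fhat : E3 → ℂ) : ℝ≥0∞ :=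
  ⨆ (k : ℤ) (l : ℤ) (a : ℕ) (b : ℕ) (_ : a + b ≤ n₂),
    normWeight n₁ β k l * eLpNorm (HL ψ k l (scal^[a] (rot^[b] (PV ψ ϕ k Fhat)))) 2 volume

/-- `⟨t⟩ = (1 + t²)^{1/2}`. -/
def bracket (t : ℝ) : ℝ := Real.sqrt (1 + t ^ 2)

end RotatingEuler

end

/-! After rescaling, each dyadic piece of `F` has its spectrum in a fixed compact set away from the
origin. Since `Λ` is homogeneous of degree zero, the propagator does not see the rescaling, and the
factor `2^{3k/2}` is the Jacobian of the `L²` norm. It remains to bound `∫ e^{i(x·ξ + tΛ(ξ))} m(ξ)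
ĝ(ξ) dξ` by `⟨t⟩⁻¹` times weighted `L²` norms of at most three scaling fields applied to `g`; no
rotations are needed. The part of `⟨t⟩` near 1 comes from the trivial `L¹` bound on the spectrum.

Away from the vertical axis (`exists_offAxis_bound`) put `ξ = ρ(cos θ, sin θ, μ)`. The phase becomes
`ρ(c(θ) + x₃ μ) + t μ/√(1+μ²)`: it is linear in `ρ`, and the `μ`-derivative of the dispersive term
is at least `κ|t|`. If `|x₃|` is small compared with `|t|`, one integration by parts in `μ` gains
`1/|t|`. Otherwise two integrations by parts in `ρ` give the factor `(1 + (c + x₃ μ)²)⁻¹`, whose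
`μ`-integral is at most `π/|x₃|`, again of order `1/|t|` (`exists_oscillatory_bound_slope`). Radial
derivatives of `ĝ` are scaling fields, which the Fourier transform conjugates to `-(3 + S)`; the
single vertical derivative costs one power of `x₃`, which the `X` norm controls.

Near the vertical axis that change of variables degenerates. On a horizontal slice `ξ₃ = ζ`,
however, `Λ = ±(1+|η|²)^{-1/2}` with `η = ξ_h/|ζ|`, a function with nondegenerate Hessian near the
origin. Stationary phase in the plane (`norm_integral_plane_le`), carried out in polar coordinates
about the critical point, bounds the slice of the kernel by `C/|t|`, uniformly in the position and
in `ζ`. What remains is an `L¹` norm in the horizontal position and over bounded `ζ`. Cauchy–Schwarz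
with the weight `(1+|y|)^{2+β}`, whose inverse is integrable on the plane, and Plancherel on
vertical lines bound it by the quantity in the `Y` norm (`exists_nearAxis_bound`).

The rest of the support of `χ^v` lies off the axis, but there only horizontal weights are available.
Since `|ξ₃|` is bounded below, `ξ₃∂₃ = S - ξ₁∂₁ - ξ₂∂₂` replaces the vertical derivative by
horizontal ones and one more scaling field, the third (`norm_vert_le`).

The estimates are proved for smooth compactly supported `g`, extended by dilated truncations to
band-limited functions (`decay_of_bandlimited`), and rescaled (`exists_dyadic_decay`). The dyadic
norms control the power weight because `2^{(2+β)L}` against `2^{-2(1+β)L}` leaves the summable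
`2^{-βL}`. The second assertion sums over `k`: with `n₁ = 3` the bounds are `2^{-3|k|/2}`. -/

noncomputable section

namespace RotatingEuler

/-! ### One-dimensional oscillatory integrals -/

/-- Integration by parts against an oscillating exponential. -/
theorem norm_integral_exp_mul_deriv_le {a b : ℝ} (hab : a ≤ b) {p p' : ℝ → ℝ} {w w' : ℝ → ℂ}
    (hp : ∀ x ∈ Set.Icc a b, HasDerivAt p (p' x) x) (hp' : ContinuousOn p' (Set.Icc a b))
    (hw : ∀ x ∈ Set.Icc a b, HasDerivAt w (w' x) x) (hw' : ContinuousOn w' (Set.Icc a b)) :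
    ‖∫ x in a..b, Complex.exp (Complex.I * (p x : ℂ)) * ((p' x : ℂ) * w x)‖
      ≤ ‖w a‖ + ‖w b‖ + ∫ x in a..b, ‖w' x‖ := by
  have hE : ∀ x ∈ Set.Icc a b, HasDerivAt (fun x => -Complex.I * Complex.exp (Complex.I * (p x : ℂ)))
      (Complex.exp (Complex.I * (p x : ℂ)) * (p' x : ℂ)) x := by
    intro x hx
    have h1 : HasDerivAt (fun x => (p x : ℂ)) (p' x : ℂ) x := (hp x hx).ofReal_comp
    have h2 := ((h1.const_mul Complex.I).cexp).const_mul (-Complex.I)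
    refine h2.congr_deriv ?_
    linear_combination (-Complex.exp (Complex.I * (p x : ℂ)) * (p' x : ℂ)) * Complex.I_sq
  have hpc : ContinuousOn (fun x => Complex.exp (Complex.I * (p x : ℂ))) (Set.Icc a b) := by
    have : ContinuousOn p (Set.Icc a b) := fun x hx => (hp x hx).continuousAt.continuousWithinAt
    fun_prop
  have hp'c : ContinuousOn (fun x => (p' x : ℂ)) (Set.Icc a b) := by fun_prop
  have huIcc : Set.uIcc a b = Set.Icc a b := Set.uIcc_of_le hab
  have key := intervalIntegral.integral_deriv_mul_eq_sub (a := a) (b := b)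
    (u := fun x => -Complex.I * Complex.exp (Complex.I * (p x : ℂ))) (v := w)
    (u' := fun x => Complex.exp (Complex.I * (p x : ℂ)) * (p' x : ℂ)) (v' := w')
    (by rw [huIcc]; exact hE) (by rw [huIcc]; exact hw)
    (by apply ContinuousOn.intervalIntegrable; rw [huIcc]; exact hpc.mul hp'c)
    (by apply ContinuousOn.intervalIntegrable; rw [huIcc]; exact hw')
  have hwc : ContinuousOn w (Set.Icc a b) := fun x hx => (hw x hx).continuousAt.continuousWithinAt
  rw [intervalIntegral.integral_add] at key
  rotate_left
  · apply ContinuousOn.intervalIntegrable; rw [huIcc]; exact (hpc.mul hp'c).mul hwc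
  · apply ContinuousOn.intervalIntegrable; rw [huIcc]; exact (continuousOn_const.mul hpc).mul hw'
  have e1 : (∫ x in a..b, Complex.exp (Complex.I * (p x : ℂ)) * ((p' x : ℂ) * w x))
      = ∫ x in a..b, Complex.exp (Complex.I * (p x : ℂ)) * (p' x : ℂ) * w x := by
    simp only [mul_assoc]
  have hn : ∀ x, ‖Complex.exp (Complex.I * (p x : ℂ))‖ = 1 := fun x => by
    rw [mul_comm]; exact Complex.norm_exp_ofReal_mul_I _
  rw [e1, eq_sub_of_add_eq key]
  refine (norm_sub_le _ _).trans ?_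
  gcongr
  · refine (norm_sub_le _ _).trans ?_
    simp [hn, add_comm]
  · refine (intervalIntegral.norm_integral_le_integral_norm hab).trans (le_of_eq ?_)
    simp [hn]

/-- Non-stationary phase: one integration by parts for a compactly supported amplitude. -/
theorem norm_integral_exp_le_of_deriv_ge {a b : ℝ} (hab : a ≤ b) {p p' p'' : ℝ → ℝ} {u u' : ℝ → ℂ}
    {d D : ℝ} (hd : 0 < d)
    (hp : ∀ x, HasDerivAt p (p' x) x) (hp' : ∀ x, HasDerivAt p' (p'' x) x)
    (hp'' : Continuous p'')
    (hu : ∀ x, HasDerivAt u (u' x) x) (hu' : Continuous u')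
    (hlow : ∀ x ∈ Set.Icc a b, d ≤ |p' x|) (hup : ∀ x ∈ Set.Icc a b, |p'' x| ≤ D)
    (ha : u a = 0) (hb : u b = 0) :
    ‖∫ x in a..b, Complex.exp (Complex.I * (p x : ℂ)) * u x‖
      ≤ (∫ x in a..b, ‖u' x‖) / d + D * (∫ x in a..b, ‖u x‖) / d ^ 2 := by
  have huIcc : Set.uIcc a b = Set.Icc a b := Set.uIcc_of_le hab
  have hne : ∀ x ∈ Set.Icc a b, p' x ≠ 0 := fun x hx h => by
    have := hlow x hx; rw [h, abs_zero] at this; linarith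
  have hneC : ∀ x ∈ Set.Icc a b, (p' x : ℂ) ≠ 0 := fun x hx => by exact_mod_cast hne x hx
  have hcu : Continuous u := continuous_iff_continuousAt.2 fun x => (hu x).continuousAt
  have hcp' : Continuous p' := continuous_iff_continuousAt.2 fun x => (hp' x).continuousAt
  have hw : ∀ x ∈ Set.Icc a b, HasDerivAt (fun x => u x / (p' x : ℂ))
      ((u' x * (p' x : ℂ) - u x * (p'' x : ℂ)) / (p' x : ℂ) ^ 2) x := fun x hx =>
    (hu x).div (hp' x).ofReal_comp (hneC x hx)
  have hw'c : ContinuousOn (fun x => (u' x * (p' x : ℂ) - u x * (p'' x : ℂ)) / (p' x : ℂ) ^ 2)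
      (Set.Icc a b) := by
    apply ContinuousOn.div
    · fun_prop
    · fun_prop
    · intro x hx; exact pow_ne_zero _ (hneC x hx)
  have key := norm_integral_exp_mul_deriv_le hab (fun x _ => hp x) hcp'.continuousOn hw hw'c
  -- Writing `u = p' · (u/p')` puts the integrand in the form to which integration by parts applies.
  have e1 : (∫ x in a..b, Complex.exp (Complex.I * (p x : ℂ)) * u x)
      = ∫ x in a..b, Complex.exp (Complex.I * (p x : ℂ)) * ((p' x : ℂ) * (u x / (p' x : ℂ))) := by
    apply intervalIntegral.integral_congr
    intro x hx
    rw [huIcc] at hx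
    have := hneC x hx
    simp only
    field_simp
  rw [e1]
  refine key.trans ?_
  simp only [ha, hb, zero_div, norm_zero, zero_add]
  have hi : IntervalIntegrable (fun x => ‖u' x‖) volume a b := (by fun_prop : Continuous fun x => ‖u' x‖).intervalIntegrable _ _
  have hi2 : IntervalIntegrable (fun x => ‖u x‖) volume a b := (by fun_prop : Continuous fun x => ‖u x‖).intervalIntegrable _ _
  have : (∫ x in a..b, ‖u' x‖) / d + D * (∫ x in a..b, ‖u x‖) / d ^ 2
      = ∫ x in a..b, (‖u' x‖ * d⁻¹ + ‖u x‖ * (D / d ^ 2)) := by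
    rw [intervalIntegral.integral_add (hi.mul_const _) (hi2.mul_const _),
      intervalIntegral.integral_mul_const, intervalIntegral.integral_mul_const]
    ring
  rw [this]
  apply intervalIntegral.integral_mono_on hab
  · apply ContinuousOn.intervalIntegrable; rw [huIcc]; exact hw'c.norm
  · exact (hi.mul_const _).add (hi2.mul_const _)
  intro x hx
  have h1 := hlow x hx
  have h2 := hup x hx
  have h0 : 0 < |p' x| := hd.trans_le h1
  have e2 : (u' x * (p' x : ℂ) - u x * (p'' x : ℂ)) / (p' x : ℂ) ^ 2
      = u' x / (p' x : ℂ) - u x * ((p'' x : ℂ) / (p' x : ℂ) ^ 2) := by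
    have := hneC x hx
    field_simp
  rw [e2]
  refine (norm_sub_le _ _).trans ?_
  rw [norm_div, norm_mul, norm_div, norm_pow]
  simp only [Complex.norm_real, Real.norm_eq_abs]
  gcongr ?_ + ?_ * ?_
  · rw [div_eq_mul_inv]; gcongr
  · have : 0 ≤ D := (abs_nonneg _).trans h2
    gcongr

/-- `(1+Φ²)⁻¹` decay of the Fourier integral of a function vanishing to second order at the
end points. -/
theorem norm_integral_exp_linear_le {R : ℝ} (hR : 0 ≤ R) {u u₁ u₂ : ℝ → ℂ} (Φ : ℝ)
    (hu : ∀ x, HasDerivAt u (u₁ x) x) (hu₁ : ∀ x, HasDerivAt u₁ (u₂ x) x) (hu₂ : Continuous u₂)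
    (h0 : u 0 = 0) (hR0 : u R = 0) (h1 : u₁ 0 = 0) (hR1 : u₁ R = 0) :
    ‖∫ x in (0 : ℝ)..R, Complex.exp (Complex.I * ((x * Φ : ℝ) : ℂ)) * u x‖
      ≤ (1 + Φ ^ 2)⁻¹ * ∫ x in (0 : ℝ)..R, ‖u x - u₂ x‖ := by
  have hcu : Continuous u := continuous_iff_continuousAt.2 fun x => (hu x).continuousAt
  have hcu₁ : Continuous u₁ := continuous_iff_continuousAt.2 fun x => (hu₁ x).continuousAt
  set E : ℝ → ℂ := fun x => Complex.exp (Complex.I * ((x * Φ : ℝ) : ℂ)) with hEdef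
  have hE : ∀ x, HasDerivAt E (E x * (Complex.I * Φ)) x := by
    intro x
    have h1 : HasDerivAt (fun x : ℝ => ((x * Φ : ℝ) : ℂ)) (Φ : ℂ) x := by
      have := ((hasDerivAt_id x).mul_const Φ).ofReal_comp
      simpa using this
    exact (h1.const_mul Complex.I).cexp
  have hcE : Continuous E := continuous_iff_continuousAt.2 fun x => (hE x).continuousAt
  have ibp : ∀ v v' : ℝ → ℂ, (∀ x, HasDerivAt v (v' x) x) → Continuous v' → v 0 = 0 → v R = 0 →
      ∫ x in (0 : ℝ)..R, E x * v' x = -(Complex.I * Φ) * ∫ x in (0 : ℝ)..R, E x * v x := by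
    intro v v' hv hv' hv0 hvR
    have hcv : Continuous v := continuous_iff_continuousAt.2 fun x => (hv x).continuousAt
    rw [intervalIntegral.integral_mul_deriv_eq_deriv_mul (fun x _ => hE x) (fun x _ => hv x)
      (Continuous.intervalIntegrable (by fun_prop) _ _)
      (Continuous.intervalIntegrable (by fun_prop) _ _), hv0, hvR,
      ← intervalIntegral.integral_const_mul]
    simp only [mul_zero, sub_zero, zero_sub]
    rw [← intervalIntegral.integral_neg]
    congr 1; ext x; ring
  have h2 := ibp u₁ u₂ hu₁ hu₂ h1 hR1
  rw [ibp u u₁ hu hcu₁ h0 hR0] at h2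
  -- Two integrations by parts turn `u₂` into `-Φ² u` under the integral, so `u - u₂` carries
  -- exactly the factor `1 + Φ²`.
  have h3 : ∫ x in (0 : ℝ)..R, E x * (u x - u₂ x)
      = ((1 + Φ ^ 2 : ℝ) : ℂ) * ∫ x in (0 : ℝ)..R, E x * u x := by
    simp only [mul_sub]
    rw [intervalIntegral.integral_sub (Continuous.intervalIntegrable (by fun_prop) _ _)
      (Continuous.intervalIntegrable (by fun_prop) _ _), h2]
    push_cast
    linear_combination (-(Φ : ℂ) ^ 2 * ∫ x in (0 : ℝ)..R, E x * u x) * Complex.I_sq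
  have hpos : 0 < 1 + Φ ^ 2 := by positivity
  have h4 : ‖∫ x in (0 : ℝ)..R, E x * (u x - u₂ x)‖ ≤ ∫ x in (0 : ℝ)..R, ‖u x - u₂ x‖ := by
    refine (intervalIntegral.norm_integral_le_integral_norm hR).trans (le_of_eq ?_)
    congr 1; ext x
    rw [norm_mul, hEdef]
    simp only
    rw [mul_comm Complex.I, Complex.norm_exp_ofReal_mul_I, one_mul]
  rw [h3, norm_mul, Complex.norm_real, Real.norm_eq_abs, abs_of_pos hpos] at h4
  rw [inv_mul_eq_div, le_div_iff₀' hpos]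
  exact h4

/-- Change of the order of integration for a continuous function on a rectangle. -/
theorem intervalIntegral_swap_of_continuous {E : Type*} [NormedAddCommGroup E] [NormedSpace ℝ E]
    {f : ℝ → ℝ → E} (hf : Continuous (Function.uncurry f)) (a b c d : ℝ) :
    ∫ x in a..b, ∫ y in c..d, f x y = ∫ y in c..d, ∫ x in a..b, f x y := by
  apply intervalIntegral_intervalIntegral_swap
  apply (hf.continuousOn.integrableOn_compact (isCompact_uIcc.prod isCompact_uIcc)).mono_set
  exact Set.prod_mono Set.uIoc_subset_uIcc Set.uIoc_subset_uIcc

/-! ### The double integral in the radial and slope variables -/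

theorem hasDerivAt_slope_div_sqrt (μ : ℝ) :
    HasDerivAt (fun μ => μ / √(1 + μ ^ 2)) ((√(1 + μ ^ 2) ^ 3)⁻¹) μ := by
  have hpos : 0 < 1 + μ ^ 2 := by positivity
  have hs : 0 < √(1 + μ ^ 2) := Real.sqrt_pos.2 hpos
  have h1 : HasDerivAt (fun μ : ℝ => 1 + μ ^ 2) (2 * μ) μ := by
    simpa using (hasDerivAt_pow 2 μ).const_add 1
  have h2 := (hasDerivAt_id μ).div (h1.sqrt hpos.ne') hs.ne'
  refine h2.congr_deriv ?_
  have h3 : √(1 + μ ^ 2) ^ 2 = 1 + μ ^ 2 := Real.sq_sqrt hpos.le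
  simp only [id]
  field_simp
  linear_combination h3

theorem hasDerivAt_inv_sqrt_cube (μ : ℝ) :
    HasDerivAt (fun μ => (√(1 + μ ^ 2) ^ 3)⁻¹) (-(3 * μ / √(1 + μ ^ 2) ^ 5)) μ := by
  have hpos : 0 < 1 + μ ^ 2 := by positivity
  have hs : 0 < √(1 + μ ^ 2) := Real.sqrt_pos.2 hpos
  have h1 : HasDerivAt (fun μ : ℝ => 1 + μ ^ 2) (2 * μ) μ := by
    simpa using (hasDerivAt_pow 2 μ).const_add 1
  have h2 := ((h1.sqrt hpos.ne').pow 3).inv (pow_pos hs 3).ne'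
  refine h2.congr_deriv ?_
  simp only [Nat.cast_ofNat, Nat.reduceSub, Pi.pow_apply]
  field_simp

/-- The substitution `z = c + yμ` leaves a difference of arctangents. The bound depends neither on
`c` nor on the interval: a line of slope `y` stays near zero only for a length of order `1/|y|`. -/
theorem integral_inv_one_add_affine_sq_le {y : ℝ} (hy : y ≠ 0) (c a b : ℝ) :
    ∫ μ in a..b, (1 + (c + y * μ) ^ 2)⁻¹ ≤ Real.pi / |y| := by
  have h := intervalIntegral.integral_comp_add_mul (fun z : ℝ => (1 + z ^ 2)⁻¹) hy c (a := a) (b := b)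
  rw [h]
  have hz : ∀ a b : ℝ, |∫ z in a..b, (1 + z ^ 2)⁻¹| ≤ Real.pi := by
    intro a b
    rw [integral_inv_one_add_sq]
    have := Real.arctan_lt_pi_div_two b
    have := Real.neg_pi_div_two_lt_arctan b
    have := Real.arctan_lt_pi_div_two a
    have := Real.neg_pi_div_two_lt_arctan a
    rw [abs_le]; constructor <;> linarith
  refine (le_abs_self _).trans ?_
  rw [smul_eq_mul, abs_mul, abs_inv, inv_mul_eq_div]
  gcongr
  exact hz _ _

/-- Decay of the oscillatory integral with phase `ρ (c + y μ) + t μ/√(1+μ²)`. -/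
theorem exists_oscillatory_bound_slope (R M : ℝ) (hR : 0 < R) (hM : 0 < M) :
    ∃ C : ℝ, 0 < C ∧ ∀ (u u₁ u₂ v w : ℝ → ℝ → ℂ),
      (∀ ρ μ, HasDerivAt (fun ρ => u ρ μ) (u₁ ρ μ) ρ) →
      (∀ ρ μ, HasDerivAt (fun ρ => u₁ ρ μ) (u₂ ρ μ) ρ) →
      (∀ ρ μ, HasDerivAt (fun μ => u ρ μ) (v ρ μ) μ) →
      (∀ ρ μ, HasDerivAt (fun μ => u ρ μ - u₂ ρ μ) (w ρ μ) μ) →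
      Continuous (Function.uncurry u) → Continuous (Function.uncurry u₂) →
      Continuous (Function.uncurry v) → Continuous (Function.uncurry w) →
      (∀ μ, u 0 μ = 0) → (∀ μ, u₁ 0 μ = 0) → (∀ μ, u R μ = 0) → (∀ μ, u₁ R μ = 0) →
      (∀ ρ ∈ Set.Icc 0 R, u ρ (-M) = 0) → (∀ ρ ∈ Set.Icc 0 R, u ρ M = 0) →
      (∀ ρ ∈ Set.Icc 0 R, u₂ ρ (-M) = 0) →
      ∀ c y t : ℝ,
      |t| * ‖∫ ρ in (0 : ℝ)..R, ∫ μ in (-M)..M,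
          Complex.exp (Complex.I * ((ρ * (c + y * μ) + t * (μ / √(1 + μ ^ 2)) : ℝ) : ℂ)) * u ρ μ‖
        ≤ C * ∫ ρ in (0 : ℝ)..R, ∫ μ in (-M)..M, (‖u ρ μ‖ + ‖v ρ μ‖ + ‖w ρ μ‖) := by
  -- `κ` is the minimum over `[-M, M]` of `(1+μ²)^{-3/2}`, the derivative of `μ/√(1+μ²)`.
  set κ : ℝ := (√(1 + M ^ 2) ^ 3)⁻¹ with hκ
  have hκ0 : 0 < κ := by positivity
  refine ⟨2 * R / κ * Real.pi + (2 / κ + 12 * M / κ ^ 2), by positivity, ?_⟩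
  intro u u₁ u₂ v w hu hu₁ hv hw cu cu₂ cv cw h0 h10 hR0 h1R hm hM0 hm2 c y t
  set V := ∫ ρ in (0 : ℝ)..R, ∫ μ in (-M)..M, (‖u ρ μ‖ + ‖v ρ μ‖ + ‖w ρ μ‖) with hV
  have hMM : -M ≤ M := by linarith
  have hcont : Continuous (Function.uncurry fun ρ μ => ‖u ρ μ‖ + ‖v ρ μ‖ + ‖w ρ μ‖) := by
    have := cu.norm; have := cv.norm; have := cw.norm
    exact ((cu.norm).add cv.norm).add cw.norm
  have hV0 : 0 ≤ V := by
    apply intervalIntegral.integral_nonneg hR.le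
    intro ρ _
    apply intervalIntegral.integral_nonneg hMM
    intro μ _; positivity
  rcases eq_or_ne t 0 with rfl | ht
  · simp only [abs_zero, zero_mul]; positivity
  have ht' : 0 < |t| := abs_pos.2 ht
  have cE : Continuous (Function.uncurry fun ρ μ : ℝ =>
      Complex.exp (Complex.I * ((ρ * (c + y * μ) + t * (μ / √(1 + μ ^ 2)) : ℝ) : ℂ))) := by
    have : ∀ μ : ℝ, √(1 + μ ^ 2) ≠ 0 := fun μ => (Real.sqrt_pos.2 (by positivity)).ne'
    simp only [Function.uncurry_def]
    have h : Continuous fun p : ℝ × ℝ => p.2 / √(1 + p.2 ^ 2) :=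
      continuous_snd.div (by fun_prop) (fun p => this p.2)
    fun_prop
  have hle : ∀ z : ℝ, ‖Complex.exp (Complex.I * (z : ℂ))‖ = 1 := fun z => by
    rw [mul_comm]; exact Complex.norm_exp_ofReal_mul_I _
  -- The `μ`-derivative of the phase is `ρy + t(1+μ²)^{-3/2}`. The threshold makes the first term at
  -- most half of `|t|κ`, the lower bound for the second.
  by_cases hcase : R * |y| ≤ |t| * κ / 2
  · -- the vertical frequency derivative of the phase is large
    have hin : ∀ ρ ∈ Set.Icc 0 R, ‖∫ μ in (-M)..M,
          Complex.exp (Complex.I * ((ρ * (c + y * μ) + t * (μ / √(1 + μ ^ 2)) : ℝ) : ℂ)) * u ρ μ‖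
        ≤ (2 / κ + 12 * M / κ ^ 2) / |t| * ∫ μ in (-M)..M, (‖u ρ μ‖ + ‖v ρ μ‖ + ‖w ρ μ‖) := by
      intro ρ hρ
      have cuρ : Continuous (u ρ) := cu.uncurry_left ρ
      have cvρ : Continuous (v ρ) := cv.uncurry_left ρ
      have cwρ : Continuous (w ρ) := cw.uncurry_left ρ
      have hb := norm_integral_exp_le_of_deriv_ge hMM
        (p := fun μ => ρ * (c + y * μ) + t * (μ / √(1 + μ ^ 2)))
        (p' := fun μ => ρ * y + t * (√(1 + μ ^ 2) ^ 3)⁻¹)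
        (p'' := fun μ => t * (-(3 * μ / √(1 + μ ^ 2) ^ 5))) (u := u ρ) (u' := v ρ)
        (d := |t| * κ / 2) (D := 3 * M * |t|) (by positivity)
        (fun μ => by
          have h1 : HasDerivAt (fun μ => ρ * (c + y * μ)) (ρ * y) μ := by
            simpa using (((hasDerivAt_id μ).const_mul y).const_add c).const_mul ρ
          exact h1.add ((hasDerivAt_slope_div_sqrt μ).const_mul t))
        (fun μ => ((hasDerivAt_inv_sqrt_cube μ).const_mul t).const_add _)
        (by
          have : ∀ μ : ℝ, √(1 + μ ^ 2) ^ 5 ≠ 0 := fun μ => pow_ne_zero _ (Real.sqrt_pos.2 (by positivity)).ne'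
          have h : Continuous fun μ : ℝ => 3 * μ / √(1 + μ ^ 2) ^ 5 := Continuous.div (by fun_prop) (by fun_prop) this
          fun_prop)
        (hv ρ) cvρ ?_ ?_ (hm ρ hρ) (hM0 ρ hρ)
      · refine hb.trans ?_
        have iu : IntervalIntegrable (fun μ => ‖u ρ μ‖) volume (-M) M := cuρ.norm.intervalIntegrable _ _
        have iv : IntervalIntegrable (fun μ => ‖v ρ μ‖) volume (-M) M := cvρ.norm.intervalIntegrable _ _
        have iw : IntervalIntegrable (fun μ => ‖w ρ μ‖) volume (-M) M := cwρ.norm.intervalIntegrable _ _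
        rw [intervalIntegral.integral_add (iu.add iv) iw, intervalIntegral.integral_add iu iv]
        have nu : 0 ≤ ∫ μ in (-M)..M, ‖u ρ μ‖ := intervalIntegral.integral_nonneg hMM fun _ _ => norm_nonneg _
        have nv : 0 ≤ ∫ μ in (-M)..M, ‖v ρ μ‖ := intervalIntegral.integral_nonneg hMM fun _ _ => norm_nonneg _
        have nw : 0 ≤ ∫ μ in (-M)..M, ‖w ρ μ‖ := intervalIntegral.integral_nonneg hMM fun _ _ => norm_nonneg _
        set U := ∫ μ in (-M)..M, ‖u ρ μ‖
        set W := ∫ μ in (-M)..M, ‖v ρ μ‖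
        set X := ∫ μ in (-M)..M, ‖w ρ μ‖
        have e : W / (|t| * κ / 2) + 3 * M * |t| * U / (|t| * κ / 2) ^ 2
            = (2 / κ * W + 12 * M / κ ^ 2 * U) / |t| := by
          field_simp
          ring
        rw [e, div_mul_eq_mul_div (2 / κ + 12 * M / κ ^ 2)]
        refine div_le_div_of_nonneg_right ?_ ht'.le
        have : 0 ≤ 2 / κ := by positivity
        have : 0 ≤ 12 * M / κ ^ 2 := by positivity
        nlinarith [mul_nonneg (by positivity : 0 ≤ 2 / κ) nu, mul_nonneg (by positivity : 0 ≤ 2 / κ) nw,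
          mul_nonneg (by positivity : 0 ≤ 12 * M / κ ^ 2) nv, mul_nonneg (by positivity : 0 ≤ 12 * M / κ ^ 2) nw]
      · intro μ hμ
        have hk : κ ≤ (√(1 + μ ^ 2) ^ 3)⁻¹ := by
          rw [hκ]
          have hq : μ ^ 2 ≤ M ^ 2 := sq_le_sq' hμ.1 hμ.2
          have : 0 < √(1 + μ ^ 2) := Real.sqrt_pos.2 (by positivity)
          gcongr
        have h1 : |t| * κ ≤ |t * (√(1 + μ ^ 2) ^ 3)⁻¹| := by
          rw [abs_mul, abs_of_pos (by positivity : 0 < (√(1 + μ ^ 2) ^ 3)⁻¹)]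
          gcongr
        have h2 : |ρ * y| ≤ |t| * κ / 2 := by
          rw [abs_mul, abs_of_nonneg hρ.1]
          exact (mul_le_mul_of_nonneg_right hρ.2 (abs_nonneg y)).trans hcase
        have h3 := abs_sub_abs_le_abs_sub (t * (√(1 + μ ^ 2) ^ 3)⁻¹) (-(ρ * y))
        rw [abs_neg, sub_neg_eq_add, add_comm (t * _)] at h3
        linarith
      · intro μ hμ
        have h5 : 1 ≤ √(1 + μ ^ 2) ^ 5 := one_le_pow₀ (Real.one_le_sqrt.2 (by nlinarith [sq_nonneg μ]))
        have h6 : |μ| ≤ M := abs_le.2 hμ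
        rw [abs_mul, abs_neg, abs_div, abs_mul, abs_of_pos (by positivity : (0:ℝ) < √(1 + μ ^ 2) ^ 5),
          abs_of_pos (by norm_num : (0:ℝ) < 3), mul_comm]
        gcongr
        calc 3 * |μ| / √(1 + μ ^ 2) ^ 5 ≤ 3 * |μ| / 1 := by gcongr
          _ ≤ 3 * M := by linarith
    have hfin : ‖∫ ρ in (0 : ℝ)..R, ∫ μ in (-M)..M,
          Complex.exp (Complex.I * ((ρ * (c + y * μ) + t * (μ / √(1 + μ ^ 2)) : ℝ) : ℂ)) * u ρ μ‖
        ≤ (2 / κ + 12 * M / κ ^ 2) / |t| * V := by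
      rw [hV, ← intervalIntegral.integral_const_mul]
      apply intervalIntegral.norm_integral_le_of_norm_le hR.le
      · exact Filter.Eventually.of_forall fun ρ hρ => hin ρ ⟨hρ.1.le, hρ.2⟩
      · apply Continuous.intervalIntegrable
        exact continuous_const.mul
          (intervalIntegral.continuous_parametric_intervalIntegral_of_continuous' hcont _ _)
    calc _ ≤ |t| * ((2 / κ + 12 * M / κ ^ 2) / |t| * V) := by gcongr
      _ = (2 / κ + 12 * M / κ ^ 2) * V := by field_simp
      _ ≤ _ := by
        refine mul_le_mul_of_nonneg_right ?_ hV0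
        have : 0 ≤ 2 * R / κ * Real.pi := by positivity
        linarith
  · -- the integral over the radial variable localizes to a strip
    push Not at hcase
    have hy : y ≠ 0 := by
      rintro rfl
      rw [abs_zero, mul_zero] at hcase
      have : 0 < |t| * κ / 2 := by positivity
      linarith
    have hy' : 0 < |y| := abs_pos.2 hy
    rw [intervalIntegral_swap_of_continuous (f := fun ρ μ : ℝ => Complex.exp (Complex.I *
      ((ρ * (c + y * μ) + t * (μ / √(1 + μ ^ 2)) : ℝ) : ℂ)) * u ρ μ) (cE.mul cu)]
    -- A supremum over `μ` is bought with one `μ`-derivative: `u - u₂` vanishes at `-M`, so at every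
    -- `μ` it is an integral of `w`.
    have hW : ∀ μ ∈ Set.Icc (-M) M, ∫ ρ in (0 : ℝ)..R, ‖u ρ μ - u₂ ρ μ‖ ≤ V := by
      intro μ hμ
      rw [hV]
      have c2 : Continuous fun ρ => ‖u ρ μ - u₂ ρ μ‖ :=
        ((cu.uncurry_right μ).sub (cu₂.uncurry_right μ)).norm
      apply intervalIntegral.integral_mono_on hR.le (c2.intervalIntegrable _ _)
        ((intervalIntegral.continuous_parametric_intervalIntegral_of_continuous' hcont _ _).intervalIntegrable _ _)
      intro ρ hρ
      have cwρ : Continuous (w ρ) := cw.uncurry_left ρ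
      have h1 := intervalIntegral.integral_eq_sub_of_hasDerivAt (a := -M) (b := μ)
        (fun x _ => hw ρ x) (cwρ.intervalIntegrable _ _)
      rw [hm ρ hρ, hm2 ρ hρ, sub_zero, sub_zero] at h1
      rw [← h1]
      refine (intervalIntegral.norm_integral_le_integral_norm hμ.1).trans ?_
      have hc1 : Continuous fun μ => ‖u ρ μ‖ + ‖v ρ μ‖ + ‖w ρ μ‖ := hcont.uncurry_left ρ
      calc ∫ x in (-M)..μ, ‖w ρ x‖ ≤ ∫ x in (-M)..μ, (‖u ρ x‖ + ‖v ρ x‖ + ‖w ρ x‖) := by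
            apply intervalIntegral.integral_mono_on hμ.1 (cwρ.norm.intervalIntegrable _ _)
              (hc1.intervalIntegrable _ _)
            intro x _
            have := norm_nonneg (u ρ x); have := norm_nonneg (v ρ x); linarith
        _ ≤ _ := by
            apply intervalIntegral.integral_mono_interval le_rfl hμ.1 hμ.2
              (Filter.Eventually.of_forall fun x => by simp only [Pi.zero_apply]; positivity)
              (hc1.intervalIntegrable _ _)
    have hin : ∀ μ ∈ Set.Icc (-M) M, ‖∫ ρ in (0 : ℝ)..R,
          Complex.exp (Complex.I * ((ρ * (c + y * μ) + t * (μ / √(1 + μ ^ 2)) : ℝ) : ℂ)) * u ρ μ‖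
        ≤ (1 + (c + y * μ) ^ 2)⁻¹ * V := by
      intro μ hμ
      have h1 := norm_integral_exp_linear_le hR.le (c + y * μ) (fun x => hu x μ) (fun x => hu₁ x μ)
        (cu₂.uncurry_right μ) (h0 μ) (hR0 μ) (h10 μ) (h1R μ)
      have e : ∀ ρ, Complex.exp (Complex.I * ((ρ * (c + y * μ) + t * (μ / √(1 + μ ^ 2)) : ℝ) : ℂ)) * u ρ μ
          = Complex.exp (Complex.I * ((t * (μ / √(1 + μ ^ 2)) : ℝ) : ℂ)) *
            (Complex.exp (Complex.I * ((ρ * (c + y * μ) : ℝ) : ℂ)) * u ρ μ) := by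
        intro ρ
        rw [← mul_assoc, ← Complex.exp_add]
        congr 2
        push_cast; ring
      simp_rw [e]
      rw [intervalIntegral.integral_const_mul, norm_mul, hle, one_mul]
      refine h1.trans ?_
      gcongr
      exact hW μ hμ
    have hfin : ‖∫ μ in (-M)..M, ∫ ρ in (0 : ℝ)..R,
          Complex.exp (Complex.I * ((ρ * (c + y * μ) + t * (μ / √(1 + μ ^ 2)) : ℝ) : ℂ)) * u ρ μ‖
        ≤ Real.pi / |y| * V := by
      have hci : Continuous fun μ : ℝ => (1 + (c + y * μ) ^ 2)⁻¹ :=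
        Continuous.inv₀ (by fun_prop) fun μ => by positivity
      calc _ ≤ ∫ μ in (-M)..M, (1 + (c + y * μ) ^ 2)⁻¹ * V := by
            apply intervalIntegral.norm_integral_le_of_norm_le hMM
            · exact Filter.Eventually.of_forall fun μ hμ => hin μ ⟨hμ.1.le, hμ.2⟩
            · exact (hci.mul continuous_const).intervalIntegrable _ _
        _ = (∫ μ in (-M)..M, (1 + (c + y * μ) ^ 2)⁻¹) * V := intervalIntegral.integral_mul_const _ _
        _ ≤ _ := by
            gcongr
            exact integral_inv_one_add_affine_sq_le hy c _ _
    -- In this case `|y|` is bounded below by a multiple of `|t|`, which turns the gain `1/|y|` into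
    -- `1/|t|`.
    have ht2 : |t| ≤ 2 * R / κ * |y| := by
      rw [div_mul_eq_mul_div, le_div_iff₀ hκ0]
      linarith
    calc _ ≤ (2 * R / κ * |y|) * (Real.pi / |y| * V) := by gcongr
      _ = 2 * R / κ * Real.pi * V := by field_simp
      _ ≤ _ := by
        refine mul_le_mul_of_nonneg_right ?_ hV0
        have : 0 ≤ 2 / κ + 12 * M / κ ^ 2 := by positivity
        linarith

/-! ### Coordinates on `ℝ³`: Cartesian, polar and slope -/

/-- The point of `ℝ³` with the given coordinates. -/
def pt (a b c : ℝ) : E3 := !₂[a, b, c]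

@[simp] theorem pt_zero (a b c : ℝ) : pt a b c 0 = a := rfl
@[simp] theorem pt_one (a b c : ℝ) : pt a b c 1 = b := rfl
@[simp] theorem pt_two (a b c : ℝ) : pt a b c 2 = c := rfl

theorem smul_pt (r a b c : ℝ) : r • pt a b c = pt (r * a) (r * b) (r * c) := by
  ext i; fin_cases i <;> simp [pt]

theorem inner_eq_sum (x y : E3) : inner ℝ x y = x 0 * y 0 + x 1 * y 1 + x 2 * y 2 := by
  simp [PiLp.inner_apply, Fin.sum_univ_three, mul_comm]

theorem norm_sq_eq_sum (x : E3) : ‖x‖ ^ 2 = x 0 ^ 2 + x 1 ^ 2 + x 2 ^ 2 := by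
  rw [EuclideanSpace.norm_sq_eq, Fin.sum_univ_three]; simp

theorem horiz_sq (x : E3) : horiz x ^ 2 = x 0 ^ 2 + x 1 ^ 2 := Real.sq_sqrt (by positivity)

theorem horiz_nonneg (x : E3) : 0 ≤ horiz x := Real.sqrt_nonneg _

@[fun_prop]
theorem continuous_horiz : Continuous horiz := by unfold horiz; fun_prop

/-- `ℝ³` as the product of the vertical line and the horizontal plane. -/
def ptEquiv : ℝ × ℝ × ℝ ≃ᵐ E3 :=
  ((MeasurableEquiv.refl ℝ).prodCongr MeasurableEquiv.finTwoArrow.symm).trans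
    ((MeasurableEquiv.piFinSuccAbove (fun _ => ℝ) 2).symm.trans (MeasurableEquiv.toLp 2 (Fin 3 → ℝ)))

theorem ptEquiv_apply (p : ℝ × ℝ × ℝ) : ptEquiv p = pt p.2.1 p.2.2 p.1 := by
  ext i
  fin_cases i <;> rfl

theorem measurePreserving_ptEquiv : MeasurePreserving ptEquiv := by
  have h1 : MeasurePreserving (MeasurableEquiv.finTwoArrow (α := ℝ)).symm :=
    (volume_preserving_finTwoArrow ℝ).symm
  have h2 : MeasurePreserving (MeasurableEquiv.piFinSuccAbove (fun _ : Fin 3 => ℝ) 2).symm :=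
    (volume_preserving_piFinSuccAbove (fun _ : Fin 3 => ℝ) 2).symm
  have h3 : MeasurePreserving (MeasurableEquiv.toLp 2 (Fin 3 → ℝ)) :=
    PiLp.volume_preserving_toLp (Fin 3)
  exact h3.comp (h2.comp ((MeasurePreserving.id volume).prod h1))

theorem integral_ptEquiv {E : Type*} [NormedAddCommGroup E] [NormedSpace ℝ E] (f : E3 → E) :
    ∫ p : ℝ × ℝ × ℝ, f (pt p.2.1 p.2.2 p.1) = ∫ x, f x := by
  rw [← measurePreserving_ptEquiv.integral_comp ptEquiv.measurableEmbedding f]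
  simp only [ptEquiv_apply]

theorem integrable_ptEquiv {E : Type*} [NormedAddCommGroup E] {f : E3 → E}
    (hf : Integrable f) : Integrable fun p : ℝ × ℝ × ℝ => f (pt p.2.1 p.2.2 p.1) := by
  have := (measurePreserving_ptEquiv.integrable_comp_emb ptEquiv.measurableEmbedding).2 hf
  simpa only [Function.comp_def, ptEquiv_apply] using this

/-- Fubini: first the vertical, then the horizontal variables. -/
theorem integral_eq_integral_horizontal_vertical {E : Type*} [NormedAddCommGroup E] [NormedSpace ℝ E]
    {f : E3 → E} (hf : Integrable f) :
    ∫ x, f x = ∫ p : ℝ × ℝ, ∫ c : ℝ, f (pt p.1 p.2 c) := by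
  rw [← integral_ptEquiv]
  exact integral_prod_symm _ (integrable_ptEquiv hf)

@[fun_prop]
theorem continuous_pt {X : Type*} [TopologicalSpace X] {a b c : X → ℝ} (ha : Continuous a)
    (hb : Continuous b) (hc : Continuous c) : Continuous fun x => pt (a x) (b x) (c x) := by
  unfold pt; fun_prop

/-- Polar coordinates for a continuous function supported in a disc. -/
theorem integral_eq_polar {E : Type*} [NormedAddCommGroup E] [NormedSpace ℝ E]
    {g : ℝ × ℝ → E} (hg : Continuous g) {R : ℝ} (hR : 0 ≤ R)
    (hsupp : ∀ p : ℝ × ℝ, R ^ 2 < p.1 ^ 2 + p.2 ^ 2 → g p = 0) :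
    ∫ p, g p = ∫ θ in (-Real.pi)..Real.pi, ∫ r in (0 : ℝ)..R,
      r • g (r * Real.cos θ, r * Real.sin θ) := by
  have hpi : -Real.pi ≤ Real.pi := by linarith [Real.pi_pos]
  set F : ℝ × ℝ → E := fun p => p.1 • g (p.1 * Real.cos p.2, p.1 * Real.sin p.2) with hF
  have hFc : Continuous F := by fun_prop
  have h1 : ∫ p, g p = ∫ p in Set.Ioi (0 : ℝ) ×ˢ Set.Ioo (-Real.pi) Real.pi, F p := by
    rw [← integral_comp_polarCoord_symm]
    rfl
  have h2 : ∫ p in Set.Ioi (0 : ℝ) ×ˢ Set.Ioo (-Real.pi) Real.pi, F p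
      = ∫ p in Set.Ioc (0 : ℝ) R ×ˢ Set.Ioo (-Real.pi) Real.pi, F p := by
    apply setIntegral_eq_of_subset_of_forall_sdiff_eq_zero
    · exact measurableSet_Ioi.prod measurableSet_Ioo
    · exact Set.prod_mono Set.Ioc_subset_Ioi_self le_rfl
    · rintro ⟨r, θ⟩ ⟨h, h'⟩
      simp only [Set.mem_prod, Set.mem_Ioi, Set.mem_Ioc, not_and] at h h'
      have hr : R < r := by
        by_contra hr
        exact h' ⟨h.1, not_lt.1 hr⟩ h.2
      have : g (r * Real.cos θ, r * Real.sin θ) = 0 := by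
        apply hsupp
        have : (r * Real.cos θ) ^ 2 + (r * Real.sin θ) ^ 2 = r ^ 2 := by
          linear_combination r ^ 2 * Real.sin_sq_add_cos_sq θ
        simp only [this]
        gcongr
      simp [hF, this]
  have hint : IntegrableOn F (Set.Ioc (0 : ℝ) R ×ˢ Set.Ioo (-Real.pi) Real.pi) :=
    (hFc.continuousOn.integrableOn_compact (isCompact_Icc.prod isCompact_Icc)).mono_set
      (Set.prod_mono Set.Ioc_subset_Icc_self Set.Ioo_subset_Icc_self)
  rw [h1, h2, Measure.volume_eq_prod, setIntegral_prod _ hint,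
    intervalIntegral_swap_of_continuous (f := fun θ r => r • g (r * Real.cos θ, r * Real.sin θ))
      (by simp only [Function.uncurry_def]; fun_prop),
    intervalIntegral.integral_of_le hR]
  refine integral_congr_ae (Filter.Eventually.of_forall fun r => ?_)
  simp only
  rw [intervalIntegral.integral_of_le hpi, integral_Ioc_eq_integral_Ioo]

/-- The integral in the coordinates `ξ = ρ (cos θ, sin θ, μ)`. -/
theorem integral_eq_slope_coords {E : Type*} [NormedAddCommGroup E] [NormedSpace ℝ E]
    {f : E3 → E} (hf : Continuous f) {c₁ c₃ R M : ℝ} (hR : 0 ≤ R)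
    (hM : 0 ≤ M) (hMc : c₃ < M * c₁)
    (hsupp : ∀ ξ, f ξ ≠ 0 → c₁ ≤ horiz ξ ∧ horiz ξ ≤ R ∧ |ξ 2| ≤ c₃) :
    ∫ ξ, f ξ = ∫ θ in (-Real.pi)..Real.pi, ∫ ρ in (0 : ℝ)..R, ∫ μ in (-M)..M,
      ρ ^ 2 • f (ρ • pt (Real.cos θ) (Real.sin θ) μ) := by
  have hcs : HasCompactSupport f := by
    apply HasCompactSupport.intro (isCompact_closedBall (0 : E3) (R + |c₃|))
    intro ξ hξ
    by_contra hne
    obtain ⟨-, h2, h3⟩ := hsupp ξ hne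
    apply hξ
    rw [mem_closedBall_zero_iff]
    apply abs_le_of_sq_le_sq' _ (by positivity) |>.2
    rw [norm_sq_eq_sum, ← horiz_sq, ← sq_abs (ξ 2)]
    have := horiz_nonneg ξ
    have := h3.trans (le_abs_self c₃)
    nlinarith [abs_nonneg (ξ 2), abs_nonneg c₃]
  have hi : Integrable f := hf.integrable_of_hasCompactSupport hcs
  have hz : ∀ a b c, f (pt a b c) ≠ 0 → -(|c₃|) ≤ c ∧ c ≤ |c₃| := by
    intro a b c h
    have := (hsupp _ h).2.2.trans (le_abs_self c₃)
    exact abs_le.1 this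
  have hvert : ∀ p : ℝ × ℝ, ∫ c : ℝ, f (pt p.1 p.2 c) = ∫ c in (-(|c₃| + 1))..(|c₃| + 1), f (pt p.1 p.2 c) := by
    intro p
    rw [intervalIntegral.integral_of_le (by have := abs_nonneg c₃; linarith)]
    symm
    apply setIntegral_eq_integral_of_forall_compl_eq_zero
    intro c hc
    by_contra hne
    have := hz _ _ _ hne
    exact hc ⟨by linarith, by linarith⟩
  rw [integral_eq_integral_horizontal_vertical hi, integral_eq_polar _ hR]
  · refine intervalIntegral.integral_congr fun θ _ => ?_
    simp only
    apply intervalIntegral.integral_congr_ae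
    refine Filter.Eventually.of_forall fun ρ hρ => ?_
    rw [Set.uIoc_of_le hR] at hρ
    have hρ0 : 0 < ρ := hρ.1
    have e1 : ∀ μ, f (ρ • pt (Real.cos θ) (Real.sin θ) μ)
        = f (pt (ρ * Real.cos θ) (ρ * Real.sin θ) (ρ * μ)) := fun μ => by rw [smul_pt]
    simp only [e1]
    -- The substitution `ξ₃ = ρμ` supplies the second factor of the density `ρ²`; the first comes
    -- from polar coordinates.
    have e2 := Measure.integral_comp_mul_left
      (fun c => f (pt (ρ * Real.cos θ) (ρ * Real.sin θ) c)) ρ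
    rw [abs_of_pos (inv_pos.2 hρ0)] at e2
    rw [intervalIntegral.integral_smul, intervalIntegral.integral_of_le (by linarith),
      setIntegral_eq_integral_of_forall_compl_eq_zero, e2, smul_smul]
    · congr 1; field_simp
    · intro μ hμ
      by_contra hne
      obtain ⟨h1, h2, h3⟩ := hsupp _ hne
      have hh : horiz (pt (ρ * Real.cos θ) (ρ * Real.sin θ) (ρ * μ)) = ρ := by
        rw [horiz, pt_zero, pt_one,
          show (ρ * Real.cos θ) ^ 2 + (ρ * Real.sin θ) ^ 2 = ρ ^ 2 by
            linear_combination ρ ^ 2 * Real.sin_sq_add_cos_sq θ, Real.sqrt_sq hρ0.le]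
      rw [hh] at h1
      rw [pt_two, abs_mul, abs_of_pos hρ0] at h3
      -- Outside `(-M, M]` one has `|ξ₃| = ρ|μ| ≥ c₁M > c₃`, so truncating the slope loses nothing.
      have hμM : M ≤ |μ| := by
        by_contra hlt
        rw [not_le, abs_lt] at hlt
        exact hμ ⟨hlt.1, hlt.2.le⟩
      have := mul_le_mul h1 hμM hM hρ0.le
      linarith
  · intro p hp
    rw [← integral_zero ℝ E]
    congr 1; ext c
    by_contra hne
    have h2 := (hsupp _ hne).2.1
    have h3 := horiz_sq (pt p.1 p.2 c)
    have := horiz_nonneg (pt p.1 p.2 c)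
    simp only [pt_zero, pt_one] at h3
    nlinarith
  · simp only [hvert]
    apply intervalIntegral.continuous_parametric_intervalIntegral_of_continuous'
      (f := fun (p : ℝ × ℝ) c => f (pt p.1 p.2 c))
    simp only [Function.uncurry_def]
    fun_prop

/-! ### The scaling field, the vertical derivative and decay off the vertical axis -/

theorem contDiff_scal {f : E3 → ℂ} (hf : ContDiff ℝ (⊤ : ℕ∞) f) : ContDiff ℝ (⊤ : ℕ∞) (scal f) := by
  unfold scal
  have : ContDiff ℝ (⊤ : ℕ∞) (fderiv ℝ f) := hf.fderiv_right (by simp)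
  exact this.clm_apply contDiff_id

theorem contDiff_iterate_scal {f : E3 → ℂ} (hf : ContDiff ℝ (⊤ : ℕ∞) f) (a : ℕ) :
    ContDiff ℝ (⊤ : ℕ∞) (scal^[a] f) := by
  induction a with
  | zero => exact hf
  | succ a ih => rw [Function.iterate_succ_apply']; exact contDiff_scal ih

theorem fderiv_eq_zero_of_support {f : E3 → ℂ} {K : Set E3} (hK : IsClosed K)
    (hf : ∀ ξ, f ξ ≠ 0 → ξ ∈ K) {ξ : E3} (hξ : ξ ∉ K) : fderiv ℝ f ξ = 0 := by
  have h : f =ᶠ[nhds ξ] fun _ => 0 := by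
    filter_upwards [hK.isOpen_compl.mem_nhds hξ] with η hη
    by_contra hne
    exact hη (hf η hne)
  rw [h.fderiv_eq]; simp

theorem iterate_scal_support {f : E3 → ℂ} {K : Set E3} (hK : IsClosed K)
    (hf : ∀ ξ, f ξ ≠ 0 → ξ ∈ K) (a : ℕ) (ξ : E3) (h : (scal^[a] f) ξ ≠ 0) : ξ ∈ K := by
  induction a generalizing ξ with
  | zero => exact hf ξ h
  | succ a ih =>
    by_contra hξ
    rw [Function.iterate_succ_apply'] at h
    exact h (by rw [scal, fderiv_eq_zero_of_support hK ih hξ]; simp)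

/-- The derivative in the third variable. -/
def vert (f : E3 → ℂ) (ξ : E3) : ℂ := fderiv ℝ f ξ (pt 0 0 1)

theorem contDiff_vert {f : E3 → ℂ} (hf : ContDiff ℝ (⊤ : ℕ∞) f) : ContDiff ℝ (⊤ : ℕ∞) (vert f) := by
  unfold vert
  have : ContDiff ℝ (⊤ : ℕ∞) (fderiv ℝ f) := hf.fderiv_right (by simp)
  exact this.clm_apply contDiff_const

/-- Multiplied by `ρ`, this derivative is `scal f` at `ρ • e`; hence radial integrations by parts
cost only scaling fields. -/
theorem hasDerivAt_radial {f : E3 → ℂ} (hf : Differentiable ℝ f) (e : E3) (ρ : ℝ) :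
    HasDerivAt (fun ρ : ℝ => f (ρ • e)) (fderiv ℝ f (ρ • e) e) ρ := by
  have h := (hf (ρ • e)).hasFDerivAt.comp_hasDerivAt ρ ((hasDerivAt_id ρ).smul_const e)
  exact h.congr_deriv (by simp)

theorem hasDerivAt_slope {f : E3 → ℂ} (hf : Differentiable ℝ f) (ρ a b μ : ℝ) :
    HasDerivAt (fun μ : ℝ => f (ρ • pt a b μ)) (ρ * vert f (ρ • pt a b μ)) μ := by
  have h0 : HasDerivAt (fun μ : ℝ => ρ • pt a b μ) (ρ • pt 0 0 1) μ := by
    have h1 : (fun μ : ℝ => ρ • pt a b μ) = fun μ : ℝ => ρ • pt a b 0 + μ • (ρ • pt 0 0 1) := by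
      ext μ i; fin_cases i <;> simp [pt, mul_comm]
    rw [h1]
    simpa using ((hasDerivAt_id μ).smul_const (ρ • pt 0 0 1)).const_add (ρ • pt a b 0)
  have h := (hf (ρ • pt a b μ)).hasFDerivAt.comp_hasDerivAt μ h0
  exact h.congr_deriv (by simp [vert])

theorem contDiffAt_Lam {ξ : E3} (hξ : ξ ≠ 0) : ContDiffAt ℝ (⊤ : ℕ∞) Lam ξ := by
  unfold Lam
  have h1 : ContDiffAt ℝ (⊤ : ℕ∞) (fun ξ : E3 => ξ 2) ξ := by fun_prop
  exact h1.div (contDiffAt_norm ℝ hξ) (norm_ne_zero_iff.2 hξ)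

/-- The oscillating factor `e^{i(x·ξ + tΛ(ξ))}`. -/
def osc (x : E3) (t : ℝ) (ξ : E3) : ℂ :=
  Complex.exp (Complex.I * ((inner ℝ x ξ + t * Lam ξ : ℝ) : ℂ))

theorem norm_osc (x : E3) (t : ℝ) (ξ : E3) : ‖osc x t ξ‖ = 1 := by
  rw [osc, mul_comm]; exact Complex.norm_exp_ofReal_mul_I _

/-- `Λ` is singular only at the origin, and a neighbourhood of the origin misses the closed set `K`
that carries `m`. -/
theorem contDiff_osc_mul (x : E3) (t : ℝ) {m : E3 → ℂ} (hm : ContDiff ℝ (⊤ : ℕ∞) m)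
    {K : Set E3} (hK : IsClosed K) (h0 : (0 : E3) ∉ K) (hmK : ∀ ξ, m ξ ≠ 0 → ξ ∈ K) :
    ContDiff ℝ (⊤ : ℕ∞) fun ξ => osc x t ξ * m ξ := by
  rw [contDiff_iff_contDiffAt]
  intro ξ
  by_cases hξ : ξ = 0
  · subst hξ
    have h : (fun ξ => osc x t ξ * m ξ) =ᶠ[nhds 0] fun _ => 0 := by
      filter_upwards [hK.isOpen_compl.mem_nhds h0] with η hη
      have : m η = 0 := by
        by_contra hne
        exact hη (hmK η hne)
      simp [this]
    exact contDiffAt_const.congr_of_eventuallyEq h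
  · unfold osc
    have h1 := contDiffAt_Lam hξ
    have h2 : ContDiffAt ℝ (⊤ : ℕ∞) (fun ξ : E3 => inner ℝ x ξ + t * Lam ξ) ξ :=
      (contDiffAt_const.inner ℝ contDiffAt_id).add (contDiffAt_const.mul h1)
    have h3 : ContDiffAt ℝ (⊤ : ℕ∞) (fun ξ : E3 => ((inner ℝ x ξ + t * Lam ξ : ℝ) : ℂ)) ξ :=
      Complex.ofRealCLM.contDiff.contDiffAt.comp ξ h2
    exact ((contDiffAt_const.mul h3).cexp).mul hm.contDiffAt

/-- Dispersive bound away from the vertical axis. -/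
theorem exists_offAxis_bound {c₁ c₂ c₃ : ℝ} (hc₁ : 0 < c₁) (hc₂ : 0 < c₂) (hc₃ : 0 < c₃) :
    ∃ C : ℝ, 0 < C ∧ ∀ H : E3 → ℂ, ContDiff ℝ (⊤ : ℕ∞) H →
      (∀ ξ, H ξ ≠ 0 → c₁ ≤ horiz ξ ∧ horiz ξ ≤ c₂ ∧ |ξ 2| ≤ c₃) → ∀ (x : E3) (t : ℝ),
      |t| * ‖∫ ξ, osc x t ξ * H ξ‖
        ≤ C * ∫ ξ, ∑ j ∈ Finset.range 3, (‖(scal^[j] H) ξ‖ + ‖vert (scal^[j] H) ξ‖) := by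
  -- Both `R` and `M` leave room beyond the support: at `ρ = R`, and at `μ = ±M` where `Mc₁ = c₃ +
  -- 1`, the point lies outside `K`, so the amplitude vanishes there with its derivatives. At `ρ =
  -- 0` this follows from `c₁ > 0`.
  set R := c₂ + 1 with hRdef
  have hR : 0 < R := by positivity
  set M := (c₃ + 1) / c₁ with hMdef
  have hM : 0 < M := by positivity
  have hMc : c₃ < M * c₁ := by rw [hMdef, div_mul_cancel₀ _ hc₁.ne']; linarith
  obtain ⟨C, hC, hmain⟩ := exists_oscillatory_bound_slope R M hR hM
  refine ⟨C * (1 + 2 * R + 3 / c₁), by positivity, ?_⟩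
  intro H hH hsupp x t
  set K : Set E3 := {ξ | c₁ ≤ horiz ξ ∧ horiz ξ ≤ c₂ ∧ |ξ 2| ≤ c₃} with hKdef
  have hK : IsClosed K := by
    apply (isClosed_le continuous_const continuous_horiz).inter
    apply (isClosed_le continuous_horiz continuous_const).inter
    exact isClosed_le (f := fun ξ : E3 => |ξ 2|) (by fun_prop) continuous_const
  have hK0 : (0 : E3) ∉ K := by
    rintro ⟨h, -⟩
    have : horiz 0 = 0 := by simp [horiz]
    linarith
  have smj : ∀ j, ContDiff ℝ (⊤ : ℕ∞) (scal^[j] H) := contDiff_iterate_scal hH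
  have dj : ∀ j, Differentiable ℝ (scal^[j] H) := fun j => (smj j).differentiable (by simp)
  have cj : ∀ j, Continuous (scal^[j] H) := fun j => (smj j).continuous
  have cvj : ∀ j, Continuous (vert (scal^[j] H)) := fun j => (contDiff_vert (smj j)).continuous
  have hz : ∀ j ξ, ξ ∉ K → (scal^[j] H) ξ = 0 := fun j ξ h => by
    by_contra hne; exact h (iterate_scal_support hK hsupp j ξ hne)
  have hzv : ∀ j ξ, ξ ∉ K → vert (scal^[j] H) ξ = 0 := fun j ξ h => by
    rw [vert, fderiv_eq_zero_of_support hK (iterate_scal_support hK hsupp j) h]; simp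
  set Q : E3 → ℝ := fun ξ => ∑ j ∈ Finset.range 3, (‖(scal^[j] H) ξ‖ + ‖vert (scal^[j] H) ξ‖) with hQ
  have hQc : Continuous Q := by
    apply continuous_finsetSum
    intro j _
    exact (cj j).norm.add (cvj j).norm
  have hQ0 : ∀ ξ, 0 ≤ Q ξ := fun ξ => Finset.sum_nonneg fun j _ => by positivity
  have hcoordK : ∀ θ ρ μ, 0 ≤ ρ → horiz (ρ • pt (Real.cos θ) (Real.sin θ) μ) = ρ := by
    intro θ ρ μ hρ
    rw [smul_pt, horiz, pt_zero, pt_one,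
      show (ρ * Real.cos θ) ^ 2 + (ρ * Real.sin θ) ^ 2 = ρ ^ 2 by
        linear_combination ρ ^ 2 * Real.sin_sq_add_cos_sq θ, Real.sqrt_sq hρ]
  have hin : ∀ ξ, Q ξ ≠ 0 → c₁ ≤ horiz ξ ∧ horiz ξ ≤ c₂ ∧ |ξ 2| ≤ c₃ := by
    intro ξ hne
    by_contra hξ
    apply hne
    simp [hQ, hz _ ξ hξ, hzv _ ξ hξ]
  have hQR : ∀ ξ, Q ξ ≠ 0 → c₁ ≤ horiz ξ ∧ horiz ξ ≤ R ∧ |ξ 2| ≤ c₃ := fun ξ h =>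
    ⟨(hin ξ h).1, (hin ξ h).2.1.trans (by linarith), (hin ξ h).2.2⟩
  have hoscR : ∀ ξ, osc x t ξ * H ξ ≠ 0 → c₁ ≤ horiz ξ ∧ horiz ξ ≤ R ∧ |ξ 2| ≤ c₃ := fun ξ h => by
    have := hsupp ξ (right_ne_zero_of_mul h)
    exact ⟨this.1, this.2.1.trans (by linarith), this.2.2⟩
  have hQint := integral_eq_slope_coords hQc hR.le hM.le hMc hQR
  have hHint := integral_eq_slope_coords (contDiff_osc_mul x t hH hK hK0 hsupp).continuous
    hR.le hM.le hMc hoscR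
  have hangle : ∀ θ : ℝ, |t| * ‖∫ ρ in (0 : ℝ)..R, ∫ μ in (-M)..M,
      ρ ^ 2 • (osc x t (ρ • pt (Real.cos θ) (Real.sin θ) μ) * H (ρ • pt (Real.cos θ) (Real.sin θ) μ))‖
      ≤ C * (1 + 2 * R + 3 / c₁) * ∫ ρ in (0 : ℝ)..R, ∫ μ in (-M)..M,
        ρ ^ 2 • Q (ρ • pt (Real.cos θ) (Real.sin θ) μ) := by
    intro θ
    set e : ℝ → E3 := fun μ => pt (Real.cos θ) (Real.sin θ) μ with he
    have ce : Continuous fun p : ℝ × ℝ => p.1 • e p.2 := by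
      simp only [he]; fun_prop
    have cjp : ∀ j, Continuous fun p : ℝ × ℝ => (scal^[j] H) (p.1 • e p.2) := fun j => (cj j).comp ce
    have cvjp : ∀ j, Continuous fun p : ℝ × ℝ => vert (scal^[j] H) (p.1 • e p.2) :=
      fun j => (cvj j).comp ce
    have hsmul : ∀ (ρ μ : ℝ) j, (ρ : ℂ) * fderiv ℝ (scal^[j] H) (ρ • e μ) (e μ)
        = (scal^[j + 1] H) (ρ • e μ) := by
      intro ρ μ j
      rw [Function.iterate_succ_apply', scal, map_smul]
      simp
    have hofr : ∀ ρ : ℝ, HasDerivAt (fun ρ : ℝ => (ρ : ℂ)) 1 ρ := fun ρ => Complex.ofRealCLM.hasDerivAt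
    have hout : ∀ ρ μ, ρ = 0 ∨ ρ = R → ρ • e μ ∉ K := by
      rintro ρ μ h ⟨h1, h2, -⟩
      have hρ0 : 0 ≤ ρ := by rcases h with rfl | rfl <;> linarith
      rw [hcoordK θ ρ μ hρ0] at h1 h2
      rcases h with rfl | rfl <;> linarith
    have houtM : ∀ ρ μ : ℝ, 0 ≤ ρ → μ = M ∨ μ = -M → ρ • e μ ∉ K := by
      rintro ρ μ hρ h ⟨h1, -, h3⟩
      rw [hcoordK θ ρ μ hρ] at h1
      have : |μ| = M := by rcases h with rfl | rfl <;> simp [abs_of_pos hM]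
      rw [smul_pt, pt_two, abs_mul, abs_of_nonneg hρ, this] at h3
      have := mul_le_mul_of_nonneg_right h1 hM.le
      linarith
    -- The amplitude is `ρ²H`, with `ρ²` the Jacobian. As `ρ d/dρ` acts as `S`, its second radial
    -- derivative is `2H + 3SH + S²H`, without negative powers of `ρ`.
    have key := hmain
      (fun ρ μ => (ρ : ℂ) ^ 2 * H (ρ • e μ))
      (fun ρ μ => (ρ : ℂ) * (2 * H (ρ • e μ) + (scal^[1] H) (ρ • e μ)))
      (fun ρ μ => 2 * H (ρ • e μ) + 3 * (scal^[1] H) (ρ • e μ) + (scal^[2] H) (ρ • e μ))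
      (fun ρ μ => (ρ : ℂ) ^ 2 * (ρ * vert H (ρ • e μ)))
      (fun ρ μ => (ρ : ℂ) ^ 2 * (ρ * vert H (ρ • e μ)) - (2 * (ρ * vert H (ρ • e μ))
        + 3 * (ρ * vert (scal^[1] H) (ρ • e μ)) + ρ * vert (scal^[2] H) (ρ • e μ)))
      (fun ρ μ => by
        have h1 := ((hofr ρ).pow 2).mul (hasDerivAt_radial (dj 0) (e μ) ρ)
        refine h1.congr_deriv ?_
        have := hsmul ρ μ 0
        simp only [zero_add] at this
        simp only [Nat.cast_ofNat, Nat.reduceSub, Function.iterate_zero, id, Pi.pow_apply] at this ⊢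
        rw [← this]
        ring)
      (fun ρ μ => by
        have h1 := (hofr ρ).mul (((hasDerivAt_radial (dj 0) (e μ) ρ).const_mul 2).add
          (hasDerivAt_radial (dj 1) (e μ) ρ))
        refine h1.congr_deriv ?_
        have h2 := hsmul ρ μ 0
        have h3 := hsmul ρ μ 1
        simp only [zero_add, Nat.reduceAdd] at h2 h3
        rw [← h3]
        simp only [Function.iterate_zero, id, Pi.add_apply] at h2 ⊢
        linear_combination 2 * h2)
      (fun ρ μ => (hasDerivAt_slope (dj 0) ρ _ _ μ).const_mul _)
      (fun ρ μ => ((hasDerivAt_slope (dj 0) ρ _ _ μ).const_mul _).sub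
        ((((hasDerivAt_slope (dj 0) ρ _ _ μ).const_mul _).add
          ((hasDerivAt_slope (dj 1) ρ _ _ μ).const_mul _)).add (hasDerivAt_slope (dj 2) ρ _ _ μ)))
      (by simp only [Function.uncurry_def]; have := cjp 0; simp only [Function.iterate_zero, id] at this; fun_prop)
      (by
        simp only [Function.uncurry_def]; have := cjp 0; have := cjp 1; have := cjp 2
        simp only [Function.iterate_zero, id] at *; fun_prop)
      (by simp only [Function.uncurry_def]; have := cvjp 0; simp only [Function.iterate_zero, id] at this; fun_prop)
      (by
        simp only [Function.uncurry_def]; have := cvjp 0; have := cvjp 1; have := cvjp 2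
        simp only [Function.iterate_zero, id] at *; fun_prop)
      (fun μ => by simp) (fun μ => by simp)
      (fun μ => by
        have := hz 0 _ (hout R μ (Or.inr rfl))
        simp only [Function.iterate_zero, id] at this
        simp [this])
      (fun μ => by
        have h1 := hz 0 _ (hout R μ (Or.inr rfl))
        have h2 := hz 1 _ (hout R μ (Or.inr rfl))
        simp only [Function.iterate_zero, id] at h1
        rw [h1, h2]; simp)
      (fun ρ hρ => by
        have := hz 0 _ (houtM ρ (-M) hρ.1 (Or.inr rfl))
        simp only [Function.iterate_zero, id] at this
        rw [this]; simp)
      (fun ρ hρ => by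
        have := hz 0 _ (houtM ρ M hρ.1 (Or.inl rfl))
        simp only [Function.iterate_zero, id] at this
        rw [this]; simp)
      (fun ρ hρ => by
        have h1 := hz 0 _ (houtM ρ (-M) hρ.1 (Or.inr rfl))
        have h2 := hz 1 _ (houtM ρ (-M) hρ.1 (Or.inr rfl))
        have h3 := hz 2 _ (houtM ρ (-M) hρ.1 (Or.inr rfl))
        simp only [Function.iterate_zero, id] at h1
        rw [h1, h2, h3]; simp)
      (x 0 * Real.cos θ + x 1 * Real.sin θ) (x 2) t
    have e1 : (∫ ρ in (0 : ℝ)..R, ∫ μ in (-M)..M,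
        ρ ^ 2 • (osc x t (ρ • e μ) * H (ρ • e μ)))
        = ∫ ρ in (0 : ℝ)..R, ∫ μ in (-M)..M, Complex.exp (Complex.I *
          ((ρ * (x 0 * Real.cos θ + x 1 * Real.sin θ + x 2 * μ) + t * (μ / √(1 + μ ^ 2)) : ℝ) : ℂ))
          * ((ρ : ℂ) ^ 2 * H (ρ • e μ)) := by
      apply intervalIntegral.integral_congr_ae
      refine Filter.Eventually.of_forall fun ρ hρ => ?_
      rw [Set.uIoc_of_le hR.le] at hρ
      refine intervalIntegral.integral_congr fun μ _ => ?_
      -- Homogeneity of degree zero: `Λ` depends on the slope alone, so the phase is linear in `ρ`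
      -- up to a term free of `ρ`.
      have hL : Lam (ρ • e μ) = μ / √(1 + μ ^ 2) := by
        have hn : ‖ρ • e μ‖ = ρ * √(1 + μ ^ 2) := by
          rw [norm_smul, Real.norm_eq_abs, abs_of_pos hρ.1]
          congr 1
          rw [← Real.sqrt_sq (norm_nonneg _), norm_sq_eq_sum]
          congr 1
          simp only [he, pt_zero, pt_one, pt_two]
          linear_combination Real.sin_sq_add_cos_sq θ
        rw [Lam, hn, he]
        simp only [smul_pt, pt_two]
        exact mul_div_mul_left _ _ hρ.1.ne'
      have hI : inner ℝ x (ρ • e μ) = ρ * (x 0 * Real.cos θ + x 1 * Real.sin θ + x 2 * μ) := by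
        rw [inner_eq_sum]
        simp only [he, smul_pt, pt_zero, pt_one, pt_two]
        ring
      simp only [osc, hL, hI, Complex.real_smul]
      push_cast
      ring
    rw [e1]
    refine key.trans ?_
    rw [mul_assoc]
    refine mul_le_mul_of_nonneg_left ?_ hC.le
    rw [← intervalIntegral.integral_const_mul]
    have cQp : Continuous fun p : ℝ × ℝ => Q (p.1 • e p.2) := hQc.comp ce
    have cn1 : Continuous (Function.uncurry fun ρ μ : ℝ => ‖(ρ : ℂ) ^ 2 * H (ρ • e μ)‖ +
        ‖(ρ : ℂ) ^ 2 * (ρ * vert H (ρ • e μ))‖ +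
        ‖(ρ : ℂ) ^ 2 * (ρ * vert H (ρ • e μ)) - (2 * (ρ * vert H (ρ • e μ))
        + 3 * (ρ * vert (scal^[1] H) (ρ • e μ)) + ρ * vert (scal^[2] H) (ρ • e μ))‖) := by
      simp only [Function.uncurry_def]
      have := cjp 0; have := cvjp 0; have := cvjp 1; have := cvjp 2
      simp only [Function.iterate_zero, id] at *; fun_prop
    have cn2 : Continuous (Function.uncurry fun ρ μ : ℝ => ρ ^ 2 • Q (ρ • e μ)) := by
      simp only [Function.uncurry_def]; fun_prop
    apply intervalIntegral.integral_mono_on hR.le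
    · exact (intervalIntegral.continuous_parametric_intervalIntegral_of_continuous' cn1 _ _).intervalIntegrable _ _
    · exact (continuous_const.mul
        (intervalIntegral.continuous_parametric_intervalIntegral_of_continuous' cn2 _ _)).intervalIntegrable _ _
    intro ρ hρ
    rw [← intervalIntegral.integral_const_mul]
    apply intervalIntegral.integral_mono_on (by linarith)
    · exact (cn1.uncurry_left ρ).intervalIntegrable _ _
    · exact (continuous_const.mul (cn2.uncurry_left ρ)).intervalIntegrable _ _
    intro μ _
    by_cases hξ : ρ • e μ ∈ K
    · have hρ1 : c₁ ≤ ρ := by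
        have := hξ.1; rwa [hcoordK θ ρ μ hρ.1] at this
      have hρ0 : 0 < ρ := hc₁.trans_le hρ1
      have hρR : ρ ≤ R := hρ.2
      -- On the support `c₁ ≤ ρ ≤ R`, so the powers `ρ` and `ρ³` of the amplitudes are comparable
      -- with the Jacobian `ρ²`; this produces the factor `1 + 2R + 3/c₁`.
      have b1 : ρ ≤ ρ ^ 2 / c₁ := by
        rw [le_div_iff₀ hc₁]; nlinarith
      have b2 : ρ ^ 3 ≤ R * ρ ^ 2 := by nlinarith [sq_nonneg ρ]
      have n1 : ‖(ρ : ℂ)‖ = ρ := by rw [Complex.norm_real, Real.norm_eq_abs, abs_of_pos hρ0]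
      have hQe : Q (ρ • e μ) = ‖H (ρ • e μ)‖ + ‖vert H (ρ • e μ)‖
          + (‖(scal^[1] H) (ρ • e μ)‖ + ‖vert (scal^[1] H) (ρ • e μ)‖)
          + (‖(scal^[2] H) (ρ • e μ)‖ + ‖vert (scal^[2] H) (ρ • e μ)‖) := by
        simp [hQ, Finset.sum_range_succ]
      have tri : ‖(ρ : ℂ) ^ 2 * (ρ * vert H (ρ • e μ)) - (2 * (ρ * vert H (ρ • e μ))
          + 3 * (ρ * vert (scal^[1] H) (ρ • e μ)) + ρ * vert (scal^[2] H) (ρ • e μ))‖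
          ≤ ρ ^ 3 * ‖vert H (ρ • e μ)‖ + (2 * (ρ * ‖vert H (ρ • e μ)‖)
          + 3 * (ρ * ‖vert (scal^[1] H) (ρ • e μ)‖) + ρ * ‖vert (scal^[2] H) (ρ • e μ)‖) := by
        refine (norm_sub_le _ _).trans ?_
        gcongr ?_ + ?_
        · simp only [norm_mul, norm_pow, n1]; exact le_of_eq (by ring)
        · refine (norm_add_le _ _).trans ?_
          gcongr ?_ + ?_
          · refine (norm_add_le _ _).trans ?_
            simp [abs_of_pos hρ0]
          · simp [abs_of_pos hρ0]
      have t1 : ‖(ρ : ℂ) ^ 2 * H (ρ • e μ)‖ = ρ ^ 2 * ‖H (ρ • e μ)‖ := by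
        simp only [norm_mul, norm_pow, n1]
      have t2 : ‖(ρ : ℂ) ^ 2 * (ρ * vert H (ρ • e μ))‖ = ρ ^ 3 * ‖vert H (ρ • e μ)‖ := by
        simp only [norm_mul, norm_pow, n1]; ring
      have hA0 : 0 ≤ ‖H (ρ • e μ)‖ := norm_nonneg _
      have hA1 : 0 ≤ ‖(scal^[1] H) (ρ • e μ)‖ := norm_nonneg _
      have hA2 : 0 ≤ ‖(scal^[2] H) (ρ • e μ)‖ := norm_nonneg _
      have hv0 : 0 ≤ ‖vert H (ρ • e μ)‖ := norm_nonneg _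
      have hv1 : 0 ≤ ‖vert (scal^[1] H) (ρ • e μ)‖ := norm_nonneg _
      have hv2 : 0 ≤ ‖vert (scal^[2] H) (ρ • e μ)‖ := norm_nonneg _
      rw [t1, t2, smul_eq_mul, hQe]
      refine (add_le_add_right tri _).trans ?_
      generalize ‖H (ρ • e μ)‖ = A0 at *
      generalize ‖(scal^[1] H) (ρ • e μ)‖ = A1 at *
      generalize ‖(scal^[2] H) (ρ • e μ)‖ = A2 at *
      generalize ‖vert H (ρ • e μ)‖ = v0 at *
      generalize ‖vert (scal^[1] H) (ρ • e μ)‖ = v1 at *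
      generalize ‖vert (scal^[2] H) (ρ • e μ)‖ = v2 at *
      have hk : 0 < 1 / c₁ := by positivity
      rw [div_eq_mul_one_div] at b1
      rw [div_eq_mul_one_div 3 c₁]
      generalize 1 / c₁ = k at *
      calc _ ≤ ρ ^ 2 * A0 + R * ρ ^ 2 * v0 + (R * ρ ^ 2 * v0 + (2 * (ρ ^ 2 * k * v0)
            + 3 * (ρ ^ 2 * k * v1) + ρ ^ 2 * k * v2)) := by gcongr
        _ ≤ _ := by
          rw [← sub_nonneg]
          have : (1 + 2 * R + 3 * k) * (ρ ^ 2 * (A0 + v0 + (A1 + v1) + (A2 + v2)))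
              - (ρ ^ 2 * A0 + R * ρ ^ 2 * v0 + (R * ρ ^ 2 * v0 + (2 * (ρ ^ 2 * k * v0)
              + 3 * (ρ ^ 2 * k * v1) + ρ ^ 2 * k * v2)))
              = ρ ^ 2 * ((2 * R + 3 * k) * A0 + (1 + k) * v0 + (1 + 2 * R) * v1
                + (1 + 2 * R + 2 * k) * v2 + (1 + 2 * R + 3 * k) * (A1 + A2)) := by ring
          rw [this]
          positivity
    · have h0 := hz 0 _ hξ
      have g0 := hzv 0 _ hξ
      simp only [Function.iterate_zero, id] at h0 g0
      rw [h0, g0, hzv 1 _ hξ, hzv 2 _ hξ]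
      simp only [mul_zero, norm_zero, add_zero, sub_zero]
      have := hQ0 (ρ • e μ)
      rw [smul_eq_mul]
      positivity
  have hosc_c : Continuous fun θ : ℝ => ∫ ρ in (0 : ℝ)..R, ∫ μ in (-M)..M,
        ρ ^ 2 • Q (ρ • pt (Real.cos θ) (Real.sin θ) μ) := by
    apply intervalIntegral.continuous_parametric_intervalIntegral_of_continuous'
      (f := fun θ ρ => ∫ μ in (-M)..M, ρ ^ 2 • Q (ρ • pt (Real.cos θ) (Real.sin θ) μ))
    simp only [Function.uncurry_def]
    apply intervalIntegral.continuous_parametric_intervalIntegral_of_continuous'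
      (f := fun (p : ℝ × ℝ) μ => p.2 ^ 2 • Q (p.2 • pt (Real.cos p.1) (Real.sin p.1) μ))
    simp only [Function.uncurry_def]
    fun_prop
  rw [hHint, hQint, ← intervalIntegral.integral_const_mul]
  have hpi : -Real.pi ≤ Real.pi := by linarith [Real.pi_pos]
  rw [← Real.norm_eq_abs, ← norm_smul, ← intervalIntegral.integral_smul]
  apply intervalIntegral.norm_integral_le_of_norm_le hpi
  · refine Filter.Eventually.of_forall fun θ _ => ?_
    rw [norm_smul, Real.norm_eq_abs]
    exact hangle θ
  · exact (continuous_const.mul hosc_c).intervalIntegrable _ _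

/-! ### Stationary phase in the plane for `w·η + (1+|η|²)^{-1/2}` -/

theorem hasDerivAt_sqrt_quadratic {Q b τ : ℝ} (h : 0 < Q + 2 * b * τ + τ ^ 2) :
    HasDerivAt (fun τ => √(Q + 2 * b * τ + τ ^ 2)) ((b + τ) / √(Q + 2 * b * τ + τ ^ 2)) τ := by
  have h1 : HasDerivAt (fun τ : ℝ => Q + 2 * b * τ + τ ^ 2) (2 * b + 2 * τ) τ := by
    have := (((hasDerivAt_id τ).const_mul (2 * b)).const_add Q).add (hasDerivAt_pow 2 τ)
    exact this.congr_deriv (by simp)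
  refine (h1.sqrt h.ne').congr_deriv ?_
  have : 0 < √(Q + 2 * b * τ + τ ^ 2) := Real.sqrt_pos.2 h
  field_simp

/-- The oscillatory integral along a ray issuing from a (near-)critical point of the phase,
with the planar surface measure `τ dτ`. -/
theorem norm_integral_ray_le {Q b T δ t A : ℝ} {P : ℝ → ℝ} {a a' : ℝ → ℂ}
    (hQ : b ^ 2 ≤ Q - 1) (hT : 0 < T) (hT2 : T ≤ 2)
    (hq : ∀ τ ∈ Set.Icc 0 T, Q + 2 * b * τ + τ ^ 2 ≤ 34 / 25) (hδ : δ ≤ 0)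
    (hP : ∀ τ, HasDerivAt P (δ + b / √Q ^ 3 - (b + τ) / √(Q + 2 * b * τ + τ ^ 2) ^ 3) τ)
    (ha : ∀ τ, HasDerivAt a (a' τ) τ) (ha' : Continuous a')
    (hA : ∀ τ, ‖a τ‖ ≤ A) (hA' : ∀ τ, ‖a' τ‖ ≤ A) (haT : a T = 0)
    (haδ : ∀ τ ∈ Set.Icc 0 T, a τ ≠ 0 → δ = 0 ∨ 1 / 10 ≤ τ) :
    |t| * ‖∫ τ in (0 : ℝ)..T, Complex.exp (Complex.I * ((t * P τ : ℝ) : ℂ)) * ((τ : ℂ) * a τ)‖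
      ≤ 2030 * A := by
  have hA0 : 0 ≤ A := (norm_nonneg _).trans (hA 0)
  have hqle : ∀ τ, (b + τ) ^ 2 ≤ Q + 2 * b * τ + τ ^ 2 - 1 := fun τ => by nlinarith
  have hqpos : ∀ τ, 0 < Q + 2 * b * τ + τ ^ 2 := fun τ => by nlinarith [hqle τ, sq_nonneg (b + τ)]
  set S : ℝ → ℝ := fun τ => √(Q + 2 * b * τ + τ ^ 2) with hS
  have hSpos : ∀ τ, 0 < S τ := fun τ => Real.sqrt_pos.2 (hqpos τ)
  have hSsq : ∀ τ, S τ ^ 2 = Q + 2 * b * τ + τ ^ 2 := fun τ => Real.sq_sqrt (hqpos τ).le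
  have hSd : ∀ τ, HasDerivAt S ((b + τ) / S τ) τ := fun τ => hasDerivAt_sqrt_quadratic (hqpos τ)
  have hS1 : ∀ τ, 1 ≤ S τ := fun τ => by
    have h1 := hSsq τ; have h2 := hqle τ; nlinarith [hSpos τ, sq_nonneg (b + τ)]
  have hSc : Continuous S := by simp only [hS]; fun_prop
  have hS0 : S 0 = √Q := by simp [hS]
  have hbd : ∀ τ : ℝ, HasDerivAt (fun τ => b + τ) 1 τ := fun τ => (hasDerivAt_id τ).const_add b
  -- the derivative of the phase, up to the constant `δ`
  set g : ℝ → ℝ := fun τ => b / √Q ^ 3 - (b + τ) / S τ ^ 3 with hg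
  set g₁ : ℝ → ℝ := fun τ => -(1 / S τ ^ 3) + 3 * (b + τ) ^ 2 / S τ ^ 5 with hg₁
  set g₂ : ℝ → ℝ := fun τ => 9 * (b + τ) / S τ ^ 5 - 15 * (b + τ) ^ 3 / S τ ^ 7 with hg₂
  have hgd : ∀ τ, HasDerivAt g (g₁ τ) τ := fun τ => by
    have h := ((hbd τ).div ((hSd τ).pow 3) (pow_pos (hSpos τ) 3).ne').const_sub (b / √Q ^ 3)
    refine h.congr_deriv ?_
    have := hSpos τ
    simp only [hg₁, Pi.pow_apply, Nat.cast_ofNat, Nat.reduceSub]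
    field_simp
    ring
  have hg₁d : ∀ τ, HasDerivAt g₁ (g₂ τ) τ := fun τ => by
    have h := (((hasDerivAt_const τ (1:ℝ)).div ((hSd τ).pow 3) (pow_pos (hSpos τ) 3).ne').neg).add
      ((((hbd τ).pow 2).const_mul 3).div ((hSd τ).pow 5) (pow_pos (hSpos τ) 5).ne')
    refine h.congr_deriv ?_
    have := hSpos τ
    simp only [hg₂, Pi.pow_apply, Nat.cast_ofNat, Nat.reduceSub]
    field_simp
    ring
  have hg₁c : Continuous g₁ := continuous_iff_continuousAt.2 fun τ => (hg₁d τ).continuousAt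
  have hgc : Continuous g := continuous_iff_continuousAt.2 fun τ => (hgd τ).continuousAt
  have hg0 : g 0 = 0 := by simp [hg, hS0]
  have hSup : ∀ τ ∈ Set.Icc 0 T, S τ ≤ 117 / 100 := fun τ hτ => by
    have h1 := hSsq τ; have h2 := hq τ hτ; nlinarith [hSpos τ]
  have hbτ : ∀ τ ∈ Set.Icc 0 T, |b + τ| ≤ 3 / 5 := fun τ hτ => by
    apply abs_le_of_sq_le_sq _ (by norm_num)
    have h1 := hqle τ; have h2 := hq τ hτ; linarith
  -- The second derivative along the ray is `(-S² + 3(b+τ)²)/S⁵ ≤ (2S² - 3)/S⁵`, which is negative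
  -- where `|η|² = S² - 1 < 1/2`. With `S² ≤ 34/25` the numerator is at most `-7/25`, and `S⁵ ≤
  -- (117/100)⁵` gives `-1/10`.
  have hg₁le : ∀ τ ∈ Set.Icc 0 T, g₁ τ ≤ -(1 / 10) := fun τ hτ => by
    have h1 := hSsq τ; have h2 := hq τ hτ; have h3 := hqle τ
    have e : g₁ τ = (-(S τ ^ 2) + 3 * (b + τ) ^ 2) / S τ ^ 5 := by
      have := hSpos τ
      simp only [hg₁]; field_simp
    have h5 : S τ ^ 5 ≤ (117 / 100) ^ 5 := pow_le_pow_left₀ (hSpos τ).le (hSup τ hτ) 5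
    rw [e, div_le_iff₀ (pow_pos (hSpos τ) 5), h1]
    norm_num at h5
    linarith
  have hg₂le : ∀ τ ∈ Set.Icc 0 T, |g₂ τ| ≤ 9 := fun τ hτ => by
    have h1 := hbτ τ hτ
    have h5 : 1 ≤ S τ ^ 5 := one_le_pow₀ (hS1 τ)
    have h7 : 1 ≤ S τ ^ 7 := one_le_pow₀ (hS1 τ)
    have t1 : |9 * (b + τ) / S τ ^ 5| ≤ 9 * (3 / 5) := by
      rw [abs_div, abs_mul, abs_of_pos (by norm_num : (0:ℝ) < 9), abs_of_pos (pow_pos (hSpos τ) 5)]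
      apply (div_le_self (by positivity) h5).trans; linarith
    have t2 : |15 * (b + τ) ^ 3 / S τ ^ 7| ≤ 15 * (3 / 5) ^ 3 := by
      rw [abs_div, abs_mul, abs_of_pos (by norm_num : (0:ℝ) < 15), abs_of_pos (pow_pos (hSpos τ) 7), abs_pow]
      apply (div_le_self (by positivity) h7).trans
      gcongr
    refine (abs_sub _ _).trans ?_
    norm_num at t2
    linarith
  have hgle : ∀ τ ∈ Set.Icc 0 T, g τ ≤ -(τ / 10) := fun τ hτ => by
    have h := (convex_Icc (0 : ℝ) T).image_sub_le_mul_sub_of_deriv_le hgc.continuousOn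
      (fun x _ => (hgd x).differentiableAt.differentiableWithinAt)
      (C := -(1 / 10)) (fun x hx => by rw [(hgd x).deriv]; exact hg₁le x (interior_subset hx))
      0 ⟨le_rfl, hT.le⟩ τ hτ hτ.1
    rw [hg0] at h; linarith
  -- `g - τg'` has derivative `-τg''`, hence is quadratic in `τ`. This cancellation keeps the
  -- derivative of `τ/p` bounded up to `τ = 0`, although `p` may vanish there.
  have hrem : ∀ τ ∈ Set.Icc 0 T, |g τ - τ * g₁ τ| ≤ 9 * τ ^ 2 := fun τ hτ => by
    have hF : ∀ x ∈ Set.Icc (0 : ℝ) τ, HasDerivWithinAt (fun x => g x - x * g₁ x) (-(x * g₂ x)) (Set.Icc 0 τ) x := by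
      intro x _
      have h := (hgd x).sub ((hasDerivAt_id x).mul (hg₁d x))
      exact (h.congr_deriv (by simp)).hasDerivWithinAt
    have h := norm_image_sub_le_of_norm_deriv_le_segment' hF (C := 9 * τ) (fun x hx => by
      rw [norm_neg, norm_mul, Real.norm_eq_abs, Real.norm_eq_abs, abs_of_nonneg hx.1]
      have := hg₂le x ⟨hx.1, hx.2.le.trans hτ.2⟩
      have := abs_nonneg (g₂ x)
      nlinarith [hx.1, hx.2]) τ ⟨hτ.1, le_rfl⟩
    simp only [hg0, zero_mul, sub_zero, Real.norm_eq_abs] at h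
    linarith
  set p : ℝ → ℝ := fun τ => δ + g τ with hp
  have hpP : ∀ τ, HasDerivAt P (p τ) τ := fun τ => (hP τ).congr_deriv (by simp only [hp, hg, hS]; ring)
  have hpd : ∀ τ, HasDerivAt p (g₁ τ) τ := fun τ => (hgd τ).const_add δ
  have hpneg : ∀ τ ∈ Set.Icc 0 T, τ / 10 ≤ -p τ ∧ -δ ≤ -p τ := fun τ hτ => by
    have := hgle τ hτ
    have := hτ.1
    simp only [hp]; constructor <;> linarith
  have hac : Continuous a := continuous_iff_continuousAt.2 fun τ => (ha τ).continuousAt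
  have hPc : Continuous P := continuous_iff_continuousAt.2 fun τ => (hP τ).continuousAt
  have hpc : Continuous p := continuous_const.add hgc
  -- The possible zero of `p` at `τ = 0` is compensated by the factor `τ` of the surface measure.
  -- Integration by parts is done on `[ε, T]`, with a boundary term at `ε` bounded independently of
  -- `ε`.
  have hmain : ∀ ε ∈ Set.Ioc 0 T, |t| * ‖∫ τ in ε..T,
      Complex.exp (Complex.I * ((t * P τ : ℝ) : ℂ)) * ((τ : ℂ) * a τ)‖ ≤ 2030 * A := by
    intro ε hε
    have hsub : ∀ τ ∈ Set.Icc ε T, τ ∈ Set.Icc 0 T ∧ 0 < τ := fun τ hτ =>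
      ⟨⟨hε.1.le.trans hτ.1, hτ.2⟩, hε.1.trans_le hτ.1⟩
    have hpne : ∀ τ ∈ Set.Icc ε T, p τ < 0 := fun τ hτ => by
      have := (hpneg τ (hsub τ hτ).1).1; have := (hsub τ hτ).2; linarith
    have hpneC : ∀ τ ∈ Set.Icc ε T, (p τ : ℂ) ≠ 0 := fun τ hτ => by
      exact_mod_cast (hpne τ hτ).ne
    set w : ℝ → ℂ := fun τ => (τ : ℂ) * a τ / (p τ : ℂ) with hw
    set w' : ℝ → ℂ := fun τ => ((a τ + τ * a' τ) * (p τ : ℂ) - τ * a τ * (g₁ τ : ℂ)) / (p τ : ℂ) ^ 2 with hw'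
    have hwd : ∀ τ ∈ Set.Icc ε T, HasDerivAt w (w' τ) τ := fun τ hτ => by
      have h1 : HasDerivAt (fun τ : ℝ => (τ : ℂ)) 1 τ := Complex.ofRealCLM.hasDerivAt
      exact ((h1.mul (ha τ)).div (hpd τ).ofReal_comp (hpneC τ hτ)).congr_deriv (by simp [hw'])
    have hwc : ContinuousOn w' (Set.Icc ε T) := by
      apply ContinuousOn.div
      · fun_prop
      · fun_prop
      · intro τ hτ; exact pow_ne_zero _ (hpneC τ hτ)
    have hwn : ∀ τ ∈ Set.Icc ε T, ‖w τ‖ ≤ 10 * A := fun τ hτ => by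
      obtain ⟨h1, h2⟩ := hsub τ hτ
      have h3 := (hpneg τ h1).1
      have h4 := hpne τ hτ
      simp only [hw, norm_div, norm_mul, Complex.norm_real, Real.norm_eq_abs, abs_of_pos h2, abs_of_neg h4]
      rw [div_le_iff₀ (by linarith)]
      have := hA τ
      nlinarith [norm_nonneg (a τ)]
    have hw'n : ∀ τ ∈ Set.Icc ε T, ‖w' τ‖ ≤ 1010 * A := fun τ hτ => by
      obtain ⟨h1, h2⟩ := hsub τ hτ
      obtain ⟨h3, h3'⟩ := hpneg τ h1
      have h4 := hpne τ hτ
      have e : w' τ = τ * a' τ / p τ + a τ * (((p τ - τ * g₁ τ) / p τ ^ 2 : ℝ) : ℂ) := by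
        have := hpneC τ hτ
        simp only [hw']; push_cast; field_simp; ring
      have b1 : ‖(τ : ℂ) * a' τ / p τ‖ ≤ 10 * A := by
        simp only [norm_div, norm_mul, Complex.norm_real, Real.norm_eq_abs, abs_of_pos h2, abs_of_neg h4]
        rw [div_le_iff₀ (by linarith)]
        have := hA' τ
        nlinarith [norm_nonneg (a' τ)]
      have b2 : ‖a τ * (((p τ - τ * g₁ τ) / p τ ^ 2 : ℝ) : ℂ)‖ ≤ 1000 * A := by
        rcases eq_or_ne (a τ) 0 with h0 | h0
        · rw [h0, zero_mul, norm_zero]; positivity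
        rw [norm_mul, Complex.norm_real, Real.norm_eq_abs, abs_div, abs_of_nonneg (sq_nonneg (p τ))]
        have hpsq : τ ^ 2 ≤ 100 * p τ ^ 2 := by nlinarith
        have hnum : |p τ - τ * g₁ τ| ≤ -δ + 9 * τ ^ 2 := by
          have : p τ - τ * g₁ τ = δ + (g τ - τ * g₁ τ) := by simp only [hp]; ring
          rw [this]
          refine (abs_add_le _ _).trans ?_
          rw [abs_of_nonpos hδ]
          linarith [hrem τ h1]
        -- If `δ ≠ 0` then `τ ≥ 1/10` on the support, so `-p ≥ 1/100` and `-δ ≤ -p ≤ 100p²`.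
        have hδ' : -δ ≤ 100 * p τ ^ 2 := by
          rcases haδ τ h1 h0 with h | h
          · rw [h]; simp only [neg_zero]; positivity
          · nlinarith
        have hq' : |p τ - τ * g₁ τ| / p τ ^ 2 ≤ 1000 := by
          rw [div_le_iff₀ (by have := h4.ne; positivity)]
          linarith
        calc _ ≤ A * 1000 := mul_le_mul (hA τ) hq' (by positivity) hA0
          _ = _ := by ring
      rw [e]
      refine (norm_add_le _ _).trans ?_
      linarith
    have key := norm_integral_exp_mul_deriv_le hε.2 (p := fun τ => t * P τ) (p' := fun τ => t * p τ)
      (fun τ _ => (hpP τ).const_mul t) (by fun_prop) hwd hwc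
    have e1 : ∫ τ in ε..T, Complex.exp (Complex.I * ((t * P τ : ℝ) : ℂ)) * (((t * p τ : ℝ) : ℂ) * w τ)
        = t * ∫ τ in ε..T, Complex.exp (Complex.I * ((t * P τ : ℝ) : ℂ)) * ((τ : ℂ) * a τ) := by
      rw [← intervalIntegral.integral_const_mul]
      apply intervalIntegral.integral_congr
      intro τ hτ
      rw [Set.uIcc_of_le hε.2] at hτ
      have := hpneC τ hτ
      simp only [hw]
      push_cast
      field_simp
    rw [e1, norm_mul, Complex.norm_real, Real.norm_eq_abs] at key
    have hwT : ‖w T‖ = 0 := by simp [hw, haT]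
    have hint : ∫ τ in ε..T, ‖w' τ‖ ≤ 1010 * A * (T - ε) := by
      have := intervalIntegral.integral_mono_on (μ := volume) (f := fun τ => ‖w' τ‖) (g := fun _ => 1010 * A) hε.2
        (by apply ContinuousOn.intervalIntegrable; rw [Set.uIcc_of_le hε.2]; exact hwc.norm)
        intervalIntegrable_const hw'n
      refine this.trans (le_of_eq ?_)
      rw [intervalIntegral.integral_const, smul_eq_mul]
      ring
    -- Boundary term `10A` plus `1010A` times a length at most 2: together `2030A`.
    have := hwn ε ⟨le_rfl, hε.2⟩
    nlinarith [hε.1]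
  have hcont : Continuous fun ε => ∫ τ in ε..T, Complex.exp (Complex.I * ((t * P τ : ℝ) : ℂ)) * ((τ : ℂ) * a τ) := by
    have hf : Continuous fun τ => Complex.exp (Complex.I * ((t * P τ : ℝ) : ℂ)) * ((τ : ℂ) * a τ) := by fun_prop
    have : (fun ε => ∫ τ in ε..T, Complex.exp (Complex.I * ((t * P τ : ℝ) : ℂ)) * ((τ : ℂ) * a τ))
        = fun ε => -∫ τ in T..ε, Complex.exp (Complex.I * ((t * P τ : ℝ) : ℂ)) * ((τ : ℂ) * a τ) := by
      ext ε; rw [intervalIntegral.integral_symm]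
    rw [this]
    exact (intervalIntegral.continuous_primitive (fun a b => hf.intervalIntegrable a b) T).neg
  have hlim : Filter.Tendsto (fun ε => |t| * ‖∫ τ in ε..T,
      Complex.exp (Complex.I * ((t * P τ : ℝ) : ℂ)) * ((τ : ℂ) * a τ)‖) (nhdsWithin 0 (Set.Ioi 0))
      (nhds (|t| * ‖∫ τ in (0:ℝ)..T,
      Complex.exp (Complex.I * ((t * P τ : ℝ) : ℂ)) * ((τ : ℂ) * a τ)‖)) :=
    ((continuous_const.mul hcont.norm).tendsto 0).mono_left nhdsWithin_le_nhds
  refine le_of_tendsto hlim ?_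
  filter_upwards [Ioc_mem_nhdsGT hT] with ε hε using hmain ε hε

/-- Polar decomposition of the slope of a linear phase adapted to `(1+|η|²)^{-1/2}`: the slope is
`-∇(1+|η|²)^{-1/2}` at a point `s u` of the disc of radius `3/5`, up to an excess `κ u` which
vanishes unless `s = 3/5`. -/
theorem exists_nearCritical (w₁ w₂ : ℝ) :
    ∃ s κ u₁ u₂ : ℝ, 0 ≤ s ∧ s ≤ 3 / 5 ∧ 0 ≤ κ ∧ (κ = 0 ∨ s = 3 / 5) ∧ u₁ ^ 2 + u₂ ^ 2 = 1 ∧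
      w₁ = (s / √(1 + s ^ 2) ^ 3 + κ) * u₁ ∧ w₂ = (s / √(1 + s ^ 2) ^ 3 + κ) * u₂ := by
  set n := √(w₁ ^ 2 + w₂ ^ 2) with hn
  have hn2 : n ^ 2 = w₁ ^ 2 + w₂ ^ 2 := Real.sq_sqrt (by positivity)
  have hn0 : 0 ≤ n := Real.sqrt_nonneg _
  obtain ⟨u₁, u₂, hu, h1, h2⟩ : ∃ u₁ u₂ : ℝ, u₁ ^ 2 + u₂ ^ 2 = 1 ∧ w₁ = n * u₁ ∧ w₂ = n * u₂ := by
    rcases eq_or_ne n 0 with h | h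
    · rw [h] at hn2
      refine ⟨1, 0, by norm_num, ?_, ?_⟩ <;> rw [h] <;> nlinarith [sq_nonneg w₁, sq_nonneg w₂]
    · refine ⟨w₁ / n, w₂ / n, ?_, ?_, ?_⟩
      · rw [div_pow, div_pow, ← add_div, ← hn2, div_self (pow_ne_zero _ h)]
      · field_simp
      · field_simp
  set β : ℝ → ℝ := fun s => s / √(1 + s ^ 2) ^ 3 with hβ
  have hβc : Continuous β := by
    apply Continuous.div (by fun_prop) (by fun_prop)
    intro s
    exact pow_ne_zero _ (Real.sqrt_pos.2 (by positivity)).ne'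
  -- Slopes up to the value of `s/(1+s²)^{3/2}` at `3/5` are attained, by the intermediate value
  -- theorem. For steeper ones no critical point is used: the base point sits on the circle of
  -- radius `3/5` and the surplus goes into `κ`.
  by_cases hcase : n ≤ β (3 / 5)
  · obtain ⟨s, hs, hsn⟩ := intermediate_value_Icc (by norm_num : (0:ℝ) ≤ 3 / 5) hβc.continuousOn
      (show n ∈ Set.Icc (β 0) (β (3 / 5)) from ⟨by simpa [hβ] using hn0, hcase⟩)
    refine ⟨s, 0, u₁, u₂, hs.1, hs.2, le_rfl, Or.inl rfl, hu, ?_, ?_⟩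
    · rw [add_zero]; rw [← hsn] at h1; exact h1
    · rw [add_zero]; rw [← hsn] at h2; exact h2
  · push Not at hcase
    refine ⟨3 / 5, n - β (3 / 5), u₁, u₂, by norm_num, le_rfl, by linarith, Or.inr rfl, hu, ?_, ?_⟩
    · rw [h1]; simp only [hβ]; ring
    · rw [h2]; simp only [hβ]; ring

set_option maxHeartbeats 800000 in
/-- Two-dimensional stationary phase for the phase `w·η + (1+|η|²)^{-1/2}` near the origin,
uniformly in the slope `w`. -/
theorem norm_integral_plane_le {a : ℝ × ℝ → ℂ} {A : ℝ} (ha : ContDiff ℝ 1 a)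
    (hsupp : ∀ p : ℝ × ℝ, a p ≠ 0 → p.1 ^ 2 + p.2 ^ 2 ≤ 1 / 4)
    (hA : ∀ p, ‖a p‖ ≤ A) (hA' : ∀ p, ‖fderiv ℝ a p‖ ≤ A) (w₁ w₂ t : ℝ) :
    |t| * ‖∫ p : ℝ × ℝ, Complex.exp (Complex.I *
      ((t * (w₁ * p.1 + w₂ * p.2 + 1 / √(1 + p.1 ^ 2 + p.2 ^ 2)) : ℝ) : ℂ)) * a p‖
      ≤ 2 * Real.pi * (2030 * A) := by
  obtain ⟨s, κ, u₁, u₂, hs0, hs, hκ, hκs, hu, hw1, hw2⟩ := exists_nearCritical w₁ w₂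
  have hA0 : 0 ≤ A := (norm_nonneg _).trans (hA 0)
  set F : ℝ × ℝ → ℂ := fun p => Complex.exp (Complex.I *
      ((t * (w₁ * p.1 + w₂ * p.2 + 1 / √(1 + p.1 ^ 2 + p.2 ^ 2)) : ℝ) : ℂ)) * a p with hF
  have hac : Continuous a := ha.continuous
  have hFc : Continuous F := by
    have h : Continuous fun p : ℝ × ℝ => 1 / √(1 + p.1 ^ 2 + p.2 ^ 2) :=
      Continuous.div (by fun_prop) (by fun_prop) fun p => (Real.sqrt_pos.2 (by positivity)).ne'
    simp only [hF]; fun_prop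
  -- Polar coordinates are centred at the base point `s u`, where the gradient of the phase is the
  -- excess `κu`.
  have hshift : ∫ p, F p = ∫ p, F ((s * u₁, s * u₂) + p) := (integral_add_left_eq_self F _).symm
  have hsu : (s * u₁) ^ 2 + (s * u₂) ^ 2 = s ^ 2 := by linear_combination s ^ 2 * hu
  have hs2 : s ^ 2 ≤ 9 / 25 := by nlinarith
  -- the support on a ray
  have hray : ∀ θ τ : ℝ, 0 ≤ τ → a ((s * u₁, s * u₂) + (τ * Real.cos θ, τ * Real.sin θ)) ≠ 0 →
      1 + s ^ 2 + 2 * (s * (u₁ * Real.cos θ + u₂ * Real.sin θ)) * τ + τ ^ 2 ≤ 5 / 4 := by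
    intro θ τ _ h
    have := hsupp _ h
    simp only [Prod.mk_add_mk] at this
    have e : (s * u₁ + τ * Real.cos θ) ^ 2 + (s * u₂ + τ * Real.sin θ) ^ 2
        = s ^ 2 + 2 * (s * (u₁ * Real.cos θ + u₂ * Real.sin θ)) * τ + τ ^ 2 := by
      linear_combination hsu + τ ^ 2 * Real.sin_sq_add_cos_sq θ
    linarith
  have hbs : ∀ θ : ℝ, (s * (u₁ * Real.cos θ + u₂ * Real.sin θ)) ^ 2 ≤ s ^ 2 := by
    intro θ
    have : (u₁ * Real.cos θ + u₂ * Real.sin θ) ^ 2 ≤ 1 := by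
      nlinarith [sq_nonneg (u₁ * Real.sin θ - u₂ * Real.cos θ), Real.sin_sq_add_cos_sq θ, hu]
    nlinarith [sq_nonneg s]
  rw [hshift, integral_eq_polar (R := 2) (by fun_prop) (by norm_num)]
  swap
  · intro p hp
    by_contra hne
    have h0 : a ((s * u₁, s * u₂) + p) ≠ 0 := right_ne_zero_of_mul hne
    have := hsupp _ h0
    simp only [Prod.fst_add, Prod.snd_add] at this
    nlinarith [sq_nonneg (s * u₁ + p.1 + s * u₁), sq_nonneg (s * u₂ + p.2 + s * u₂)]
  have hang : ∀ θ : ℝ, |t| * ‖∫ τ in (0 : ℝ)..2,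
      τ • F ((s * u₁, s * u₂) + (τ * Real.cos θ, τ * Real.sin θ))‖ ≤ 2030 * A := by
    intro θ
    set c := u₁ * Real.cos θ + u₂ * Real.sin θ with hc
    set b := s * c with hb
    have hb2 : b ^ 2 ≤ s ^ 2 := hbs θ
    have hd0 : 0 ≤ b ^ 2 + 9 / 25 - s ^ 2 := by nlinarith [sq_nonneg b]
    -- `T` is the distance along the ray from `s u` to the circle of radius `3/5`, the larger root
    -- of `τ² + 2bτ = 9/25 - s²`. The amplitude lives in radius `1/2`, so it vanishes from `T` on.
    set T := -b + √(b ^ 2 + 9 / 25 - s ^ 2) with hTdef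
    have hT0 : 0 ≤ T := by
      have : |b| ≤ √(b ^ 2 + 9 / 25 - s ^ 2) := Real.abs_le_sqrt (by linarith)
      have := le_abs_self b
      linarith
    have hTq : T ^ 2 + 2 * b * T = 9 / 25 - s ^ 2 := by
      have := Real.sq_sqrt hd0
      rw [hTdef]; linear_combination this
    have hb35 : |b| ≤ 3 / 5 := abs_le_of_sq_le_sq (by linarith) (by norm_num)
    have hT2 : T ≤ 2 := by
      have := (abs_le.1 hb35).1
      nlinarith
    have hzero : ∀ τ, T ≤ τ → a ((s * u₁, s * u₂) + (τ * Real.cos θ, τ * Real.sin θ)) = 0 := by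
      intro τ hτ
      by_contra hne
      have h1 := hray θ τ (hT0.trans hτ) hne
      have h2 : T ^ 2 + 2 * b * T ≤ τ ^ 2 + 2 * b * τ := by
        have : 0 ≤ T + b := by rw [hTdef]; linarith [Real.sqrt_nonneg (b ^ 2 + 9 / 25 - s ^ 2)]
        nlinarith
      linarith
    have hsplit : ∫ τ in (0 : ℝ)..2, τ • F ((s * u₁, s * u₂) + (τ * Real.cos θ, τ * Real.sin θ))
        = ∫ τ in (0 : ℝ)..T, τ • F ((s * u₁, s * u₂) + (τ * Real.cos θ, τ * Real.sin θ)) := by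
      have hcF : Continuous fun τ : ℝ => τ • F ((s * u₁, s * u₂) + (τ * Real.cos θ, τ * Real.sin θ)) := by
        fun_prop
      rw [← intervalIntegral.integral_add_adjacent_intervals (hcF.intervalIntegrable 0 T)
        (hcF.intervalIntegrable T 2)]
      have : ∫ τ in T..2, τ • F ((s * u₁, s * u₂) + (τ * Real.cos θ, τ * Real.sin θ)) = 0 := by
        rw [← intervalIntegral.integral_zero (a := T) (b := 2) (E := ℂ) (μ := volume)]
        apply intervalIntegral.integral_congr
        intro τ hτ
        rw [Set.uIcc_of_le hT2] at hτ
        have h0 := hzero τ hτ.1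
        simp only [hF, h0, mul_zero, smul_zero]
      rw [this, add_zero]
    rw [hsplit]
    rcases hT0.eq_or_lt with hT | hT
    · rw [← hT]; simp only [intervalIntegral.integral_same, norm_zero, mul_zero]; positivity
    -- If there is an excess, the base point is on the circle; a ray with `T > 0` then points into
    -- the disc, so its direction makes a nonpositive product with `u`. The excess thus reinforces
    -- the decrease of the phase instead of cancelling it.
    have hδ : κ * c ≤ 0 := by
      rcases hκs with h | h
      · rw [h, zero_mul]
      · have hbneg : b ≤ 0 := by
          by_contra hpos
          push Not at hpos
          rw [h] at hTq
          nlinarith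
        have : c ≤ 0 := by
          rw [hb, h] at hbneg; linarith
        exact mul_nonpos_of_nonneg_of_nonpos hκ this
    set γ : ℝ → ℝ × ℝ := fun τ => (s * u₁, s * u₂) + (τ * Real.cos θ, τ * Real.sin θ) with hγ
    have hγd : ∀ τ, HasDerivAt γ (Real.cos θ, Real.sin θ) τ := by
      intro τ
      have h1 : HasDerivAt (fun τ : ℝ => τ * Real.cos θ) (Real.cos θ) τ := hasDerivAt_mul_const _
      have h2 : HasDerivAt (fun τ : ℝ => τ * Real.sin θ) (Real.sin θ) τ := hasDerivAt_mul_const _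
      exact (h1.prodMk h2).const_add _
    have hγc : Continuous γ := continuous_iff_continuousAt.2 fun τ => (hγd τ).continuousAt
    have had : ∀ τ, HasDerivAt (fun τ => a (γ τ)) (fderiv ℝ a (γ τ) (Real.cos θ, Real.sin θ)) τ := fun τ =>
      ((ha.differentiable (by simp)) (γ τ)).hasFDerivAt.comp_hasDerivAt τ (hγd τ)
    have hvn : ‖(Real.cos θ, Real.sin θ)‖ ≤ 1 := by
      rw [Prod.norm_def]
      exact max_le (Real.abs_cos_le_one θ) (Real.abs_sin_le_one θ)
    have hq : ∀ τ, 1 + s ^ 2 + 2 * b * τ + τ ^ 2 = 1 + (γ τ).1 ^ 2 + (γ τ).2 ^ 2 := by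
      intro τ
      simp only [hγ, Prod.mk_add_mk, hb, hc]
      linear_combination -hsu - τ ^ 2 * Real.sin_sq_add_cos_sq θ
    have key := norm_integral_ray_le (Q := 1 + s ^ 2) (b := b) (T := T) (δ := κ * c) (t := t) (A := A)
      (P := fun τ => w₁ * (s * u₁ + τ * Real.cos θ) + w₂ * (s * u₂ + τ * Real.sin θ)
        + 1 / √(1 + s ^ 2 + 2 * b * τ + τ ^ 2))
      (a := fun τ => a (γ τ)) (a' := fun τ => fderiv ℝ a (γ τ) (Real.cos θ, Real.sin θ))
      (by linarith) hT hT2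
      (fun τ hτ => by
        have h1 : τ ^ 2 ≤ T * τ := by nlinarith [hτ.1, hτ.2]
        rcases le_total (T + 2 * b) 0 with h | h
        · nlinarith [hτ.1]
        · nlinarith [hτ.1, hτ.2])
      hδ
      (fun τ => by
        have hpos : 0 < 1 + s ^ 2 + 2 * b * τ + τ ^ 2 := by rw [hq]; positivity
        have hSp := Real.sqrt_pos.2 hpos
        have h1 := (hasDerivAt_const τ (1:ℝ)).div (hasDerivAt_sqrt_quadratic hpos) hSp.ne'
        have hl1 : HasDerivAt (fun τ : ℝ => s * u₁ + τ * Real.cos θ) (Real.cos θ) τ :=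
          (hasDerivAt_mul_const _).const_add _
        have hl2 : HasDerivAt (fun τ : ℝ => s * u₂ + τ * Real.sin θ) (Real.sin θ) τ :=
          (hasDerivAt_mul_const _).const_add _
        refine (((hl1.const_mul w₁).add (hl2.const_mul w₂)).add h1).congr_deriv ?_
        rw [hw1, hw2]
        have : 0 < √(1 + s ^ 2) := Real.sqrt_pos.2 (by positivity)
        simp only [hb, hc] at hSp ⊢
        field_simp
        ring)
      had
      (by have := ha.continuous_fderiv (by simp); fun_prop)
      (fun τ => hA _)
      (fun τ => by
        refine (ContinuousLinearMap.le_opNorm _ _).trans ?_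
        calc _ ≤ A * 1 := mul_le_mul (hA' _) hvn (norm_nonneg _) hA0
          _ = A := mul_one A)
      (hzero T le_rfl)
      -- For `s = 3/5` the base point is at distance at least `3/5 - 1/2 = 1/10` from the support of
      -- the amplitude.
      (fun τ hτ hne => by
        rcases hκs with h | h
        · left; rw [h, zero_mul]
        · right
          have h1 := hray θ τ hτ.1 hne
          have h2 := (abs_le.1 hb35).1
          rw [h] at h1
          have h3 : 1 + (3 / 5 : ℝ) ^ 2 + 2 * b * τ + τ ^ 2 ≤ 5 / 4 := by rw [hb, h]; exact h1
          by_contra hlt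
          push Not at hlt
          nlinarith [hτ.1])
    refine le_trans (le_of_eq ?_) key
    congr 2
    apply intervalIntegral.integral_congr
    intro τ _
    simp only [hF, Complex.real_smul]
    rw [hq]
    simp only [hγ, Prod.mk_add_mk]
    ring
  have hpi : -Real.pi ≤ Real.pi := by linarith [Real.pi_pos]
  rw [← Real.norm_eq_abs, ← norm_smul, ← intervalIntegral.integral_smul]
  have h := intervalIntegral.norm_integral_le_of_norm_le_const (a := -Real.pi) (b := Real.pi)
    (f := fun θ => t • ∫ τ in (0 : ℝ)..2, τ • F ((s * u₁, s * u₂) + (τ * Real.cos θ, τ * Real.sin θ)))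
    (C := 2030 * A) (fun θ _ => by rw [norm_smul, Real.norm_eq_abs]; exact hang θ)
  refine h.trans (le_of_eq ?_)
  rw [sub_neg_eq_add, abs_of_pos (by linarith [Real.pi_pos])]
  ring

/-! ### The kernel near the vertical axis, slice by slice -/

theorem dist_pt_le (a b a' b' c : ℝ) : dist (pt a b c) (pt a' b' c) ≤ |a - a'| + |b - b'| := by
  rw [dist_eq_norm]
  have e : pt a b c - pt a' b' c = pt (a - a') (b - b') 0 := by
    ext i; fin_cases i <;> simp [pt]
  rw [e]
  apply abs_le_of_sq_le_sq' _ (by positivity) |>.2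
  rw [norm_sq_eq_sum]
  simp only [pt_zero, pt_one, pt_two]
  nlinarith [sq_abs (a - a'), sq_abs (b - b'), mul_nonneg (abs_nonneg (a - a')) (abs_nonneg (b - b'))]

/-- The horizontal slices of the dispersive kernel near the vertical axis. -/
theorem exists_horizontal_kernel_bound {m : E3 → ℂ} (hm : ContDiff ℝ (⊤ : ℕ∞) m) {c₂ : ℝ}
    (hc₂ : 0 < c₂) (hmc : HasCompactSupport m)
    (hsupp : ∀ ξ, m ξ ≠ 0 → |ξ 2| ≤ c₂ ∧ ξ 2 ≠ 0 ∧ horiz ξ ≤ |ξ 2| / 2) :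
    ∃ C : ℝ, 0 < C ∧ ∀ (z₁ z₂ t ζ : ℝ),
      |t| * ‖∫ p : ℝ × ℝ, osc (pt z₁ z₂ 0) t (pt p.1 p.2 ζ) * m (pt p.1 p.2 ζ)‖ ≤ C := by
  obtain ⟨D, hD⟩ := ContDiff.lipschitzWith_of_hasCompactSupport hmc hm (by simp)
  obtain ⟨A₀, hA₀⟩ := hm.continuous.bounded_above_of_compact_support hmc
  set A : ℝ := |A₀| + 2 * D * c₂ with hA
  have hDn : 0 ≤ (D : ℝ) := D.2
  have hA0 : 0 ≤ A := by positivity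
  refine ⟨c₂ ^ 2 * (2 * Real.pi * (2030 * A)) + 1, by positivity, ?_⟩
  intro z₁ z₂ t ζ
  by_cases hζ : ζ ≠ 0 ∧ |ζ| ≤ c₂
  swap
  · have : ∀ p : ℝ × ℝ, osc (pt z₁ z₂ 0) t (pt p.1 p.2 ζ) * m (pt p.1 p.2 ζ) = 0 := by
      intro p
      by_contra hne
      have := hsupp _ (right_ne_zero_of_mul hne)
      exact hζ ⟨this.2.1, this.1⟩
    simp only [this, integral_zero, norm_zero, mul_zero]
    positivity
  obtain ⟨hζ0, hζc⟩ := hζ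
  have hr : 0 < |ζ| := abs_pos.2 hζ0
  rcases eq_or_ne t 0 with rfl | ht
  · rw [abs_zero, zero_mul]; positivity
  set a : ℝ × ℝ → ℂ := fun p => m (pt (|ζ| * p.1) (|ζ| * p.2) ζ) with ha
  -- At `ξ = (|ζ|η, ζ)` one has `Λ = sgn(ζ)(1+|η|²)^{-1/2}`; the sign of `ζ` is moved into the time.
  -- The dilation by `|ζ|` costs the Jacobian `|ζ|² ≤ c₂²`, so the bound is uniform as `ζ` tends to
  -- zero.
  set t' : ℝ := t * (ζ / |ζ|) with ht'
  have ht'0 : t' ≠ 0 := mul_ne_zero ht (div_ne_zero hζ0 hr.ne')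
  have ht'a : |t'| = |t| := by
    rw [ht', abs_mul, abs_div, abs_abs, div_self hr.ne', mul_one]
  have hscale := Measure.integral_comp_smul (volume : Measure (ℝ × ℝ))
    (fun p : ℝ × ℝ => osc (pt z₁ z₂ 0) t (pt p.1 p.2 ζ) * m (pt p.1 p.2 ζ)) |ζ|
  rw [Module.finrank_prod, Module.finrank_self,
    abs_of_pos (by positivity : 0 < (|ζ| ^ (1 + 1))⁻¹)] at hscale
  have haC : ContDiff ℝ 1 a := by
    have h1 : ContDiff ℝ 1 fun p : ℝ × ℝ => pt (|ζ| * p.1) (|ζ| * p.2) ζ := by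
      rw [contDiff_euclidean]
      intro i
      fin_cases i
      · simp only [pt]; exact contDiff_const.mul contDiff_fst
      · simp only [pt]; exact contDiff_const.mul contDiff_snd
      · simp only [pt]; exact contDiff_const
    exact (hm.of_le (by simp)).comp h1
  have hlip : LipschitzWith (Real.toNNReal (2 * D * c₂)) a := by
    apply LipschitzWith.of_dist_le_mul
    intro p q
    rw [Real.coe_toNNReal _ (by positivity)]
    refine (hD.dist_le_mul _ _).trans ?_
    have h1 := dist_pt_le (|ζ| * p.1) (|ζ| * p.2) (|ζ| * q.1) (|ζ| * q.2) ζ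
    rw [← mul_sub, ← mul_sub, abs_mul, abs_mul, abs_abs] at h1
    have h2 : |p.1 - q.1| ≤ dist p q := by
      rw [← Real.dist_eq, Prod.dist_eq]; exact le_max_left _ _
    have h3 : |p.2 - q.2| ≤ dist p q := by
      rw [← Real.dist_eq, Prod.dist_eq]; exact le_max_right _ _
    have h4 : dist (pt (|ζ| * p.1) (|ζ| * p.2) ζ) (pt (|ζ| * q.1) (|ζ| * q.2) ζ) ≤ 2 * c₂ * dist p q := by
      refine h1.trans ?_
      have : |ζ| * |p.1 - q.1| ≤ c₂ * dist p q := by gcongr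
      have : |ζ| * |p.2 - q.2| ≤ c₂ * dist p q := by gcongr
      linarith
    calc _ ≤ (D : ℝ) * (2 * c₂ * dist p q) := by gcongr
      _ = _ := by ring
  have key := norm_integral_plane_le haC (A := A)
    (fun p hp => by
      have h1 := (hsupp _ hp).2.2
      have h2 := horiz_sq (pt (|ζ| * p.1) (|ζ| * p.2) ζ)
      have h3 := horiz_nonneg (pt (|ζ| * p.1) (|ζ| * p.2) ζ)
      simp only [pt_zero, pt_one, pt_two] at h1 h2
      have h4 : |ζ| ^ 2 * (p.1 ^ 2 + p.2 ^ 2) ≤ |ζ| ^ 2 * (1 / 4) := by nlinarith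
      exact le_of_mul_le_mul_left h4 (by positivity))
    (fun p => (hA₀ _).trans (by rw [hA]; have := le_abs_self A₀; have : 0 ≤ 2 * D * c₂ := by positivity
                                linarith))
    (fun p => (norm_fderiv_le_of_lipschitz ℝ hlip).trans (by
      rw [Real.coe_toNNReal _ (by positivity), hA]; have := abs_nonneg A₀; linarith))
    (|ζ| * z₁ / t') (|ζ| * z₂ / t') t'
  have e1 : ∀ p : ℝ × ℝ, Complex.exp (Complex.I *
      ((t' * (|ζ| * z₁ / t' * p.1 + |ζ| * z₂ / t' * p.2 + 1 / √(1 + p.1 ^ 2 + p.2 ^ 2)) : ℝ) : ℂ)) * a p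
      = osc (pt z₁ z₂ 0) t (pt (|ζ| • p).1 (|ζ| • p).2 ζ) * m (pt (|ζ| • p).1 (|ζ| • p).2 ζ) := by
    intro p
    simp only [Prod.smul_fst, Prod.smul_snd, smul_eq_mul, ha, osc]
    congr 4
    rw [inner_eq_sum]
    simp only [pt_zero, pt_one, pt_two]
    have hn : ‖pt (|ζ| * p.1) (|ζ| * p.2) ζ‖ = |ζ| * √(1 + p.1 ^ 2 + p.2 ^ 2) := by
      rw [← Real.sqrt_sq (norm_nonneg _), norm_sq_eq_sum]
      simp only [pt_zero, pt_one, pt_two]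
      rw [show (|ζ| * p.1) ^ 2 + (|ζ| * p.2) ^ 2 + ζ ^ 2 = |ζ| ^ 2 * (1 + p.1 ^ 2 + p.2 ^ 2) by
        rw [← sq_abs ζ]; ring, Real.sqrt_mul (by positivity), Real.sqrt_sq hr.le]
    rw [Lam, hn, pt_two]
    have hS : 0 < √(1 + p.1 ^ 2 + p.2 ^ 2) := Real.sqrt_pos.2 (by positivity)
    rw [ht'] at ht'0 ⊢
    field_simp
    ring
  simp only [e1] at key
  rw [hscale, ht'a, norm_smul, Real.norm_eq_abs,
    abs_of_pos (by positivity : 0 < (|ζ| ^ (1 + 1))⁻¹)] at key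
  generalize ‖∫ p : ℝ × ℝ, osc (pt z₁ z₂ 0) t (pt p.1 p.2 ζ) * m (pt p.1 p.2 ζ)‖ = X at *
  have h5 : |t| * X = |ζ| ^ 2 * (|t| * ((|ζ| ^ (1 + 1))⁻¹ * X)) := by field_simp
  rw [h5]
  calc _ ≤ |ζ| ^ 2 * (2 * Real.pi * (2030 * A)) := by gcongr
    _ ≤ c₂ ^ 2 * (2 * Real.pi * (2030 * A)) := by gcongr
    _ ≤ _ := by linarith

/-! ### The partial Fourier transform and decay near the vertical axis -/

/-- The Fourier transform in the vertical variable only. -/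
def vertFourier (g : E3 → ℂ) (y : ℝ × ℝ) (ζ : ℝ) : ℂ := 𝓕 (fun s : ℝ => g (pt y.1 y.2 s)) ζ

/-- Plancherel on a single vertical line: the slice of `g` is smooth with compact support, hence
Schwartz. -/
theorem integral_norm_sq_vertFourier {g : E3 → ℂ} (hg : ContDiff ℝ (⊤ : ℕ∞) g)
    (hgc : HasCompactSupport g) (y : ℝ × ℝ) :
    Integrable (fun ζ => ‖vertFourier g y ζ‖ ^ 2) ∧
    ∫ ζ, ‖vertFourier g y ζ‖ ^ 2 = ∫ s, ‖g (pt y.1 y.2 s)‖ ^ 2 := by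
  have h1 : ContDiff ℝ (⊤ : ℕ∞) fun s : ℝ => g (pt y.1 y.2 s) := by
    have : ContDiff ℝ (⊤ : ℕ∞) fun s : ℝ => pt y.1 y.2 s := by
      rw [contDiff_euclidean]
      intro i
      fin_cases i
      · simp only [pt]; exact contDiff_const
      · simp only [pt]; exact contDiff_const
      · simp only [pt]; exact contDiff_id
    exact hg.comp this
  have h2 : HasCompactSupport fun s : ℝ => g (pt y.1 y.2 s) := by
    obtain ⟨R, hR⟩ := hgc.isCompact.isBounded.subset_closedBall (0 : E3)
    apply HasCompactSupport.intro (isCompact_closedBall (0 : ℝ) R)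
    intro s hs
    by_contra hne
    have h3 := hR (subset_tsupport g hne)
    rw [mem_closedBall_zero_iff] at h3
    apply hs
    rw [mem_closedBall_zero_iff]
    have := EuclideanSpace.norm_eq (pt y.1 y.2 s)
    have h4 : ‖(pt y.1 y.2 s) 2‖ ≤ ‖pt y.1 y.2 s‖ := PiLp.norm_apply_le _ _
    exact h4.trans h3
  have key := SchwartzMap.integral_norm_sq_fourier (h2.toSchwartzMap h1)
  refine ⟨?_, key⟩
  have := ((𝓕 (h2.toSchwartzMap h1)).memLp 2 volume).integrable_norm_pow (by norm_num)
  exact this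

theorem exists_pos_radius {g : E3 → ℂ} (hgc : HasCompactSupport g) :
    ∃ R : ℝ, 0 < R ∧ ∀ ξ, g ξ ≠ 0 → ‖ξ‖ ≤ R := by
  obtain ⟨R, hR⟩ := hgc.isCompact.isBounded.subset_closedBall (0 : E3)
  refine ⟨max R 1, by positivity, fun ξ hξ => ?_⟩
  have := hR (subset_tsupport g hξ)
  rw [mem_closedBall_zero_iff] at this
  exact this.trans (le_max_left _ _)

theorem norm_le_of_pt_ne_zero {g : E3 → ℂ} {R : ℝ} (hR : ∀ ξ, g ξ ≠ 0 → ‖ξ‖ ≤ R) {y : ℝ × ℝ} {s : ℝ}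
    (h : g (pt y.1 y.2 s) ≠ 0) : ‖y‖ ≤ R ∧ |s| ≤ R := by
  have h1 := hR _ h
  refine ⟨?_, (PiLp.norm_apply_le (pt y.1 y.2 s) 2).trans h1⟩
  rw [Prod.norm_def]
  exact max_le ((PiLp.norm_apply_le (pt y.1 y.2 s) 0).trans h1)
    ((PiLp.norm_apply_le (pt y.1 y.2 s) 1).trans h1)

theorem vertFourier_eq_intervalIntegral {g : E3 → ℂ} {R : ℝ} (hR0 : 0 < R)
    (hR : ∀ ξ, g ξ ≠ 0 → ‖ξ‖ ≤ R) (y : ℝ × ℝ) (ζ : ℝ) :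
    vertFourier g y ζ = ∫ s in (-(R + 1))..(R + 1),
      Complex.exp (((-2 * Real.pi * s * ζ : ℝ) : ℂ) * Complex.I) * g (pt y.1 y.2 s) := by
  rw [vertFourier, Real.fourier_eq', intervalIntegral.integral_of_le (by linarith)]
  symm
  have e : ∀ s : ℝ, Complex.exp (((-2 * Real.pi * inner ℝ s ζ : ℝ) : ℂ) * Complex.I) • g (pt y.1 y.2 s)
      = Complex.exp (((-2 * Real.pi * s * ζ : ℝ) : ℂ) * Complex.I) * g (pt y.1 y.2 s) := by
    intro s
    rw [smul_eq_mul]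
    congr 4
    simp only [RCLike.inner_apply, conj_trivial]
    ring
  simp only [e]
  apply setIntegral_eq_integral_of_forall_compl_eq_zero
  intro s hs
  by_contra hne
  have h2 := (norm_le_of_pt_ne_zero hR (right_ne_zero_of_mul hne)).2
  rw [abs_le] at h2
  exact hs ⟨by linarith, by linarith⟩

theorem continuous_vertFourier {g : E3 → ℂ} (hg : Continuous g) (hgc : HasCompactSupport g) :
    Continuous fun p : (ℝ × ℝ) × ℝ => vertFourier g p.1 p.2 := by
  obtain ⟨R, hR0, hR⟩ := exists_pos_radius hgc
  simp only [vertFourier_eq_intervalIntegral hR0 hR]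
  apply intervalIntegral.continuous_parametric_intervalIntegral_of_continuous'
    (f := fun (p : (ℝ × ℝ) × ℝ) s => Complex.exp (((-2 * Real.pi * s * p.2 : ℝ) : ℂ) * Complex.I)
      * g (pt p.1.1 p.1.2 s))
  simp only [Function.uncurry_def]
  fun_prop

theorem vertFourier_eq_zero {g : E3 → ℂ} {R : ℝ} (hR : ∀ ξ, g ξ ≠ 0 → ‖ξ‖ ≤ R) {y : ℝ × ℝ}
    (hy : R < ‖y‖) (ζ : ℝ) : vertFourier g y ζ = 0 := by
  have : (fun s : ℝ => g (pt y.1 y.2 s)) = fun _ => 0 := by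
    ext s
    by_contra hne
    exact absurd (norm_le_of_pt_ne_zero hR hne).1 (not_le.2 hy)
  rw [vertFourier, this, Real.fourier_eq]
  simp

/-- The Fourier transform as iterated transform: vertical variable first. -/
theorem fourier_eq_integral_vertFourier {g : E3 → ℂ} (hg : Integrable g) (p : ℝ × ℝ) (ζ : ℝ) :
    𝓕 g (pt p.1 p.2 ζ) = ∫ y : ℝ × ℝ,
      Complex.exp (((-2 * Real.pi * (y.1 * p.1 + y.2 * p.2) : ℝ) : ℂ) * Complex.I) * vertFourier g y ζ := by
  rw [Real.fourier_eq']
  have hint : Integrable fun v : E3 => Complex.exp (((-2 * Real.pi * inner ℝ v (pt p.1 p.2 ζ) : ℝ) : ℂ)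
      * Complex.I) • g v := by
    refine hg.bdd_smul (φ := fun v : E3 => Complex.exp (((-2 * Real.pi * inner ℝ v (pt p.1 p.2 ζ) : ℝ) : ℂ)
      * Complex.I)) 1 ?_ ?_
    · apply Continuous.aestronglyMeasurable; fun_prop
    · filter_upwards with v
      rw [Complex.norm_exp_ofReal_mul_I]
  rw [integral_eq_integral_horizontal_vertical hint]
  congr 1; ext y
  rw [vertFourier, Real.fourier_eq', ← integral_const_mul]
  congr 1; ext s
  rw [smul_eq_mul, smul_eq_mul, ← mul_assoc, ← Complex.exp_add, inner_eq_sum]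
  congr 2
  simp only [pt_zero, pt_one, pt_two, RCLike.inner_apply, conj_trivial]
  push_cast
  ring

set_option maxHeartbeats 1000000 in
/-- Dispersive bound near the vertical axis. -/
theorem exists_nearAxis_bound {m : E3 → ℂ} (hm : ContDiff ℝ (⊤ : ℕ∞) m) {c₂ : ℝ}
    (hc₂ : 0 < c₂) (hmc : HasCompactSupport m) {K : Set E3} (hK : IsClosed K) (hK0 : (0 : E3) ∉ K)
    (hmK : ∀ ξ, m ξ ≠ 0 → ξ ∈ K)
    (hsupp : ∀ ξ, m ξ ≠ 0 → |ξ 2| ≤ c₂ ∧ ξ 2 ≠ 0 ∧ horiz ξ ≤ |ξ 2| / 2)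
    {w : ℝ × ℝ → ℝ} (hw : Continuous w) (hw0 : ∀ y, 0 < w y) (hwi : Integrable fun y => (w y)⁻¹) :
    ∃ C : ℝ, 0 < C ∧ ∀ (g : E3 → ℂ), ContDiff ℝ (⊤ : ℕ∞) g → HasCompactSupport g → ∀ N : ℝ, 0 < N →
      ∫ x : E3, w (x 0, x 1) * ‖g x‖ ^ 2 ≤ N ^ 2 → ∀ (x : E3) (t : ℝ),
      |t| * ‖∫ ξ, osc x t ξ * m ξ * 𝓕 g ξ‖ ≤ C * N := by
  obtain ⟨C, hC, hker⟩ := exists_horizontal_kernel_bound hm hc₂ hmc hsupp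
  set I₀ := ∫ y, (w y)⁻¹ with hI₀
  have hI₀0 : 0 ≤ I₀ := integral_nonneg fun y => (inv_pos.2 (hw0 y)).le
  refine ⟨C * ((2 * c₂ * I₀ + 1) / 2), by positivity, ?_⟩
  intro g hg hgc N hN hgN x t
  obtain ⟨R, hR0, hR⟩ := exists_pos_radius hgc
  obtain ⟨R', hR'0, hR'⟩ := exists_pos_radius hmc
  set Φ : E3 → ℂ := fun ξ => osc x t ξ * m ξ with hΦ
  have hΦs : ContDiff ℝ (⊤ : ℕ∞) Φ := contDiff_osc_mul x t hm hK hK0 hmK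
  have hΦc : Continuous Φ := hΦs.continuous
  have hΦ0 : ∀ ξ, Φ ξ ≠ 0 → ‖ξ‖ ≤ R' := fun ξ h => hR' ξ (right_ne_zero_of_mul h)
  have hΦcs : HasCompactSupport Φ := hmc.mul_left
  set G := vertFourier g with hG
  have hGc : Continuous fun p : (ℝ × ℝ) × ℝ => G p.1 p.2 := continuous_vertFourier hg.continuous hgc
  have hG0 : ∀ y ζ, R < ‖y‖ → G y ζ = 0 := fun y ζ hy => vertFourier_eq_zero hR hy ζ
  have hgi : Integrable g := hg.continuous.integrable_of_hasCompactSupport hgc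
  have hFc : Continuous (𝓕 g) := by
    exact (𝓕 (hgc.toSchwartzMap hg) : 𝓢(E3, ℂ)).continuous
  -- Fubini
  have hI1 : Integrable fun ξ => Φ ξ * 𝓕 g ξ :=
    (hΦc.mul hFc).integrable_of_hasCompactSupport hΦcs.mul_right
  have hstep1 : ∫ ξ, osc x t ξ * m ξ * 𝓕 g ξ = ∫ ζ : ℝ, ∫ p : ℝ × ℝ, Φ (pt p.1 p.2 ζ) * 𝓕 g (pt p.1 p.2 ζ) := by
    change ∫ ξ, Φ ξ * 𝓕 g ξ = _
    rw [← integral_ptEquiv]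
    exact integral_prod _ (integrable_ptEquiv hI1)
  set E : ℝ × ℝ → ℝ × ℝ → ℂ := fun y p =>
    Complex.exp (((-2 * Real.pi * (y.1 * p.1 + y.2 * p.2) : ℝ) : ℂ) * Complex.I) with hE
  have hstep2 : ∀ ζ : ℝ, ∫ p : ℝ × ℝ, Φ (pt p.1 p.2 ζ) * 𝓕 g (pt p.1 p.2 ζ)
      = ∫ y : ℝ × ℝ, (∫ p : ℝ × ℝ, Φ (pt p.1 p.2 ζ) * E y p) * G y ζ := by
    intro ζ
    have h1 : ∀ p : ℝ × ℝ, Φ (pt p.1 p.2 ζ) * 𝓕 g (pt p.1 p.2 ζ)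
        = ∫ y : ℝ × ℝ, Φ (pt p.1 p.2 ζ) * E y p * G y ζ := by
      intro p
      rw [fourier_eq_integral_vertFourier hgi, ← integral_const_mul]
      congr 1; ext y; simp only [hE, hG]; ring
    simp only [h1]
    rw [integral_integral_swap]
    · congr 1; ext y; rw [integral_mul_const]
    · have hc : Continuous (Function.uncurry fun (p y : ℝ × ℝ) => Φ (pt p.1 p.2 ζ) * E y p * G y ζ) := by
        have hGc' : Continuous fun q : (ℝ × ℝ) × (ℝ × ℝ) => G q.2 ζ :=
          hGc.comp (continuous_snd.prodMk continuous_const)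
        simp only [Function.uncurry_def, hE]
        fun_prop
      apply hc.integrable_of_hasCompactSupport
      apply HasCompactSupport.intro
        ((isCompact_closedBall (0 : ℝ × ℝ) R').prod (isCompact_closedBall (0 : ℝ × ℝ) R))
      rintro ⟨p, y⟩ hpy
      by_contra hne
      apply hpy
      simp only [Function.uncurry_apply_pair] at hne
      refine ⟨?_, ?_⟩
      · rw [mem_closedBall_zero_iff]
        exact (norm_le_of_pt_ne_zero hΦ0 (left_ne_zero_of_mul (left_ne_zero_of_mul hne))).1
      · rw [mem_closedBall_zero_iff]
        by_contra hlt
        exact right_ne_zero_of_mul hne (hG0 y ζ (not_le.1 hlt))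
  -- The character `E y p` only translates the horizontal position by `-2πy`, and the vertical phase
  -- has modulus one; the slice bound is uniform in the position.
  have hinner : ∀ y ζ, |t| * ‖∫ p : ℝ × ℝ, Φ (pt p.1 p.2 ζ) * E y p‖ ≤ C := by
    intro y ζ
    have e : ∀ p : ℝ × ℝ, Φ (pt p.1 p.2 ζ) * E y p = Complex.exp (((x 2 * ζ : ℝ) : ℂ) * Complex.I) *
        (osc (pt (x 0 - 2 * Real.pi * y.1) (x 1 - 2 * Real.pi * y.2) 0) t (pt p.1 p.2 ζ) * m (pt p.1 p.2 ζ)) := by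
      intro p
      simp only [hΦ, hE, osc]
      have : ∀ a b c d e : ℂ, Complex.exp a * e * Complex.exp b = Complex.exp c * (Complex.exp d * e) ↔
        Complex.exp (a + b) * e = Complex.exp (c + d) * e := by
        intro a b c d e
        rw [Complex.exp_add, Complex.exp_add]
        constructor <;> intro h <;> linear_combination h
      rw [this]
      congr 2
      simp only [inner_eq_sum, pt_zero, pt_one, pt_two]
      push_cast
      ring
    simp only [e]
    rw [integral_const_mul, norm_mul, Complex.norm_exp_ofReal_mul_I, one_mul]
    exact hker _ _ _ _
  have hinner0 : ∀ y ζ, c₂ < |ζ| → ∫ p : ℝ × ℝ, Φ (pt p.1 p.2 ζ) * E y p = 0 := by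
    intro y ζ hζ
    rw [← integral_zero (ℝ × ℝ) ℂ]
    congr 1; ext p
    by_contra hne
    have := (hsupp _ (right_ne_zero_of_mul (left_ne_zero_of_mul hne))).1
    rw [pt_two] at this
    linarith
  -- weighted bound for the vertical Fourier transform
  have hprodInt : ∀ f : ℝ × ℝ × ℝ → ℝ, Continuous f → (∀ ζ y, R < ‖y‖ → f (ζ, y) = 0) →
      Integrable f ((volume.restrict (Set.Icc (-c₂) c₂)).prod volume) := by
    intro f hf hf0
    have h1 : IntegrableOn f (Set.Icc (-c₂) c₂ ×ˢ Metric.closedBall (0 : ℝ × ℝ) R) :=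
      hf.continuousOn.integrableOn_compact (isCompact_Icc.prod (isCompact_closedBall _ _))
    have h2 : IntegrableOn f (Set.Icc (-c₂) c₂ ×ˢ Set.univ) := by
      apply h1.of_forall_sdiff_eq_zero (measurableSet_Icc.prod MeasurableSet.univ)
      rintro ⟨ζ, y⟩ ⟨h, h'⟩
      apply hf0
      by_contra hlt
      exact h' ⟨h.1, mem_closedBall_zero_iff.2 (not_lt.1 hlt)⟩
    rw [← Measure.restrict_univ (μ := (volume : Measure (ℝ × ℝ))), Measure.prod_restrict]
    exact h2
  have hGcs : Continuous fun p : ℝ × ℝ × ℝ => G p.2 p.1 := hGc.comp continuous_swap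
  have hGsl : ∀ y, Continuous fun ζ => G y ζ := fun y => hGc.comp (continuous_const.prodMk continuous_id)
  have hGsl' : ∀ ζ, Continuous fun y => G y ζ := fun ζ => hGc.comp (continuous_id.prodMk continuous_const)
  have hwG : Integrable (fun p : ℝ × ℝ × ℝ => w p.2 * ‖G p.2 p.1‖ ^ 2)
      ((volume.restrict (Set.Icc (-c₂) c₂)).prod volume) := by
    apply hprodInt
    · fun_prop
    · intro ζ y hy; simp [hG0 y ζ hy]
  have hnG : Integrable (fun p : ℝ × ℝ × ℝ => ‖G p.2 p.1‖)
      ((volume.restrict (Set.Icc (-c₂) c₂)).prod volume) := by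
    apply hprodInt
    · fun_prop
    · intro ζ y hy; simp [hG0 y ζ hy]
  -- After exchanging the integrals, `ζ` is allowed to run over the whole line, where Plancherel
  -- holds for each `y`; the weight does not involve the vertical variable.
  have hL2 : ∫ ζ in Set.Icc (-c₂) c₂, ∫ y, w y * ‖G y ζ‖ ^ 2 ≤ N ^ 2 := by
    rw [integral_integral_swap hwG]
    refine le_trans ?_ hgN
    have hwg : Integrable fun x : E3 => w (x 0, x 1) * ‖g x‖ ^ 2 := by
      apply Continuous.integrable_of_hasCompactSupport
      · have := hg.continuous; fun_prop
      · apply HasCompactSupport.intro hgc.isCompact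
        intro x hx
        rw [image_eq_zero_of_notMem_tsupport hx]; simp
    rw [integral_eq_integral_horizontal_vertical hwg]
    apply integral_mono
    · exact hwG.integral_prod_right
    · exact (integrable_ptEquiv hwg).integral_prod_right
    · intro y
      simp only [pt_zero, pt_one]
      rw [integral_const_mul, integral_const_mul]
      refine mul_le_mul_of_nonneg_left ?_ (hw0 y).le
      obtain ⟨h1, h2⟩ := integral_norm_sq_vertFourier hg hgc y
      rw [← h2]
      exact setIntegral_le_integral h1 (Filter.Eventually.of_forall fun ζ => sq_nonneg _)
  -- Cauchy–Schwarz in the form `|G| ≤ (N/2) w⁻¹ + (1/(2N)) w|G|²`: the first term is integrable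
  -- because `w⁻¹` is and `|ζ| ≤ c₂`, the second is controlled by `hL2`.
  have hamgm : ∫ ζ in Set.Icc (-c₂) c₂, ∫ y, ‖G y ζ‖ ≤ ((2 * c₂ * I₀ + 1) / 2) * N := by
    have hb : Integrable (fun p : ℝ × ℝ × ℝ => (N / 2) * (w p.2)⁻¹ + (1 / (2 * N)) * (w p.2 * ‖G p.2 p.1‖ ^ 2))
        ((volume.restrict (Set.Icc (-c₂) c₂)).prod volume) := by
      apply Integrable.add _ (hwG.const_mul _)
      exact (Integrable.comp_snd hwi _).const_mul _
    calc ∫ ζ in Set.Icc (-c₂) c₂, ∫ y, ‖G y ζ‖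
        = ∫ p : ℝ × ℝ × ℝ, ‖G p.2 p.1‖ ∂((volume.restrict (Set.Icc (-c₂) c₂)).prod volume) :=
          (integral_prod _ hnG).symm
      _ ≤ ∫ p : ℝ × ℝ × ℝ, ((N / 2) * (w p.2)⁻¹ + (1 / (2 * N)) * (w p.2 * ‖G p.2 p.1‖ ^ 2))
          ∂((volume.restrict (Set.Icc (-c₂) c₂)).prod volume) := by
          apply integral_mono hnG hb
          intro p
          have hwp := hw0 p.2
          simp only
          rw [← sub_nonneg]
          have : (N / 2) * (w p.2)⁻¹ + (1 / (2 * N)) * (w p.2 * ‖G p.2 p.1‖ ^ 2) - ‖G p.2 p.1‖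
              = (N - w p.2 * ‖G p.2 p.1‖) ^ 2 / (2 * N * w p.2) := by
            field_simp; ring
          rw [this]; positivity
      _ = (N / 2) * (2 * c₂ * I₀) + (1 / (2 * N)) * ∫ ζ in Set.Icc (-c₂) c₂, ∫ y, w y * ‖G y ζ‖ ^ 2 := by
          rw [integral_add ((Integrable.comp_snd hwi _).const_mul _) (hwG.const_mul _),
            integral_const_mul, integral_const_mul, integral_prod _ hwG,
            integral_prod _ (Integrable.comp_snd hwi _)]
          congr 2
          simp only [integral_const, MeasurableSet.univ, measureReal_restrict_apply, Set.univ_inter,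
            Real.volume_real_Icc, smul_eq_mul, ← hI₀]
          rw [max_eq_left (by linarith)]
          ring
      _ ≤ (N / 2) * (2 * c₂ * I₀) + (1 / (2 * N)) * N ^ 2 := by gcongr
      _ = _ := by field_simp
  rw [hstep1]
  simp only [hstep2]
  have hres : ∫ ζ : ℝ, ∫ y : ℝ × ℝ, (∫ p : ℝ × ℝ, Φ (pt p.1 p.2 ζ) * E y p) * G y ζ
      = ∫ ζ in Set.Icc (-c₂) c₂, ∫ y : ℝ × ℝ, (∫ p : ℝ × ℝ, Φ (pt p.1 p.2 ζ) * E y p) * G y ζ := by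
    symm
    apply setIntegral_eq_integral_of_forall_compl_eq_zero
    intro ζ hζ
    have : c₂ < |ζ| := by
      by_contra hlt
      exact hζ (abs_le.1 (not_lt.1 hlt))
    simp [hinner0 _ ζ this]
  rw [hres, ← Real.norm_eq_abs, ← norm_smul, ← integral_smul]
  calc ‖∫ ζ in Set.Icc (-c₂) c₂, t • ∫ y : ℝ × ℝ, (∫ p : ℝ × ℝ, Φ (pt p.1 p.2 ζ) * E y p) * G y ζ‖
      ≤ ∫ ζ in Set.Icc (-c₂) c₂, C * ∫ y, ‖G y ζ‖ := by
        apply norm_integral_le_of_norm_le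
        · exact hnG.integral_prod_left.const_mul _
        · refine Filter.Eventually.of_forall fun ζ => ?_
          rw [← integral_smul, ← integral_const_mul]
          apply norm_integral_le_of_norm_le
          · apply Integrable.const_mul
            apply (hGsl' ζ).norm.integrable_of_hasCompactSupport
            apply HasCompactSupport.intro (isCompact_closedBall (0 : ℝ × ℝ) R)
            intro y hy
            rw [mem_closedBall_zero_iff, not_le] at hy
            simp [hG0 y ζ hy]
          · refine Filter.Eventually.of_forall fun y => ?_
            rw [norm_smul, norm_mul, ← mul_assoc, Real.norm_eq_abs]
            exact mul_le_mul_of_nonneg_right (hinner y ζ) (norm_nonneg _)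
    _ = C * ∫ ζ in Set.Icc (-c₂) c₂, ∫ y, ‖G y ζ‖ := integral_const_mul _ _
    _ ≤ C * (((2 * c₂ * I₀ + 1) / 2) * N) := by gcongr
    _ = _ := by ring

/-! ### Leibniz rules for iterated scaling fields -/

theorem scal_mul {m f : E3 → ℂ} (hm : Differentiable ℝ m) (hf : Differentiable ℝ f) :
    scal (m * f) = scal m * f + m * scal f := by
  ext x
  simp only [scal, Pi.mul_apply, Pi.add_apply]
  rw [fderiv_mul (hm x) (hf x)]
  simp only [add_apply, smul_apply, smul_eq_mul]
  ring

theorem scal_add {f g : E3 → ℂ} (hf : Differentiable ℝ f) (hg : Differentiable ℝ g) :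
    scal (f + g) = scal f + scal g := by
  ext x
  simp only [scal, Pi.add_apply]
  rw [fderiv_add (hf x) (hg x), add_apply]

theorem iterate_scal_add {f g : E3 → ℂ} (hf : ContDiff ℝ (⊤ : ℕ∞) f) (hg : ContDiff ℝ (⊤ : ℕ∞) g)
    (a : ℕ) : scal^[a] (f + g) = scal^[a] f + scal^[a] g := by
  induction a with
  | zero => rfl
  | succ a ih =>
    rw [Function.iterate_succ_apply', ih, scal_add, Function.iterate_succ_apply', Function.iterate_succ_apply']
    · exact (contDiff_iterate_scal hf a).differentiable (by simp)
    · exact (contDiff_iterate_scal hg a).differentiable (by simp)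

theorem vert_mul {m f : E3 → ℂ} (hm : Differentiable ℝ m) (hf : Differentiable ℝ f) :
    vert (m * f) = vert m * f + m * vert f := by
  ext x
  simp only [vert, Pi.mul_apply, Pi.add_apply]
  rw [fderiv_mul (hm x) (hf x)]
  simp only [add_apply, smul_apply, smul_eq_mul]
  ring

theorem vert_add {f g : E3 → ℂ} (hf : Differentiable ℝ f) (hg : Differentiable ℝ g) :
    vert (f + g) = vert f + vert g := by
  ext x
  simp only [vert, Pi.add_apply]
  rw [fderiv_add (hf x) (hg x), add_apply]

theorem iterate_scal_mul {m f : E3 → ℂ} (hm : ContDiff ℝ (⊤ : ℕ∞) m) (hf : ContDiff ℝ (⊤ : ℕ∞) f)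
    (a : ℕ) : scal^[a + 1] (m * f) = scal^[a] (scal m * f) + scal^[a] (m * scal f) := by
  rw [Function.iterate_succ_apply, scal_mul (hm.differentiable (by simp)) (hf.differentiable (by simp)),
    iterate_scal_add (f := scal m * f) (g := m * scal f) ((contDiff_scal hm).mul hf) (hm.mul (contDiff_scal hf))]

theorem sum_range_add_sum_range_succ_le {u : ℕ → ℝ} (hu : ∀ j, 0 ≤ u j) (a : ℕ) :
    ∑ j ∈ Finset.range (a + 1), u j + ∑ j ∈ Finset.range (a + 1), u (j + 1)
      ≤ 2 * ∑ j ∈ Finset.range (a + 2), u j := by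
  have h1 := Finset.sum_range_succ u (a + 1)
  have h2 := Finset.sum_range_succ' u (a + 1)
  linarith [hu 0, hu (a + 1)]

/-- Leibniz bound for iterates of the scaling field. -/
theorem norm_iterate_scal_mul_le {D : ℝ} (x : E3) (a : ℕ) :
    ∀ {m f : E3 → ℂ}, ContDiff ℝ (⊤ : ℕ∞) m → ContDiff ℝ (⊤ : ℕ∞) f →
    (∀ j ≤ a, ‖(scal^[j] m) x‖ ≤ D) →
    ‖(scal^[a] (m * f)) x‖ ≤ 2 ^ a * D * ∑ j ∈ Finset.range (a + 1), ‖(scal^[j] f) x‖ := by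
  induction a with
  | zero =>
    intro m f hm hf hD
    simp only [Function.iterate_zero, id, Pi.mul_apply, norm_mul, pow_zero, one_mul, zero_add,
      Finset.range_one, Finset.sum_singleton]
    gcongr
    exact hD 0 le_rfl
  | succ a ih =>
    intro m f hm hf hD
    have hD0 : 0 ≤ D := (norm_nonneg _).trans (hD 0 (by omega))
    rw [iterate_scal_mul hm hf]
    have h1 := ih (contDiff_scal hm) hf (fun j hj => by
      rw [← Function.iterate_succ_apply]; exact hD _ (by omega))
    have h2 := ih hm (contDiff_scal hf) (fun j hj => hD j (by omega))
    simp only [← Function.iterate_succ_apply scal] at h2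
    have h3 := sum_range_add_sum_range_succ_le (u := fun j => ‖(scal^[j] f) x‖) (fun j => norm_nonneg _) a
    refine (norm_add_le _ _).trans ((add_le_add h1 h2).trans ?_)
    rw [← mul_add, pow_succ]
    calc _ ≤ 2 ^ a * D * (2 * ∑ j ∈ Finset.range (a + 2), ‖(scal^[j] f) x‖) :=
          mul_le_mul_of_nonneg_left h3 (by positivity)
      _ = _ := by ring

/-- The vertical derivative acts after the scaling fields, so the induction peels off one innermost
`S` at a time and only the base case needs the product rule for `vert`. -/
theorem norm_vert_iterate_scal_mul_le {D : ℝ} (x : E3) (a : ℕ) :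
    ∀ {m f : E3 → ℂ}, ContDiff ℝ (⊤ : ℕ∞) m → ContDiff ℝ (⊤ : ℕ∞) f →
    (∀ j ≤ a, ‖(scal^[j] m) x‖ ≤ D) → (∀ j ≤ a, ‖vert (scal^[j] m) x‖ ≤ D) →
    ‖vert (scal^[a] (m * f)) x‖
      ≤ 2 ^ a * D * ∑ j ∈ Finset.range (a + 1), (‖(scal^[j] f) x‖ + ‖vert (scal^[j] f) x‖) := by
  induction a with
  | zero =>
    intro m f hm hf hD hD'
    have h1 := hD 0 le_rfl
    have h2 := hD' 0 le_rfl
    simp only [Function.iterate_zero, id, pow_zero, one_mul, zero_add,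
      Finset.range_one, Finset.sum_singleton] at *
    rw [vert_mul (hm.differentiable (by simp)) (hf.differentiable (by simp))]
    simp only [Pi.add_apply, Pi.mul_apply]
    refine (norm_add_le _ _).trans ?_
    rw [norm_mul, norm_mul, mul_add]
    gcongr
  | succ a ih =>
    intro m f hm hf hD hD'
    have hD0 : 0 ≤ D := (norm_nonneg _).trans (hD 0 (by omega))
    rw [iterate_scal_mul hm hf, vert_add (f := scal^[a] (scal m * f)) (g := scal^[a] (m * scal f))
      ((contDiff_iterate_scal ((contDiff_scal hm).mul hf) a).differentiable (by simp))
      ((contDiff_iterate_scal (hm.mul (contDiff_scal hf)) a).differentiable (by simp))]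
    have h1 := ih (contDiff_scal hm) hf (fun j hj => by
      rw [← Function.iterate_succ_apply]; exact hD _ (by omega)) (fun j hj => by
      rw [← Function.iterate_succ_apply]; exact hD' _ (by omega))
    have h2 := ih hm (contDiff_scal hf) (fun j hj => hD j (by omega)) (fun j hj => hD' j (by omega))
    simp only [← Function.iterate_succ_apply scal] at h2
    have h3 := sum_range_add_sum_range_succ_le (u := fun j => ‖(scal^[j] f) x‖ + ‖vert (scal^[j] f) x‖)
      (fun j => by positivity) a
    refine (norm_add_le _ _).trans ((add_le_add h1 h2).trans ?_)
    rw [← mul_add, pow_succ]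
    calc _ ≤ 2 ^ a * D * (2 * ∑ j ∈ Finset.range (a + 2), (‖(scal^[j] f) x‖ + ‖vert (scal^[j] f) x‖)) :=
          mul_le_mul_of_nonneg_left h3 (by positivity)
      _ = _ := by ring

theorem hasCompactSupport_iterate_scal {f : E3 → ℂ} (hf : HasCompactSupport f) (a : ℕ) :
    HasCompactSupport (scal^[a] f) := by
  apply HasCompactSupport.intro hf.isCompact
  intro x hx
  by_contra hne
  exact hx (iterate_scal_support (isClosed_tsupport f) (fun ξ h => subset_tsupport f h) a x hne)

theorem hasCompactSupport_vert {f : E3 → ℂ} (hf : HasCompactSupport f) :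
    HasCompactSupport (vert f) := by
  apply HasCompactSupport.intro hf.isCompact
  intro x hx
  rw [vert, fderiv_eq_zero_of_support (isClosed_tsupport f) (fun ξ h => subset_tsupport f h) hx]
  simp

theorem exists_bound_iterate_scal {m : E3 → ℂ} (hm : ContDiff ℝ (⊤ : ℕ∞) m)
    (hmc : HasCompactSupport m) (n : ℕ) :
    ∃ D : ℝ, 0 < D ∧ ∀ j ≤ n, ∀ x, ‖(scal^[j] m) x‖ ≤ D ∧ ‖vert (scal^[j] m) x‖ ≤ D := by
  induction n with
  | zero =>
    obtain ⟨A, hA⟩ := hm.continuous.bounded_above_of_compact_support hmc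
    obtain ⟨B, hB⟩ := (contDiff_vert hm).continuous.bounded_above_of_compact_support
      (hasCompactSupport_vert hmc)
    refine ⟨max (max A B) 1, by positivity, fun j hj x => ?_⟩
    obtain rfl : j = 0 := by omega
    exact ⟨(hA x).trans (by simp), (hB x).trans (by simp)⟩
  | succ n ih =>
    obtain ⟨D, hD, h⟩ := ih
    obtain ⟨A, hA⟩ := (contDiff_iterate_scal hm (n + 1)).continuous.bounded_above_of_compact_support
      (hasCompactSupport_iterate_scal hmc (n + 1))
    obtain ⟨B, hB⟩ := (contDiff_vert (contDiff_iterate_scal hm (n + 1))).continuous.bounded_above_of_compact_support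
      (hasCompactSupport_vert (hasCompactSupport_iterate_scal hmc (n + 1)))
    refine ⟨max (max A B) D, by positivity, fun j hj x => ?_⟩
    rcases Nat.lt_or_ge n j with h1 | h1
    · obtain rfl : j = n + 1 := by omega
      exact ⟨(hA x).trans (by simp), (hB x).trans (by simp)⟩
    · exact ⟨(h j h1 x).1.trans (by simp), (h j h1 x).2.trans (by simp)⟩

/-! ### The scaling field under the Fourier transform -/

/-- The operator conjugate to the scaling field under the Fourier transform. -/
def dualScal (g : E3 → ℂ) (x : E3) : ℂ := -(3 * g x) - scal g x

theorem contDiff_dualScal {f : E3 → ℂ} (hf : ContDiff ℝ (⊤ : ℕ∞) f) :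
    ContDiff ℝ (⊤ : ℕ∞) (dualScal f) := by
  unfold dualScal
  exact (contDiff_const.mul hf).neg.sub (contDiff_scal hf)

theorem contDiff_iterate_dualScal {f : E3 → ℂ} (hf : ContDiff ℝ (⊤ : ℕ∞) f) (a : ℕ) :
    ContDiff ℝ (⊤ : ℕ∞) (dualScal^[a] f) := by
  induction a with
  | zero => exact hf
  | succ a ih => rw [Function.iterate_succ_apply']; exact contDiff_dualScal ih

theorem hasCompactSupport_dualScal {f : E3 → ℂ} (hf : HasCompactSupport f) :
    HasCompactSupport (dualScal f) := by
  apply HasCompactSupport.intro hf.isCompact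
  intro x hx
  rw [dualScal, image_eq_zero_of_notMem_tsupport hx, scal,
    fderiv_eq_zero_of_support (isClosed_tsupport f) (fun ξ h => subset_tsupport f h) hx]
  simp

theorem hasCompactSupport_iterate_dualScal {f : E3 → ℂ} (hf : HasCompactSupport f) (a : ℕ) :
    HasCompactSupport (dualScal^[a] f) := by
  induction a with
  | zero => exact hf
  | succ a ih => rw [Function.iterate_succ_apply']; exact hasCompactSupport_dualScal ih

theorem iterate_dualScal_succ {f : E3 → ℂ} (hf : ContDiff ℝ (⊤ : ℕ∞) f) (a : ℕ) (x : E3) :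
    (scal^[a] (dualScal f)) x = -(3 * (scal^[a] f) x) - (scal^[a + 1] f) x := by
  induction a generalizing x with
  | zero => rfl
  | succ a ih =>
    have h1 := (contDiff_iterate_scal hf a).differentiable (by simp)
    have h2 := (contDiff_iterate_scal hf (a + 1)).differentiable (by simp)
    have e : scal^[a] (dualScal f) = fun x => -(3 * (scal^[a] f) x) - (scal^[a + 1] f) x := funext ih
    rw [Function.iterate_succ_apply', e, scal, fderiv_fun_sub (((h1 x).const_mul _).fun_neg) (h2 x),
      fderiv_fun_neg, fderiv_const_mul (h1 x)]
    simp [Function.iterate_succ_apply', scal]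

/-- Each factor `-(3 + S)` costs `3 + 1 = 4`. The estimate is pointwise in `x`, so it passes to any
weighted norm. -/
theorem norm_iterate_dualScal_le (x : E3) (a : ℕ) : ∀ {f : E3 → ℂ}, ContDiff ℝ (⊤ : ℕ∞) f →
    ‖(dualScal^[a] f) x‖ ≤ 4 ^ a * ∑ j ∈ Finset.range (a + 1), ‖(scal^[j] f) x‖ := by
  induction a with
  | zero => intro f hf; simp
  | succ a ih =>
    intro f hf
    rw [Function.iterate_succ_apply]
    refine (ih (contDiff_dualScal hf)).trans ?_
    have h1 : ∀ j, ‖(scal^[j] (dualScal f)) x‖ ≤ 3 * ‖(scal^[j] f) x‖ + ‖(scal^[j + 1] f) x‖ := by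
      intro j
      rw [iterate_dualScal_succ hf]
      refine (norm_sub_le _ _).trans ?_
      rw [norm_neg, norm_mul]; simp
    have h2 := Finset.sum_range_succ (fun j => ‖(scal^[j] f) x‖) (a + 1)
    have h3 := Finset.sum_range_succ' (fun j => ‖(scal^[j] f) x‖) (a + 1)
    have h4 : ∑ j ∈ Finset.range (a + 1), ‖(scal^[j] (dualScal f)) x‖
        ≤ 4 * ∑ j ∈ Finset.range (a + 2), ‖(scal^[j] f) x‖ := by
      refine (Finset.sum_le_sum fun j _ => h1 j).trans ?_
      rw [Finset.sum_add_distrib, ← Finset.mul_sum]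
      have := norm_nonneg ((scal^[0] f) x)
      have := norm_nonneg ((scal^[a + 1] f) x)
      linarith
    rw [pow_succ, mul_assoc]
    gcongr

theorem contDiff_fourier_of_compactSupport {g : E3 → ℂ} (hg : ContDiff ℝ (⊤ : ℕ∞) g)
    (hgc : HasCompactSupport g) : ContDiff ℝ (⊤ : ℕ∞) (𝓕 g) :=
  (𝓕 (hgc.toSchwartzMap hg) : 𝓢(E3, ℂ)).smooth _

theorem fderiv_fourier_apply {g : E3 → ℂ} (hg : Continuous g)
    (hgc : HasCompactSupport g) (ξ v : E3) :
    fderiv ℝ (𝓕 g) ξ v = 𝓕 (fun y => -(2 * Real.pi * Complex.I) * (inner ℝ y v : ℝ) * g y) ξ := by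
  have hi : Integrable g := hg.integrable_of_hasCompactSupport hgc
  have hi' : Integrable fun v : E3 => ‖v‖ * ‖g v‖ := by
    apply Continuous.integrable_of_hasCompactSupport (by fun_prop)
    exact hgc.norm.mul_left
  rw [Real.fderiv_fourier hi hi']
  have hi2 : Integrable (VectorFourier.fourierSMulRight (innerSL ℝ) g) := by
    apply Continuous.integrable_of_hasCompactSupport
    · unfold VectorFourier.fourierSMulRight; fun_prop
    · apply HasCompactSupport.intro hgc.isCompact
      intro x hx
      ext w
      simp [VectorFourier.fourierSMulRight_apply, image_eq_zero_of_notMem_tsupport hx]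
  rw [Real.fourier_continuousLinearMap_apply hi2]
  refine congrArg (fun u : E3 → ℂ => 𝓕 u ξ) (funext fun y => ?_)
  rw [VectorFourier.fourierSMulRight_apply, innerSL_apply_apply ℝ]
  simp [mul_assoc]

theorem fourier_fderiv_apply {h : E3 → ℂ} (hh : ContDiff ℝ (⊤ : ℕ∞) h) (hhc : HasCompactSupport h)
    (ξ v : E3) : 𝓕 (fun y => fderiv ℝ h y v) ξ = 2 * Real.pi * Complex.I * (inner ℝ ξ v : ℝ) * 𝓕 h ξ := by
  have hc : Continuous (fderiv ℝ h) := hh.continuous_fderiv (by simp)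
  have hi : Integrable (fderiv ℝ h) := hc.integrable_of_hasCompactSupport (hhc.fderiv ℝ)
  have := Real.fourier_fderiv (hh.continuous.integrable_of_hasCompactSupport hhc)
    (hh.differentiable (by simp)) hi
  rw [← Real.fourier_continuousLinearMap_apply hi, this, VectorFourier.fourierSMulRight_apply]
  simp only [neg_apply, innerSL_apply_apply ℝ]
  simp [mul_assoc]

theorem eq_sum_pt (ξ : E3) : ξ = ξ 0 • pt 1 0 0 + ξ 1 • pt 0 1 0 + ξ 2 • pt 0 0 1 := by
  ext i; fin_cases i <;> simp [pt]

theorem scal_eq_sum (f : E3 → ℂ) (ξ : E3) : scal f ξ =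
    ξ 0 * fderiv ℝ f ξ (pt 1 0 0) + ξ 1 * fderiv ℝ f ξ (pt 0 1 0) + ξ 2 * vert f ξ := by
  rw [scal, vert]
  have h := congrArg (fderiv ℝ f ξ) (eq_sum_pt ξ)
  simp only [map_add, map_smul, Complex.real_smul] at h
  exact h

/-- In each coordinate, `ξᵢ∂ᵢ` on the frequency side corresponds to `f ↦ -∂ᵢ(yᵢ f) = -(1 + yᵢ∂ᵢ)f`;
the three coordinates add up to `-(3 + S)`. -/
theorem scal_fourier {g : E3 → ℂ} (hg : ContDiff ℝ (⊤ : ℕ∞) g) (hgc : HasCompactSupport g) :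
    scal (𝓕 g) = 𝓕 (dualScal g) := by
  ext ξ
  have hd := hg.differentiable (by simp)
  have key : ∀ (i : Fin 3) (e : E3), (∀ y : E3, inner ℝ y e = y i) → e i = 1 →
      ξ i * fderiv ℝ (𝓕 g) ξ e = 𝓕 (fun y => -(g y) - y i * fderiv ℝ g y e) ξ := by
    intro i e he hei
    have hcs : ContDiff ℝ (⊤ : ℕ∞) fun y : E3 => ((y i : ℝ) : ℂ) :=
      Complex.ofRealCLM.contDiff.comp (by fun_prop)
    have h1 : ContDiff ℝ (⊤ : ℕ∞) fun y : E3 => ((y i : ℝ) : ℂ) * g y := hcs.mul hg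
    have h1c : HasCompactSupport fun y : E3 => ((y i : ℝ) : ℂ) * g y := hgc.mul_left
    rw [fderiv_fourier_apply hg.continuous hgc]
    have h2 := fourier_fderiv_apply h1 h1c ξ e
    simp only [he] at h2 ⊢
    have h3 : (fun y : E3 => fderiv ℝ (fun y : E3 => ((y i : ℝ) : ℂ) * g y) y e)
        = fun y => g y + y i * fderiv ℝ g y e := by
      ext y
      have h4 : HasFDerivAt (fun y : E3 => ((y i : ℝ) : ℂ))
          (Complex.ofRealCLM ∘L (EuclideanSpace.proj i : E3 →L[ℝ] ℝ)) y :=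
        (Complex.ofRealCLM ∘L (EuclideanSpace.proj i : E3 →L[ℝ] ℝ)).hasFDerivAt
      rw [(h4.fun_mul (hd y).hasFDerivAt).fderiv]
      simp [hei]
      ring
    rw [h3] at h2
    have h5 : 𝓕 (fun y : E3 => -(2 * Real.pi * Complex.I) * ((y i : ℝ) : ℂ) * g y) ξ
        = -(2 * Real.pi * Complex.I) * 𝓕 (fun y : E3 => ((y i : ℝ) : ℂ) * g y) ξ := by
      rw [Real.fourier_eq', Real.fourier_eq', ← integral_const_mul]
      congr 1; ext y; simp only [smul_eq_mul]; ring
    have h6 : 𝓕 (fun y : E3 => -(g y) - y i * fderiv ℝ g y e) ξ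
        = - 𝓕 (fun y : E3 => g y + y i * fderiv ℝ g y e) ξ := by
      rw [Real.fourier_eq', Real.fourier_eq', ← integral_neg]
      congr 1; ext y; simp only [smul_eq_mul]; ring
    rw [h5, h6, h2]
    ring
  have hI : ∀ (i : Fin 3) (e : E3), Integrable fun y => Complex.exp
      (((-2 * Real.pi * inner ℝ y ξ : ℝ) : ℂ) * Complex.I) • (-(g y) - y i * fderiv ℝ g y e) := by
    intro i e
    have hc : Continuous (fderiv ℝ g) := hg.continuous_fderiv (by simp)
    have hgc' := hg.continuous
    apply Continuous.integrable_of_hasCompactSupport (by fun_prop)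
    apply HasCompactSupport.intro hgc.isCompact
    intro x hx
    rw [fderiv_eq_zero_of_support (isClosed_tsupport g) (fun ξ h => subset_tsupport g h) hx,
      image_eq_zero_of_notMem_tsupport hx]
    simp
  rw [scal_eq_sum, vert, key 0 _ (by simp [inner_eq_sum]) rfl, key 1 _ (by simp [inner_eq_sum]) rfl,
    key 2 _ (by simp [inner_eq_sum]) rfl]
  simp only [Real.fourier_eq']
  rw [← integral_add (hI _ _) (hI _ _), ← integral_add ((hI _ _).fun_add (hI _ _)) (hI _ _)]
  congr 1; ext y
  rw [dualScal, scal_eq_sum, vert]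
  simp only [smul_eq_mul]
  ring

theorem iterate_scal_fourier {g : E3 → ℂ} (hg : ContDiff ℝ (⊤ : ℕ∞) g) (hgc : HasCompactSupport g)
    (a : ℕ) : scal^[a] (𝓕 g) = 𝓕 (dualScal^[a] g) := by
  induction a with
  | zero => rfl
  | succ a ih =>
    rw [Function.iterate_succ_apply', ih, scal_fourier (contDiff_iterate_dualScal hg a)
      (hasCompactSupport_iterate_dualScal hgc a), Function.iterate_succ_apply']

/-! ### From weighted `L²` bounds to `L¹` bounds on compact frequency sets -/

theorem integrable_weight_norm_sq {W : E3 → ℝ} (hW : Continuous W) {g : E3 → ℂ} (hg : Continuous g)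
    (hgc : HasCompactSupport g) : Integrable fun x => W x * ‖g x‖ ^ 2 := by
  apply Continuous.integrable_of_hasCompactSupport (by fun_prop)
  apply HasCompactSupport.intro hgc.isCompact
  intro x hx
  rw [image_eq_zero_of_notMem_tsupport hx]; simp

theorem integral_weight_iterate_dualScal_le {W : E3 → ℝ} (hW : Continuous W) (hW0 : ∀ x, 0 ≤ W x)
    {g : E3 → ℂ} (hg : ContDiff ℝ (⊤ : ℕ∞) g) (hgc : HasCompactSupport g) {N : ℝ} {n : ℕ}
    (h : ∀ a ≤ n, ∫ x, W x * ‖(scal^[a] g) x‖ ^ 2 ≤ N ^ 2) {j : ℕ} (hj : j ≤ n) :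
    ∫ x, W x * ‖(dualScal^[j] g) x‖ ^ 2 ≤ (4 ^ j * (j + 1) * N) ^ 2 := by
  have hi : ∀ a, Integrable fun x => W x * ‖(scal^[a] g) x‖ ^ 2 := fun a =>
    integrable_weight_norm_sq hW (contDiff_iterate_scal hg a).continuous (hasCompactSupport_iterate_scal hgc a)
  calc ∫ x, W x * ‖(dualScal^[j] g) x‖ ^ 2
      ≤ ∫ x, (4 ^ j) ^ 2 * (j + 1) * ∑ a ∈ Finset.range (j + 1), W x * ‖(scal^[a] g) x‖ ^ 2 := by
        apply integral_mono
        · exact integrable_weight_norm_sq hW (contDiff_iterate_dualScal hg j).continuous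
            (hasCompactSupport_iterate_dualScal hgc j)
        · exact (integrable_finsetSum _ fun a _ => hi a).const_mul _
        · intro x
          simp only
          rw [← Finset.mul_sum]
          have h1 := norm_iterate_dualScal_le x j hg
          have h2 := sq_sum_le_card_mul_sum_sq (s := Finset.range (j + 1)) (f := fun a => ‖(scal^[a] g) x‖)
          rw [Finset.card_range] at h2
          push_cast at h2
          have h3 : ‖(dualScal^[j] g) x‖ ^ 2 ≤ (4 ^ j) ^ 2 * (∑ a ∈ Finset.range (j + 1), ‖(scal^[a] g) x‖) ^ 2 := by
            rw [← mul_pow]; gcongr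
          calc W x * ‖(dualScal^[j] g) x‖ ^ 2
              ≤ W x * ((4 ^ j) ^ 2 * ((j + 1) * ∑ a ∈ Finset.range (j + 1), ‖(scal^[a] g) x‖ ^ 2)) := by
                apply mul_le_mul_of_nonneg_left _ (hW0 x)
                exact h3.trans (by gcongr)
            _ = _ := by ring
    _ = (4 ^ j) ^ 2 * (j + 1) * ∑ a ∈ Finset.range (j + 1), ∫ x, W x * ‖(scal^[a] g) x‖ ^ 2 := by
        rw [integral_const_mul, integral_finsetSum _ fun a _ => hi a]
    _ ≤ (4 ^ j) ^ 2 * (j + 1) * ∑ a ∈ Finset.range (j + 1), N ^ 2 := by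
        gcongr with a ha
        exact h a (by have := Finset.mem_range.1 ha; omega)
    _ = _ := by rw [Finset.sum_const, Finset.card_range]; simp only [nsmul_eq_mul]; push_cast; ring

/-- Cauchy–Schwarz on a set of finite measure followed by Plancherel; with the level `N` known, the
inequality `|z| ≤ N/2 + |z|²/(2N)` does the work of Cauchy–Schwarz. -/
theorem setIntegral_norm_fourier_le {g : E3 → ℂ} (hg : ContDiff ℝ (⊤ : ℕ∞) g)
    (hgc : HasCompactSupport g) {K : Set E3} (hK : IsCompact K) {N : ℝ} (hN : 0 < N)
    (h : ∫ x, ‖g x‖ ^ 2 ≤ N ^ 2) :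
    ∫ ξ in K, ‖𝓕 g ξ‖ ≤ (volume.real K + 1) / 2 * N := by
  have hF := contDiff_fourier_of_compactSupport hg hgc
  have h2 := SchwartzMap.integral_norm_sq_fourier (hgc.toSchwartzMap hg)
  have h2' : ∫ ξ, ‖𝓕 g ξ‖ ^ 2 = ∫ x, ‖g x‖ ^ 2 := h2
  have hi : Integrable fun ξ => ‖𝓕 g ξ‖ ^ 2 :=
    ((𝓕 (hgc.toSchwartzMap hg)).memLp 2 volume).integrable_norm_pow (by norm_num)
  have hf : volume K ≠ ∞ := hK.measure_lt_top.ne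
  calc ∫ ξ in K, ‖𝓕 g ξ‖ ≤ ∫ ξ in K, (N / 2 + 1 / (2 * N) * ‖𝓕 g ξ‖ ^ 2) := by
        apply integral_mono
        · exact hF.continuous.norm.continuousOn.integrableOn_compact hK
        · exact (integrableOn_const hf).add (hi.integrableOn.const_mul _)
        · intro ξ
          simp only
          rw [← sub_nonneg]
          have : N / 2 + 1 / (2 * N) * ‖𝓕 g ξ‖ ^ 2 - ‖𝓕 g ξ‖ = (N - ‖𝓕 g ξ‖) ^ 2 / (2 * N) := by
            field_simp; ring
          rw [this]; positivity
    _ = N / 2 * volume.real K + 1 / (2 * N) * ∫ ξ in K, ‖𝓕 g ξ‖ ^ 2 := by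
        rw [integral_add (f := fun _ => N / 2) (integrableOn_const hf)
          (hi.integrableOn.const_mul _), integral_const_mul]
        simp [mul_comm]
    _ ≤ N / 2 * volume.real K + 1 / (2 * N) * N ^ 2 := by
        gcongr
        refine le_trans ?_ (h2'.trans_le h)
        exact setIntegral_le_integral hi (Filter.Eventually.of_forall fun ξ => sq_nonneg _)
    _ = _ := by field_simp

/-- Differentiating the transform in direction `e` multiplies `g` by `-2πi (y·e)`, hence the weight
`(x·e)²` and the factor `2π`. -/
theorem setIntegral_norm_fderiv_fourier_le {g : E3 → ℂ} (hg : ContDiff ℝ (⊤ : ℕ∞) g)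
    (hgc : HasCompactSupport g) {K : Set E3} (hK : IsCompact K) {N : ℝ} (hN : 0 < N) (e : E3)
    (h : ∫ x, (inner ℝ x e) ^ 2 * ‖g x‖ ^ 2 ≤ N ^ 2) :
    ∫ ξ in K, ‖fderiv ℝ (𝓕 g) ξ e‖ ≤ (volume.real K + 1) / 2 * (2 * Real.pi * N) := by
  have e0 : (fun ξ => ‖fderiv ℝ (𝓕 g) ξ e‖) =
      fun ξ => ‖𝓕 (fun y => -(2 * Real.pi * Complex.I) * (inner ℝ y e : ℝ) * g y) ξ‖ :=
    funext fun ξ => by rw [fderiv_fourier_apply hg.continuous hgc]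
  rw [e0]
  refine setIntegral_norm_fourier_le (g := fun y => -(2 * Real.pi * Complex.I) * (inner ℝ y e : ℝ) * g y)
    ?_ hgc.mul_left hK (by positivity) ?_
  · refine ContDiff.mul (contDiff_const.mul ?_) hg
    exact Complex.ofRealCLM.contDiff.comp (contDiff_id.inner ℝ contDiff_const)
  · have e1 : ∀ x : E3, ‖-(2 * Real.pi * Complex.I) * (inner ℝ x e : ℝ) * g x‖ ^ 2
        = (2 * Real.pi) ^ 2 * ((inner ℝ x e) ^ 2 * ‖g x‖ ^ 2) := by
      intro x
      rw [norm_mul, norm_mul, norm_neg, norm_mul, norm_mul, Complex.norm_I, Complex.norm_real,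
        Complex.norm_real, mul_pow, mul_pow]
      simp only [Real.norm_eq_abs, mul_one, sq_abs, Complex.norm_ofNat, mul_pow]
      ring
    simp only [e1]
    rw [integral_const_mul, mul_pow (2 * Real.pi) N]
    gcongr

/-- The off-axis bound for the amplitude `m · 𝓕 g`. Leibniz moves the scaling fields onto `𝓕 g`,
where they become `dualScal` on `g`; the support of `m` localizes the norms to a compact set. -/
theorem exists_offAxis_fourier_bound {m : E3 → ℂ} (hm : ContDiff ℝ (⊤ : ℕ∞) m)
    (hmc : HasCompactSupport m) {c₁ c₂ c₃ : ℝ} (hc₁ : 0 < c₁) (hc₂ : 0 < c₂) (hc₃ : 0 < c₃)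
    (hsupp : ∀ ξ, m ξ ≠ 0 → c₁ ≤ horiz ξ ∧ horiz ξ ≤ c₂ ∧ |ξ 2| ≤ c₃) :
    ∃ C : ℝ, 0 < C ∧ ∀ g : E3 → ℂ, ContDiff ℝ (⊤ : ℕ∞) g → HasCompactSupport g →
      ∀ (x : E3) (t : ℝ), |t| * ‖∫ ξ, osc x t ξ * m ξ * 𝓕 g ξ‖ ≤ C * ∑ j ∈ Finset.range 3,
        ∫ ξ in tsupport m, (‖𝓕 (dualScal^[j] g) ξ‖ + ‖vert (𝓕 (dualScal^[j] g)) ξ‖) := by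
  obtain ⟨C, hC, hmain⟩ := exists_offAxis_bound hc₁ hc₂ hc₃
  obtain ⟨D, hD, hDm⟩ := exists_bound_iterate_scal hm hmc 2
  -- Each `j ≤ 2` contributes at most `2²D` from the function and as much from its vertical
  -- derivative; the three values of `j` give `24D`.
  refine ⟨C * (24 * D), by positivity, ?_⟩
  intro g hg hgc x t
  have hF := contDiff_fourier_of_compactSupport hg hgc
  have hH : ContDiff ℝ (⊤ : ℕ∞) (m * 𝓕 g) := hm.mul hF
  have h1 := hmain (m * 𝓕 g) hH (fun ξ h => hsupp ξ (left_ne_zero_of_mul h)) x t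
  have e1 : ∀ ξ, osc x t ξ * (m * 𝓕 g) ξ = osc x t ξ * m ξ * 𝓕 g ξ := fun ξ => by
    rw [Pi.mul_apply, mul_assoc]
  simp only [e1] at h1
  refine h1.trans ?_
  rw [mul_assoc]
  apply mul_le_mul_of_nonneg_left _ hC.le
  set T : ℕ → E3 → ℝ := fun j ξ => ‖(scal^[j] (𝓕 g)) ξ‖ + ‖vert (scal^[j] (𝓕 g)) ξ‖ with hT
  have hTc : ∀ j, Continuous (T j) := fun j =>
    (contDiff_iterate_scal hF j).continuous.norm.add (contDiff_vert (contDiff_iterate_scal hF j)).continuous.norm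
  have hT0 : ∀ j ξ, 0 ≤ T j ξ := fun j ξ => by positivity
  have hTi : ∀ j, IntegrableOn (T j) (tsupport m) := fun j =>
    (hTc j).continuousOn.integrableOn_compact hmc.isCompact
  simp only [← iterate_scal_fourier hg hgc]
  rw [← integral_finsetSum _ fun j _ => hTi j, ← integral_const_mul]
  have hz : ∀ ξ, ξ ∉ tsupport m →
      ∑ j ∈ Finset.range 3, (‖(scal^[j] (m * 𝓕 g)) ξ‖ + ‖vert (scal^[j] (m * 𝓕 g)) ξ‖) = 0 := by
    intro ξ hξ
    have hs : ∀ η, (m * 𝓕 g) η ≠ 0 → η ∈ tsupport m := fun η h =>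
      subset_tsupport m (left_ne_zero_of_mul h)
    apply Finset.sum_eq_zero
    intro j _
    have h2 : (scal^[j] (m * 𝓕 g)) ξ = 0 := by
      by_contra hne
      exact hξ (iterate_scal_support (isClosed_tsupport m) hs j ξ hne)
    rw [h2, vert, fderiv_eq_zero_of_support (isClosed_tsupport m)
      (iterate_scal_support (isClosed_tsupport m) hs j) hξ]
    simp
  rw [← setIntegral_eq_integral_of_forall_compl_eq_zero hz]
  apply integral_mono
  · apply integrable_finsetSum
    intro j _
    refine ContinuousOn.integrableOn_compact hmc.isCompact (Continuous.continuousOn ?_)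
    exact (contDiff_iterate_scal hH j).continuous.norm.add
      (contDiff_vert (contDiff_iterate_scal hH j)).continuous.norm
  · exact (integrable_finsetSum _ fun j _ => hTi j).const_mul _
  · intro ξ
    simp only
    have hle : ∀ j ≤ 2, ‖(scal^[j] (m * 𝓕 g)) ξ‖ + ‖vert (scal^[j] (m * 𝓕 g)) ξ‖
        ≤ 8 * D * ∑ i ∈ Finset.range 3, T i ξ := by
      intro j hj
      have h2 := norm_iterate_scal_mul_le (D := D) ξ j hm hF (fun i hi => (hDm i (by omega) ξ).1)
      have h3 := norm_vert_iterate_scal_mul_le (D := D) ξ j hm hF (fun i hi => (hDm i (by omega) ξ).1)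
        (fun i hi => (hDm i (by omega) ξ).2)
      have h4 : ∑ i ∈ Finset.range (j + 1), ‖(scal^[i] (𝓕 g)) ξ‖ ≤ ∑ i ∈ Finset.range (j + 1), T i ξ :=
        Finset.sum_le_sum fun i _ => by simp [hT]
      have h5 : ∑ i ∈ Finset.range (j + 1), T i ξ ≤ ∑ i ∈ Finset.range 3, T i ξ := by
        apply Finset.sum_le_sum_of_subset_of_nonneg
        · exact Finset.range_mono (by omega)
        · intro i _ _; exact hT0 i ξ
      have h6 : (2 : ℝ) ^ j ≤ 4 := by
        calc (2 : ℝ) ^ j ≤ 2 ^ 2 := pow_le_pow_right₀ (by norm_num) hj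
          _ = 4 := by norm_num
      have h7 : 0 ≤ ∑ i ∈ Finset.range 3, T i ξ := Finset.sum_nonneg fun i _ => hT0 i ξ
      have h8 : 2 ^ j * D * ∑ i ∈ Finset.range (j + 1), T i ξ ≤ 4 * D * ∑ i ∈ Finset.range 3, T i ξ := by
        gcongr
      have h9 : 2 ^ j * D * ∑ i ∈ Finset.range (j + 1), ‖(scal^[i] (𝓕 g)) ξ‖
          ≤ 2 ^ j * D * ∑ i ∈ Finset.range (j + 1), T i ξ := by gcongr
      simp only [hT] at *
      linarith
    calc _ ≤ ∑ j ∈ Finset.range 3, 8 * D * ∑ i ∈ Finset.range 3, T i ξ :=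
          Finset.sum_le_sum fun j hj => hle j (by have := Finset.mem_range.1 hj; omega)
      _ = _ := by rw [Finset.sum_const, Finset.card_range]; simp only [nsmul_eq_mul, hT]; push_cast; ring

/-- The trivial bound, independent of `t`; it upgrades the decay `|t|⁻¹` to `⟨t⟩⁻¹`. -/
theorem norm_integral_osc_mul_le (x : E3) (t : ℝ) {m F : E3 → ℂ}
    (hmc : HasCompactSupport m) (hF : Continuous F) {D : ℝ} (hD : ∀ ξ, ‖m ξ‖ ≤ D) :
    ‖∫ ξ, osc x t ξ * m ξ * F ξ‖ ≤ D * ∫ ξ in tsupport m, ‖F ξ‖ := by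
  have hz : ∀ ξ, ξ ∉ tsupport m → osc x t ξ * m ξ * F ξ = 0 := fun ξ hξ => by
    rw [image_eq_zero_of_notMem_tsupport hξ]; simp
  rw [← setIntegral_eq_integral_of_forall_compl_eq_zero hz, ← integral_const_mul]
  apply norm_integral_le_of_norm_le
  · exact (hF.norm.continuousOn.integrableOn_compact hmc.isCompact).const_mul _
  · refine Filter.Eventually.of_forall fun ξ => ?_
    rw [norm_mul, norm_mul, norm_osc, one_mul]
    exact mul_le_mul_of_nonneg_right (hD ξ) (norm_nonneg _)

theorem sqrt_one_add_sq_mul_le {t X A B : ℝ} (hX : 0 ≤ X) (h1 : |t| * X ≤ A) (h2 : X ≤ B) :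
    √(1 + t ^ 2) * X ≤ A + B := by
  have h3 : √(1 + t ^ 2) ≤ 1 + |t| := by
    rw [Real.sqrt_le_left (by positivity)]
    nlinarith [sq_abs t, abs_nonneg t]
  calc √(1 + t ^ 2) * X ≤ (1 + |t|) * X := by gcongr
    _ ≤ _ := by linarith

theorem integral_norm_sq_le_of_weight {W V : E3 → ℝ} (hW : Continuous W) (hV : Continuous V)
    (hVW : ∀ x, V x ≤ W x) {g : E3 → ℂ} (hg : Continuous g) (hgc : HasCompactSupport g) {A : ℝ}
    (h : ∫ x, W x * ‖g x‖ ^ 2 ≤ A) : ∫ x, V x * ‖g x‖ ^ 2 ≤ A := by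
  refine le_trans (integral_mono (integrable_weight_norm_sq hV hg hgc)
    (integrable_weight_norm_sq hW hg hgc) fun x => ?_) h
  exact mul_le_mul_of_nonneg_right (hVW x) (sq_nonneg _)

/-- The number `256 = 4³ · 4` is the value of the factor at `j = 3`. -/
theorem dualScal_factor_le {j : ℕ} (hj : j ≤ 3) {N : ℝ} (hN : 0 < N) :
    0 < 4 ^ j * ((j : ℝ) + 1) * N ∧ 4 ^ j * ((j : ℝ) + 1) * N ≤ 256 * N := by
  refine ⟨by positivity, ?_⟩
  have h1 : (4 : ℝ) ^ j ≤ 4 ^ 3 := pow_le_pow_right₀ (by norm_num) hj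
  have h2 : (j : ℝ) + 1 ≤ 4 := by
    have : (j : ℝ) ≤ 3 := by exact_mod_cast hj
    linarith
  have h3 : (4 : ℝ) ^ j * ((j : ℝ) + 1) ≤ 4 ^ 3 * 4 := by gcongr
  nlinarith

/-- `L¹` bounds on compact sets for the transforms of `dualScal^[j] g`. -/
theorem setIntegral_fourier_dualScal_le {W : E3 → ℝ} (hW : Continuous W) (hW1 : ∀ x, 1 ≤ W x)
    {g : E3 → ℂ} (hg : ContDiff ℝ (⊤ : ℕ∞) g) (hgc : HasCompactSupport g) {N : ℝ} (hN : 0 < N)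
    (h : ∀ a ≤ 3, ∫ x, W x * ‖(scal^[a] g) x‖ ^ 2 ≤ N ^ 2) {K : Set E3} (hK : IsCompact K)
    {j : ℕ} (hj : j ≤ 3) :
    ∫ ξ in K, ‖𝓕 (dualScal^[j] g) ξ‖ ≤ (volume.real K + 1) / 2 * (256 * N) := by
  have hs := contDiff_iterate_dualScal hg j
  have hc := hasCompactSupport_iterate_dualScal hgc j
  have h1 := integral_weight_iterate_dualScal_le hW (fun x => zero_le_one.trans (hW1 x)) hg hgc h hj
  have h2 := integral_norm_sq_le_of_weight hW continuous_const hW1 hs.continuous hc h1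
  simp only [one_mul] at h2
  obtain ⟨h3, h4⟩ := dualScal_factor_le hj hN
  refine (setIntegral_norm_fourier_le hs hc hK h3 h2).trans ?_
  gcongr

theorem setIntegral_fderiv_fourier_dualScal_le {W : E3 → ℝ} (hW : Continuous W) (e : E3)
    (hW1 : ∀ x, (inner ℝ x e) ^ 2 ≤ W x)
    {g : E3 → ℂ} (hg : ContDiff ℝ (⊤ : ℕ∞) g) (hgc : HasCompactSupport g) {N : ℝ} (hN : 0 < N)
    (h : ∀ a ≤ 3, ∫ x, W x * ‖(scal^[a] g) x‖ ^ 2 ≤ N ^ 2) {K : Set E3} (hK : IsCompact K)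
    {j : ℕ} (hj : j ≤ 3) :
    ∫ ξ in K, ‖fderiv ℝ (𝓕 (dualScal^[j] g)) ξ e‖
      ≤ (volume.real K + 1) / 2 * (2 * Real.pi * (256 * N)) := by
  have hs := contDiff_iterate_dualScal hg j
  have hc := hasCompactSupport_iterate_dualScal hgc j
  have h1 := integral_weight_iterate_dualScal_le hW (fun x => (sq_nonneg _).trans (hW1 x)) hg hgc h hj
  have h2 := integral_norm_sq_le_of_weight hW (by fun_prop) hW1 hs.continuous hc h1
  obtain ⟨h3, h4⟩ := dualScal_factor_le hj hN
  refine (setIntegral_norm_fderiv_fourier_le hs hc hK h3 e h2).trans ?_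
  gcongr

/-! ### Decay for smooth compactly supported data at unit frequency -/

/-- Frequencies away from the vertical axis, vertical weights. -/
theorem exists_offAxis_decay {m : E3 → ℂ} (hm : ContDiff ℝ (⊤ : ℕ∞) m)
    (hmc : HasCompactSupport m) {c₁ c₂ c₃ : ℝ} (hc₁ : 0 < c₁) (hc₂ : 0 < c₂) (hc₃ : 0 < c₃)
    (hsupp : ∀ ξ, m ξ ≠ 0 → c₁ ≤ horiz ξ ∧ horiz ξ ≤ c₂ ∧ |ξ 2| ≤ c₃) :
    ∃ C : ℝ, 0 < C ∧ ∀ g : E3 → ℂ, ContDiff ℝ (⊤ : ℕ∞) g → HasCompactSupport g → ∀ N : ℝ, 0 < N →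
      (∀ a ≤ 3, ∫ x : E3, (1 + (x 2) ^ 2) * ‖(scal^[a] g) x‖ ^ 2 ≤ N ^ 2) →
      ∀ (x : E3) (t : ℝ), √(1 + t ^ 2) * ‖∫ ξ, osc x t ξ * m ξ * 𝓕 g ξ‖ ≤ C * N := by
  obtain ⟨C, hC, hmain⟩ := exists_offAxis_fourier_bound hm hmc hc₁ hc₂ hc₃ hsupp
  obtain ⟨D, hD, hDm⟩ := exists_bound_iterate_scal hm hmc 0
  set V := (volume.real (tsupport m) + 1) / 2 with hV
  have hV0 : 0 < V := by have := measureReal_nonneg (μ := volume) (s := tsupport m); positivity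
  refine ⟨C * (3 * (V * 256 + V * (2 * Real.pi * 256))) + D * (V * 256), by positivity, ?_⟩
  intro g hg hgc N hN hgN x t
  have hW : Continuous fun x : E3 => 1 + (x 2) ^ 2 := by fun_prop
  -- The weight `1 + x₃²` dominates both 1, for the transform itself, and `x₃²`, for its vertical
  -- derivative.
  have hA : ∀ j ≤ 3, _ := fun j hj => setIntegral_fourier_dualScal_le hW
    (fun x => by nlinarith [sq_nonneg (x 2)]) hg hgc hN hgN hmc.isCompact hj
  have hB : ∀ j ≤ 3, _ := fun j hj => setIntegral_fderiv_fourier_dualScal_le hW (pt 0 0 1)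
    (fun x => by simp [inner_eq_sum]) hg hgc hN hgN hmc.isCompact hj
  have hF : ∀ j, ContDiff ℝ (⊤ : ℕ∞) (𝓕 (dualScal^[j] g)) := fun j =>
    contDiff_fourier_of_compactSupport (contDiff_iterate_dualScal hg j) (hasCompactSupport_iterate_dualScal hgc j)
  have h1 := hmain g hg hgc x t
  have h2 := norm_integral_osc_mul_le (F := 𝓕 g) x t hmc (contDiff_fourier_of_compactSupport hg hgc).continuous (fun ξ => (hDm 0 le_rfl ξ).1)
  refine (sqrt_one_add_sq_mul_le (norm_nonneg _) (h1.trans (c := C * (3 * (V * 256 + V * (2 * Real.pi * 256))) * N) ?_)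
    (h2.trans (c := D * (V * 256) * N) ?_)).trans_eq (by ring)
  · rw [mul_assoc]
    refine mul_le_mul_of_nonneg_left ?_ hC.le
    calc _ ≤ ∑ j ∈ Finset.range 3, (V * (256 * N) + V * (2 * Real.pi * (256 * N))) := by
          apply Finset.sum_le_sum
          intro j hj
          have hj' : j ≤ 3 := by have := Finset.mem_range.1 hj; omega
          rw [integral_add]
          · exact add_le_add (hA j hj') (hB j hj')
          · exact (hF j).continuous.norm.continuousOn.integrableOn_compact hmc.isCompact
          · exact (contDiff_vert (hF j)).continuous.norm.continuousOn.integrableOn_compact hmc.isCompact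
      _ = _ := by rw [Finset.sum_const, Finset.card_range]; simp only [nsmul_eq_mul]; push_cast; ring
  · have := hA 0 (by norm_num)
    calc _ ≤ D * (V * (256 * N)) := by gcongr; exact this
      _ = _ := by ring

/-- Solve `S = ξ₁∂₁ + ξ₂∂₂ + ξ₃∂₃` for `∂₃`, possible where `|ξ₃|` is bounded below. The vertical
derivative, which would need a vertical weight, is traded for horizontal derivatives and one more
scaling field. -/
theorem norm_vert_le {F : E3 → ℂ} {c R : ℝ} (hc : 0 < c) {ξ : E3} (hξ : c ≤ |ξ 2|) (hR : ‖ξ‖ ≤ R) :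
    ‖vert F ξ‖ ≤ c⁻¹ * (‖scal F ξ‖ + R * ‖fderiv ℝ F ξ (pt 1 0 0)‖ + R * ‖fderiv ℝ F ξ (pt 0 1 0)‖) := by
  have h1 := scal_eq_sum F ξ
  have h2 : (ξ 2 : ℂ) * vert F ξ = scal F ξ - ξ 0 * fderiv ℝ F ξ (pt 1 0 0) - ξ 1 * fderiv ℝ F ξ (pt 0 1 0) := by
    rw [h1]; ring
  have h3 := congrArg norm h2
  rw [norm_mul, Complex.norm_real, Real.norm_eq_abs] at h3
  have h4 : ∀ i, ‖ξ i‖ ≤ R := fun i => (PiLp.norm_apply_le ξ i).trans hR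
  have h5 : c * ‖vert F ξ‖ ≤ ‖scal F ξ‖ + R * ‖fderiv ℝ F ξ (pt 1 0 0)‖ + R * ‖fderiv ℝ F ξ (pt 0 1 0)‖ := by
    calc c * ‖vert F ξ‖ ≤ |ξ 2| * ‖vert F ξ‖ := by gcongr
      _ = _ := h3
      _ ≤ ‖scal F ξ‖ + ‖(ξ 0 : ℂ) * fderiv ℝ F ξ (pt 1 0 0)‖ + ‖(ξ 1 : ℂ) * fderiv ℝ F ξ (pt 0 1 0)‖ :=
        (norm_sub_le _ _).trans (add_le_add_left (norm_sub_le _ _) _)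
      _ ≤ _ := by
        rw [norm_mul, norm_mul, Complex.norm_real, Complex.norm_real]
        gcongr
        · exact h4 0
        · exact h4 1
  rw [inv_mul_eq_div, le_div_iff₀ hc]
  linarith

/-- Frequencies away from the vertical axis and the horizontal plane, horizontal weights. -/
theorem exists_offAxis_decay_horizontal {m : E3 → ℂ} (hm : ContDiff ℝ (⊤ : ℕ∞) m)
    (hmc : HasCompactSupport m) {c₁ c₂ c₃ c₄ : ℝ} (hc₁ : 0 < c₁) (hc₂ : 0 < c₂) (hc₃ : 0 < c₃)
    (hc₄ : 0 < c₄)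
    (hsupp : ∀ ξ, m ξ ≠ 0 → c₁ ≤ horiz ξ ∧ horiz ξ ≤ c₂ ∧ |ξ 2| ≤ c₃)
    (hsupp' : ∀ ξ, m ξ ≠ 0 → c₄ ≤ |ξ 2|) :
    ∃ C : ℝ, 0 < C ∧ ∀ g : E3 → ℂ, ContDiff ℝ (⊤ : ℕ∞) g → HasCompactSupport g → ∀ N : ℝ, 0 < N →
      (∀ a ≤ 3, ∫ x : E3, (1 + (x 0) ^ 2 + (x 1) ^ 2) * ‖(scal^[a] g) x‖ ^ 2 ≤ N ^ 2) →
      ∀ (x : E3) (t : ℝ), √(1 + t ^ 2) * ‖∫ ξ, osc x t ξ * m ξ * 𝓕 g ξ‖ ≤ C * N := by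
  obtain ⟨C, hC, hmain⟩ := exists_offAxis_fourier_bound hm hmc hc₁ hc₂ hc₃ hsupp
  obtain ⟨D, hD, hDm⟩ := exists_bound_iterate_scal hm hmc 0
  obtain ⟨R, hR, hKR⟩ := hmc.isCompact.isBounded.exists_pos_norm_le
  set V := (volume.real (tsupport m) + 1) / 2 with hV
  have hV0 : 0 < V := by have := measureReal_nonneg (μ := volume) (s := tsupport m); positivity
  have hKc : ∀ ξ ∈ tsupport m, c₄ ≤ |ξ 2| := by
    intro ξ hξ
    have hcl : IsClosed {ξ : E3 | c₄ ≤ |ξ 2|} :=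
      isClosed_le continuous_const (g := fun ξ : E3 => |ξ 2|) (by fun_prop)
    exact closure_minimal (fun η hη => hsupp' η hη) hcl hξ
  set Q := V * 256 + c₄⁻¹ * (V * 256 + R * (V * (2 * Real.pi * 256)) + R * (V * (2 * Real.pi * 256))) with hQ
  refine ⟨C * (3 * Q) + D * (V * 256), by positivity, ?_⟩
  intro g hg hgc N hN hgN x t
  have hW : Continuous fun x : E3 => 1 + (x 0) ^ 2 + (x 1) ^ 2 := by fun_prop
  have hA : ∀ j ≤ 3, _ := fun j hj => setIntegral_fourier_dualScal_le hW
    (fun x => by nlinarith [sq_nonneg (x 0), sq_nonneg (x 1)]) hg hgc hN hgN hmc.isCompact hj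
  have hB : ∀ j ≤ 3, _ := fun j hj => setIntegral_fderiv_fourier_dualScal_le hW (pt 1 0 0)
    (fun x => by simp [inner_eq_sum]; nlinarith [sq_nonneg (x 1)]) hg hgc hN hgN hmc.isCompact hj
  have hB' : ∀ j ≤ 3, _ := fun j hj => setIntegral_fderiv_fourier_dualScal_le hW (pt 0 1 0)
    (fun x => by simp [inner_eq_sum]; nlinarith [sq_nonneg (x 0)]) hg hgc hN hgN hmc.isCompact hj
  have hF : ∀ j, ContDiff ℝ (⊤ : ℕ∞) (𝓕 (dualScal^[j] g)) := fun j =>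
    contDiff_fourier_of_compactSupport (contDiff_iterate_dualScal hg j) (hasCompactSupport_iterate_dualScal hgc j)
  have hFi : ∀ j, IntegrableOn (fun ξ => ‖𝓕 (dualScal^[j] g) ξ‖) (tsupport m) := fun j =>
    (hF j).continuous.norm.continuousOn.integrableOn_compact hmc.isCompact
  have hFd : ∀ j e, IntegrableOn (fun ξ => ‖fderiv ℝ (𝓕 (dualScal^[j] g)) ξ e‖) (tsupport m) := fun j e =>
    (((hF j).continuous_fderiv (by simp)).clm_apply continuous_const).norm.continuousOn.integrableOn_compact
      hmc.isCompact
  have h1 := hmain g hg hgc x t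
  have h2 := norm_integral_osc_mul_le (F := 𝓕 g) x t hmc (contDiff_fourier_of_compactSupport hg hgc).continuous (fun ξ => (hDm 0 le_rfl ξ).1)
  refine (sqrt_one_add_sq_mul_le (norm_nonneg _) (h1.trans (c := C * (3 * Q) * N) ?_)
    (h2.trans (c := D * (V * 256) * N) ?_)).trans_eq (by ring)
  · rw [mul_assoc]
    refine mul_le_mul_of_nonneg_left ?_ hC.le
    calc _ ≤ ∑ j ∈ Finset.range 3, Q * N := by
          apply Finset.sum_le_sum
          intro j hj
          -- Two scaling fields come from the radial integrations by parts and one from the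
          -- replacement of `∂₃`: this is why three are needed.
          have hj' : j + 1 ≤ 3 := by have := Finset.mem_range.1 hj; omega
          have hsc : scal (𝓕 (dualScal^[j] g)) = 𝓕 (dualScal^[j + 1] g) := by
            rw [scal_fourier (contDiff_iterate_dualScal hg j) (hasCompactSupport_iterate_dualScal hgc j),
              Function.iterate_succ_apply']
          have hv : ∫ ξ in tsupport m, ‖vert (𝓕 (dualScal^[j] g)) ξ‖ ≤ c₄⁻¹ *
              (V * (256 * N) + R * (V * (2 * Real.pi * (256 * N))) + R * (V * (2 * Real.pi * (256 * N)))) := by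
            calc _ ≤ ∫ ξ in tsupport m, c₄⁻¹ * (‖𝓕 (dualScal^[j + 1] g) ξ‖
                    + R * ‖fderiv ℝ (𝓕 (dualScal^[j] g)) ξ (pt 1 0 0)‖
                    + R * ‖fderiv ℝ (𝓕 (dualScal^[j] g)) ξ (pt 0 1 0)‖) := by
                  apply setIntegral_mono_on
                  · exact hFd j _
                  · exact (((hFi _).add ((hFd j _).const_mul _)).add ((hFd j _).const_mul _)).const_mul _
                  · exact hmc.isCompact.measurableSet
                  · intro ξ hξ
                    rw [← hsc]
                    exact norm_vert_le hc₄ (hKc ξ hξ) (hKR ξ hξ)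
              _ = c₄⁻¹ * ((∫ ξ in tsupport m, ‖𝓕 (dualScal^[j + 1] g) ξ‖)
                    + R * (∫ ξ in tsupport m, ‖fderiv ℝ (𝓕 (dualScal^[j] g)) ξ (pt 1 0 0)‖)
                    + R * ∫ ξ in tsupport m, ‖fderiv ℝ (𝓕 (dualScal^[j] g)) ξ (pt 0 1 0)‖) := by
                  rw [integral_const_mul, integral_add ((hFi _).fun_add ((hFd j _).const_mul _)) ((hFd j _).const_mul _),
                    integral_add (hFi _) ((hFd j _).const_mul _), integral_const_mul, integral_const_mul]
              _ ≤ _ := by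
                  gcongr
                  · exact hA _ hj'
                  · exact hB j (by omega)
                  · exact hB' j (by omega)
          rw [integral_add (hFi j) (g := fun ξ => ‖vert (𝓕 (dualScal^[j] g)) ξ‖) (hFd j _)]
          refine (add_le_add (hA j (by omega)) hv).trans_eq ?_
          rw [hQ]; ring
      _ = _ := by rw [Finset.sum_const, Finset.card_range]; simp only [nsmul_eq_mul]; push_cast; ring
  · have := hA 0 (by norm_num)
    calc _ ≤ D * (V * (256 * N)) := by gcongr; exact this
      _ = _ := by ring

/-- A cut-off to a cone around the vertical axis, used for `ξ 2 ≠ 0`. -/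
def coneCutoff (ξ : E3) : ℝ :=
  Real.smoothTransition ((1 / 4 - (ξ 0 ^ 2 + ξ 1 ^ 2) / ξ 2 ^ 2) * (16 / 3))

theorem contDiffAt_coneCutoff {ξ : E3} (hξ : ξ 2 ≠ 0) : ContDiffAt ℝ (⊤ : ℕ∞) coneCutoff ξ := by
  unfold coneCutoff
  refine Real.smoothTransition.contDiff.contDiffAt.comp ξ ?_
  refine ContDiffAt.mul (contDiffAt_const.sub (ContDiffAt.div ?_ ?_ (by positivity))) contDiffAt_const
  · fun_prop
  · fun_prop

/-- The argument of the smooth transition vanishes at `|ξ_h| = |ξ₃|/2` and equals 1 at `|ξ_h| =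
|ξ₃|/4`; it decreases in `|ξ_h|/|ξ₃|`. -/
theorem horiz_le_of_coneCutoff_ne_zero {ξ : E3} (hξ : ξ 2 ≠ 0) (h : coneCutoff ξ ≠ 0) :
    horiz ξ ≤ |ξ 2| / 2 := by
  have h1 : 0 < (1 / 4 - (ξ 0 ^ 2 + ξ 1 ^ 2) / ξ 2 ^ 2) * (16 / 3) := by
    by_contra hle
    exact h (Real.smoothTransition.zero_of_nonpos (not_lt.1 hle))
  have h2 : (ξ 0 ^ 2 + ξ 1 ^ 2) / ξ 2 ^ 2 < 1 / 4 := by linarith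
  rw [div_lt_iff₀ (by positivity)] at h2
  rw [horiz, Real.sqrt_le_left (by positivity), div_pow, sq_abs]
  linarith

theorem le_horiz_of_coneCutoff_ne_one {ξ : E3} (hξ : ξ 2 ≠ 0) (h : coneCutoff ξ ≠ 1) :
    |ξ 2| / 4 ≤ horiz ξ := by
  have h1 : (1 / 4 - (ξ 0 ^ 2 + ξ 1 ^ 2) / ξ 2 ^ 2) * (16 / 3) < 1 := by
    by_contra hle
    exact h (Real.smoothTransition.one_of_one_le (not_lt.1 hle))
  have h2 : 1 / 16 < (ξ 0 ^ 2 + ξ 1 ^ 2) / ξ 2 ^ 2 := by linarith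
  rw [lt_div_iff₀ (by positivity)] at h2
  apply Real.le_sqrt_of_sq_le
  rw [div_pow, sq_abs]
  linarith

theorem contDiff_mul_coneCutoff {m : E3 → ℂ} (hm : ContDiff ℝ (⊤ : ℕ∞) m) {c : ℝ} (hc : 0 < c)
    (hsupp : ∀ ξ, m ξ ≠ 0 → c ≤ |ξ 2|) :
    ContDiff ℝ (⊤ : ℕ∞) fun ξ => m ξ * (coneCutoff ξ : ℂ) := by
  rw [contDiff_iff_contDiffAt]
  intro ξ
  by_cases hξ : ξ 2 = 0
  · have ho : IsOpen {η : E3 | |η 2| < c} := isOpen_lt (by fun_prop) continuous_const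
    have h : (fun ξ => m ξ * (coneCutoff ξ : ℂ)) =ᶠ[nhds ξ] fun _ => 0 := by
      filter_upwards [ho.mem_nhds (by simp [hξ, hc])] with η hη
      have : m η = 0 := by
        by_contra hne
        exact absurd (hsupp η hne) (not_le.2 hη)
      simp [this]
    exact contDiffAt_const.congr_of_eventuallyEq h
  · exact hm.contDiffAt.mul (Complex.ofRealCLM.contDiff.contDiffAt.comp ξ (contDiffAt_coneCutoff hξ))

/-- Frequencies away from the horizontal plane, horizontal weights. -/
theorem exists_nearAxis_decay {m : E3 → ℂ} (hm : ContDiff ℝ (⊤ : ℕ∞) m)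
    (hmc : HasCompactSupport m) {c : ℝ} (hc : 0 < c) (hsupp : ∀ ξ, m ξ ≠ 0 → c ≤ |ξ 2|)
    {w : ℝ × ℝ → ℝ} (hw : Continuous w) (hw1 : ∀ y, 1 + y.1 ^ 2 + y.2 ^ 2 ≤ w y)
    (hwi : Integrable fun y => (w y)⁻¹) :
    ∃ C : ℝ, 0 < C ∧ ∀ g : E3 → ℂ, ContDiff ℝ (⊤ : ℕ∞) g → HasCompactSupport g → ∀ N : ℝ, 0 < N →
      (∀ a ≤ 3, ∫ x : E3, w (x 0, x 1) * ‖(scal^[a] g) x‖ ^ 2 ≤ N ^ 2) →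
      ∀ (x : E3) (t : ℝ), √(1 + t ^ 2) * ‖∫ ξ, osc x t ξ * m ξ * 𝓕 g ξ‖ ≤ C * N := by
  obtain ⟨R, hR, hKR⟩ := exists_pos_radius hmc
  set K : Set E3 := {ξ | c ≤ |ξ 2|} with hK
  have hKcl : IsClosed K :=
    isClosed_le continuous_const (g := fun ξ : E3 => |ξ 2|) (by fun_prop)
  have hK0 : (0 : E3) ∉ K := by simp [hK, hc]
  have hne2 : ∀ ξ, m ξ ≠ 0 → ξ 2 ≠ 0 := fun ξ h h' => by
    have := hsupp ξ h
    rw [h', abs_zero] at this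
    linarith
  have h2R : ∀ ξ, m ξ ≠ 0 → |ξ 2| ≤ R := fun ξ h => (PiLp.norm_apply_le ξ 2).trans (hKR ξ h)
  -- The symbol splits into a part in the cone `|ξ_h| ≤ |ξ₃|/2`, treated by stationary phase on
  -- slices, and a part with `|ξ_h| ≥ |ξ₃|/4`, treated by the off-axis estimate.
  set m₁ : E3 → ℂ := fun ξ => m ξ * (coneCutoff ξ : ℂ) with hm₁
  have hm₁s : ContDiff ℝ (⊤ : ℕ∞) m₁ := contDiff_mul_coneCutoff hm hc hsupp
  set m₂ : E3 → ℂ := fun ξ => m ξ - m₁ ξ with hm₂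
  have hm₂e : ∀ ξ, m₂ ξ = m ξ * (1 - (coneCutoff ξ : ℂ)) := fun ξ => by simp only [hm₂, hm₁]; ring
  have hm₂s : ContDiff ℝ (⊤ : ℕ∞) m₂ := hm.sub hm₁s
  have hm₁c : HasCompactSupport m₁ := hmc.mul_right
  have hm₂c : HasCompactSupport m₂ := by
    have : m₂ = fun ξ => m ξ * (1 - (coneCutoff ξ : ℂ)) := funext hm₂e
    rw [this]
    exact hmc.mul_right
  obtain ⟨C₁, hC₁, h₁⟩ := exists_nearAxis_bound (m := m₁) hm₁s hR hm₁c hKcl hK0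
    (fun ξ h => hsupp ξ (left_ne_zero_of_mul h))
    (fun ξ h => ⟨h2R ξ (left_ne_zero_of_mul h), hne2 ξ (left_ne_zero_of_mul h),
      horiz_le_of_coneCutoff_ne_zero (hne2 ξ (left_ne_zero_of_mul h))
        (fun h0 => right_ne_zero_of_mul h (by rw [h0, Complex.ofReal_zero]))⟩)
    hw (fun y => lt_of_lt_of_le (by positivity) (hw1 y)) hwi
  obtain ⟨C₂, hC₂, h₂⟩ := exists_offAxis_decay_horizontal (m := m₂) hm₂s hm₂c (c₁ := c / 4) (c₂ := R) (c₃ := R)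
    (c₄ := c) (by positivity) hR hR hc
    (fun ξ h => by
      rw [hm₂e] at h
      have hmξ := left_ne_zero_of_mul h
      refine ⟨?_, ?_, h2R ξ hmξ⟩
      · have h3 := le_horiz_of_coneCutoff_ne_one (hne2 ξ hmξ) (fun h0 => right_ne_zero_of_mul h (by rw [h0]; simp))
        have h4 := hsupp ξ hmξ
        linarith
      · have h5 := hKR ξ hmξ
        rw [horiz, Real.sqrt_le_left hR.le]
        have h6 := norm_sq_eq_sum ξ
        nlinarith [sq_nonneg (ξ 2), norm_nonneg ξ])
    (fun ξ h => by
      rw [hm₂e] at h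
      exact hsupp ξ (left_ne_zero_of_mul h))
  obtain ⟨D, hD, hDm⟩ := exists_bound_iterate_scal hm₁s hm₁c 0
  set V := (volume.real (tsupport m₁) + 1) / 2 with hV
  have hV0 : 0 < V := by have := measureReal_nonneg (μ := volume) (s := tsupport m₁); positivity
  refine ⟨C₁ + D * (V * 256) + C₂, by positivity, ?_⟩
  intro g hg hgc N hN hgN x t
  have hF := contDiff_fourier_of_compactSupport hg hgc
  have hw' : Continuous fun x : E3 => w (x 0, x 1) := by fun_prop
  have b1 := h₁ g hg hgc N hN (hgN 0 (by norm_num)) x t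
  have b2 := norm_integral_osc_mul_le (F := 𝓕 g) x t hm₁c hF.continuous (fun ξ => (hDm 0 le_rfl ξ).1)
  have b3 : ∫ ξ in tsupport m₁, ‖𝓕 g ξ‖ ≤ V * (256 * N) :=
    setIntegral_fourier_dualScal_le hw'
      (fun x => le_trans (by nlinarith [sq_nonneg (x 0), sq_nonneg (x 1)]) (hw1 (x 0, x 1)))
      hg hgc hN hgN hm₁c.isCompact (j := 0) (by norm_num)
  have b4 : ‖∫ ξ, osc x t ξ * m₁ ξ * 𝓕 g ξ‖ ≤ D * (V * 256) * N := by
    refine b2.trans ?_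
    calc _ ≤ D * (V * (256 * N)) := by gcongr
      _ = _ := by ring
  have b5 := sqrt_one_add_sq_mul_le (norm_nonneg _) b1 b4
  have b6 := h₂ g hg hgc N hN (fun a ha => integral_norm_sq_le_of_weight hw' (by fun_prop)
    (fun x => hw1 (x 0, x 1)) (contDiff_iterate_scal hg a).continuous (hasCompactSupport_iterate_scal hgc a)
    (hgN a ha)) x t
  have hi : ∀ m : E3 → ℂ, ContDiff ℝ (⊤ : ℕ∞) m → HasCompactSupport m → (∀ ξ, m ξ ≠ 0 → ξ ∈ K) →
      Integrable fun ξ => osc x t ξ * m ξ * 𝓕 g ξ := fun m hm hmc hmK =>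
    ((contDiff_osc_mul x t hm hKcl hK0 hmK).continuous.mul hF.continuous).integrable_of_hasCompactSupport
      (hmc.mul_left.mul_right)
  have hi₁ := hi m₁ hm₁s hm₁c (fun ξ h => hsupp ξ (left_ne_zero_of_mul h))
  have hi₂ := hi m₂ hm₂s hm₂c (fun ξ h => by
    rw [hm₂e] at h
    exact hsupp ξ (left_ne_zero_of_mul h))
  have e : ∫ ξ, osc x t ξ * m ξ * 𝓕 g ξ
      = (∫ ξ, osc x t ξ * m₁ ξ * 𝓕 g ξ) + ∫ ξ, osc x t ξ * m₂ ξ * 𝓕 g ξ := by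
    rw [← integral_add hi₁ hi₂]
    congr 1; ext ξ; simp only [hm₂]; ring
  rw [e]
  calc _ ≤ √(1 + t ^ 2) * (‖∫ ξ, osc x t ξ * m₁ ξ * 𝓕 g ξ‖ + ‖∫ ξ, osc x t ξ * m₂ ξ * 𝓕 g ξ‖) := by
        gcongr; exact norm_add_le _ _
    _ ≤ C₁ * N + D * (V * 256) * N + C₂ * N := by rw [mul_add]; exact add_le_add b5 b6
    _ = _ := by ring

/-! ### Extension to band-limited functions -/

theorem iterate_scal_comp_smul {f : E3 → ℂ} (hf : ContDiff ℝ (⊤ : ℕ∞) f) (r : ℝ) (a : ℕ) :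
    scal^[a] (fun x => f (r • x)) = fun x => (scal^[a] f) (r • x) := by
  induction a with
  | zero => rfl
  | succ a ih =>
    rw [Function.iterate_succ_apply', ih, Function.iterate_succ_apply']
    ext x
    have h1 : HasFDerivAt (fun x : E3 => r • x) (r • ContinuousLinearMap.id ℝ E3) x :=
      (hasFDerivAt_id x).const_smul r
    have h2 := (((contDiff_iterate_scal hf a).differentiable (by simp)) (r • x)).hasFDerivAt.comp x h1
    rw [scal, scal]
    have h3 : fderiv ℝ (fun x => (scal^[a] f) (r • x)) x = _ := h2.fderiv
    rw [h3]
    simp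

/-- Fubini moves the transform from `h` to the Schwartz function, so that integrability of `h`
suffices. The reflection `x ↦ -x` exchanges the transform with its inverse. -/
theorem integral_fourier_mul_fourierInv (S : 𝓢(E3, ℂ)) {h : E3 → ℂ} (hh : Integrable h) :
    ∫ x, 𝓕 S x * 𝓕⁻ h x = ∫ ξ, S ξ * h ξ := by
  have e1 : ∫ x, 𝓕 S x * 𝓕⁻ h x = ∫ x, 𝓕⁻ (S : E3 → ℂ) x * 𝓕 h x := by
    rw [← integral_neg_eq_self]
    congr 1; ext x
    rw [Real.fourierInv_eq_fourier_neg h, neg_neg, Real.fourierInv_eq_fourier_neg, SchwartzMap.fourier_coe]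
  have hi : Integrable (𝓕⁻ (S : E3 → ℂ)) := by
    have := (𝓕⁻ S).integrable (μ := volume)
    rwa [SchwartzMap.fourierInv_coe] at this
  have e2 := VectorFourier.integral_fourierIntegral_smul_eq_flip (μ := volume) (ν := volume)
    (L := innerₗ E3) Real.continuous_fourierChar continuous_inner hi hh
  have e3 : 𝓕 (𝓕⁻ (S : E3 → ℂ)) = S := by
    have h2 : 𝓕 (𝓕⁻ S : 𝓢(E3, ℂ)) = S := FourierTransform.fourier_fourierInv_eq S
    have h3 := congrArg (fun f : 𝓢(E3, ℂ) => (f : E3 → ℂ)) h2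
    simp only [SchwartzMap.fourier_coe, SchwartzMap.fourierInv_coe] at h3
    exact h3
  rw [flip_innerₗ] at e2
  simp only [smul_eq_mul] at e2
  rw [e1]
  refine e2.symm.trans ?_
  change ∫ ξ, 𝓕 (𝓕⁻ (S : E3 → ℂ)) ξ * h ξ = _
  rw [e3]

theorem contDiff_fourierInv {h : E3 → ℂ} (hh : Integrable h) {R : ℝ}
    (hR : ∀ ξ, h ξ ≠ 0 → ‖ξ‖ ≤ R) : ContDiff ℝ (⊤ : ℕ∞) (𝓕⁻ h) := by
  have h1 : ContDiff ℝ (⊤ : ℕ∞) (𝓕 h) := by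
    apply Real.contDiff_fourier
    intro n _
    refine Integrable.mono' (hh.norm.const_mul (R ^ n)) ?_ (Filter.Eventually.of_forall fun ξ => ?_)
    · exact (by fun_prop : Continuous fun v : E3 => ‖v‖ ^ n).aestronglyMeasurable.mul hh.1.norm
    · rw [Real.norm_eq_abs, abs_of_nonneg (by positivity)]
      by_cases h0 : h ξ = 0
      · simp [h0]
      · have := hR ξ h0
        gcongr
  have h2 : 𝓕⁻ h = fun x => 𝓕 h (-x) := funext fun x => Real.fourierInv_eq_fourier_neg h x
  rw [h2]
  exact h1.comp contDiff_neg

theorem norm_fourierInv_le {h : E3 → ℂ} (x : E3) : ‖𝓕⁻ h x‖ ≤ ∫ ξ, ‖h ξ‖ := by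
  rw [Real.fourierInv_eq']
  refine (norm_integral_le_integral_norm _).trans_eq ?_
  congr 1; ext ξ
  rw [norm_smul, Complex.norm_exp_ofReal_mul_I, one_mul]

theorem exists_smooth_cutoff : ∃ κ : E3 → ℂ, ContDiff ℝ (⊤ : ℕ∞) κ ∧ HasCompactSupport κ ∧ κ 0 = 1 := by
  obtain ⟨κ⟩ : Nonempty (ContDiffBump (0 : E3)) := inferInstance
  refine ⟨fun x => (κ x : ℂ), Complex.ofRealCLM.contDiff.comp κ.contDiff, ?_, ?_⟩
  · exact κ.hasCompactSupport.comp_left (g := fun r : ℝ => (r : ℂ)) (by simp)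
  · have : κ 0 = 1 := κ.one_of_mem_closedBall (by simp [κ.rIn_pos.le])
    simp [this]

set_option maxHeartbeats 1000000 in
/-- Transfer of a decay estimate from compactly supported functions to band-limited functions. -/
theorem decay_of_bandlimited {m : E3 → ℂ} (hm : ContDiff ℝ (⊤ : ℕ∞) m) (hmc : HasCompactSupport m)
    {K : Set E3} (hK : IsClosed K) (hK0 : (0 : E3) ∉ K) (hmK : ∀ ξ, m ξ ≠ 0 → ξ ∈ K)
    {W : E3 → ℝ} (hW : Continuous W) (hW0 : ∀ x, 0 ≤ W x)
    (hdecay : ∃ C : ℝ, 0 < C ∧ ∀ g : E3 → ℂ, ContDiff ℝ (⊤ : ℕ∞) g → HasCompactSupport g → ∀ N : ℝ, 0 < N →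
      (∀ a ≤ 3, ∫ x : E3, W x * ‖(scal^[a] g) x‖ ^ 2 ≤ N ^ 2) →
      ∀ (x : E3) (t : ℝ), √(1 + t ^ 2) * ‖∫ ξ, osc x t ξ * m ξ * 𝓕 g ξ‖ ≤ C * N) :
    ∃ C : ℝ, 0 < C ∧ ∀ h : E3 → ℂ, Integrable h → (∀ ξ, h ξ ≠ 0 → m ξ = 1) → ∀ N : ℝ, 0 < N →
      (∀ a ≤ 3, ∫⁻ x, ENNReal.ofReal (W x) * ‖(scal^[a] (𝓕⁻ h)) x‖ₑ ^ 2 ≤ ENNReal.ofReal (N ^ 2)) →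
      ∀ (x : E3) (t : ℝ), √(1 + t ^ 2) * ‖∫ ξ, osc x t ξ * h ξ‖ ≤ C * N := by
  obtain ⟨C, hC, hmain⟩ := hdecay
  obtain ⟨κ, hκ, hκc, hκ0⟩ := exists_smooth_cutoff
  obtain ⟨D, hD, hDκ⟩ := exists_bound_iterate_scal hκ hκc 3
  obtain ⟨R', hR', hmR⟩ := exists_pos_radius hmc
  -- Leibniz with three scaling fields gives `2³D`; Cauchy–Schwarz over at most four terms and the
  -- sum of their four energies give another factor 4.
  refine ⟨C * (32 * D), by positivity, ?_⟩
  intro h hh hhm N hN hE x t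
  set f := 𝓕⁻ h with hf
  have hfs : ContDiff ℝ (⊤ : ℕ∞) f := contDiff_fourierInv hh (R := R') (fun ξ hξ => hmR ξ (by
    rw [hhm ξ hξ]; exact one_ne_zero))
  set M : E3 → ℂ := fun ξ => osc x t ξ * m ξ with hM
  have hMs : ContDiff ℝ (⊤ : ℕ∞) M := contDiff_osc_mul x t hm hK hK0 hmK
  have hMc : HasCompactSupport M := hmc.mul_left
  -- energies of `f`
  have hint : ∀ a ≤ 3, Integrable (fun x => W x * ‖(scal^[a] f) x‖ ^ 2) ∧
      ∫ x, W x * ‖(scal^[a] f) x‖ ^ 2 ≤ N ^ 2 := by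
    intro a ha
    have hc : Continuous fun x => W x * ‖(scal^[a] f) x‖ ^ 2 :=
      hW.mul ((contDiff_iterate_scal hfs a).continuous.norm.pow 2)
    have h0 : ∀ x, 0 ≤ W x * ‖(scal^[a] f) x‖ ^ 2 := fun x => mul_nonneg (hW0 x) (sq_nonneg _)
    have e : ∀ x, ENNReal.ofReal (W x * ‖(scal^[a] f) x‖ ^ 2) = ENNReal.ofReal (W x) * ‖(scal^[a] f) x‖ₑ ^ 2 := by
      intro x
      rw [ENNReal.ofReal_mul (hW0 x), ENNReal.ofReal_pow (norm_nonneg _), ofReal_norm]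
    have h1 := hE a ha
    simp only [← e] at h1
    refine ⟨⟨hc.aestronglyMeasurable, ?_⟩, ?_⟩
    · rw [hasFiniteIntegral_iff_ofReal (Filter.Eventually.of_forall h0)]
      exact h1.trans_lt ENNReal.ofReal_lt_top
    · rw [integral_eq_lintegral_of_nonneg_ae (Filter.Eventually.of_forall h0) hc.aestronglyMeasurable]
      exact ENNReal.toReal_le_of_le_ofReal (by positivity) h1
  -- truncations
  set fR : ℕ → E3 → ℂ := fun n => (fun x => κ (((n : ℝ) + 1)⁻¹ • x)) * f with hfR
  have hκn : ∀ n : ℕ, ContDiff ℝ (⊤ : ℕ∞) fun x => κ (((n : ℝ) + 1)⁻¹ • x) := fun n =>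
    hκ.comp (contDiff_const_smul _)
  have hfRs : ∀ n, ContDiff ℝ (⊤ : ℕ∞) (fR n) := fun n => (hκn n).mul hfs
  have hfRc : ∀ n, HasCompactSupport (fR n) := by
    intro n
    apply HasCompactSupport.mul_right
    have hn : ((n : ℝ) + 1)⁻¹ ≠ 0 := by positivity
    exact hκc.comp_homeomorph (Homeomorph.smulOfNeZero _ hn)
  -- Scaling fields commute with dilations, so those of `κ(x/(n+1))` are bounded by `D`
  -- independently of `n`, and truncation costs only a constant.
  have hfRE : ∀ n, ∀ a ≤ 3, ∫ x, W x * ‖(scal^[a] (fR n)) x‖ ^ 2 ≤ (32 * D * N) ^ 2 := by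
    intro n a ha
    have hpt : ∀ x, W x * ‖(scal^[a] (fR n)) x‖ ^ 2
        ≤ (8 * D) ^ 2 * 4 * ∑ j ∈ Finset.range (a + 1), W x * ‖(scal^[j] f) x‖ ^ 2 := by
      intro x
      have h1 := norm_iterate_scal_mul_le (D := D) x a (hκn n) hfs (fun j hj => by
        rw [iterate_scal_comp_smul hκ]; exact (hDκ j (by omega) _).1)
      have h2 := sq_sum_le_card_mul_sum_sq (s := Finset.range (a + 1)) (f := fun j => ‖(scal^[j] f) x‖)
      rw [Finset.card_range] at h2
      have h3 : ((a + 1 : ℕ) : ℝ) ≤ 4 := by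
        have : a + 1 ≤ 4 := by omega
        exact_mod_cast this
      have h4 : (2 : ℝ) ^ a ≤ 8 := by
        calc (2 : ℝ) ^ a ≤ 2 ^ 3 := pow_le_pow_right₀ (by norm_num) ha
          _ = 8 := by norm_num
      have h5 : ‖(scal^[a] (fR n)) x‖ ≤ 8 * D * ∑ j ∈ Finset.range (a + 1), ‖(scal^[j] f) x‖ := by
        refine h1.trans ?_
        gcongr
      have h6 : ‖(scal^[a] (fR n)) x‖ ^ 2 ≤ (8 * D) ^ 2 * (4 * ∑ j ∈ Finset.range (a + 1), ‖(scal^[j] f) x‖ ^ 2) := by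
        calc _ ≤ (8 * D * ∑ j ∈ Finset.range (a + 1), ‖(scal^[j] f) x‖) ^ 2 := by gcongr
          _ = (8 * D) ^ 2 * (∑ j ∈ Finset.range (a + 1), ‖(scal^[j] f) x‖) ^ 2 := by rw [mul_pow]
          _ ≤ _ := by
            have h7 : 0 ≤ ∑ j ∈ Finset.range (a + 1), ‖(scal^[j] f) x‖ ^ 2 :=
              Finset.sum_nonneg fun j _ => sq_nonneg _
            have h8 := mul_le_mul_of_nonneg_right h3 h7
            have h9 := h2.trans h8
            gcongr
      rw [← Finset.mul_sum]
      calc _ ≤ W x * ((8 * D) ^ 2 * (4 * ∑ j ∈ Finset.range (a + 1), ‖(scal^[j] f) x‖ ^ 2)) :=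
            mul_le_mul_of_nonneg_left h6 (hW0 x)
        _ = _ := by ring
    have hj : ∀ j ∈ Finset.range (a + 1), j ≤ 3 := fun j hj => by have := Finset.mem_range.1 hj; omega
    calc ∫ x, W x * ‖(scal^[a] (fR n)) x‖ ^ 2
        ≤ ∫ x, (8 * D) ^ 2 * 4 * ∑ j ∈ Finset.range (a + 1), W x * ‖(scal^[j] f) x‖ ^ 2 := by
          apply integral_mono
          · exact integrable_weight_norm_sq hW (contDiff_iterate_scal (hfRs n) a).continuous
              (hasCompactSupport_iterate_scal (hfRc n) a)
          · exact (integrable_finsetSum _ fun j h => (hint j (hj j h)).1).const_mul _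
          · exact hpt
      _ = (8 * D) ^ 2 * 4 * ∑ j ∈ Finset.range (a + 1), ∫ x, W x * ‖(scal^[j] f) x‖ ^ 2 := by
          rw [integral_const_mul, integral_finsetSum _ fun j h => (hint j (hj j h)).1]
      _ ≤ (8 * D) ^ 2 * 4 * ∑ j ∈ Finset.range (a + 1), N ^ 2 := by
          gcongr with j h
          exact (hint j (hj j h)).2
      _ ≤ (8 * D) ^ 2 * 4 * (4 * N ^ 2) := by
          rw [Finset.sum_const, Finset.card_range, nsmul_eq_mul]
          have h3 : ((a + 1 : ℕ) : ℝ) ≤ 4 := by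
            have : a + 1 ≤ 4 := by omega
            exact_mod_cast this
          gcongr
      _ = _ := by ring
  have hbd : ∀ n, √(1 + t ^ 2) * ‖∫ ξ, M ξ * 𝓕 (fR n) ξ‖ ≤ C * (32 * D * N) := fun n =>
    hmain (fR n) (hfRs n) (hfRc n) (32 * D * N) (by positivity) (hfRE n) x t
  -- passage to the limit
  have hswap : ∀ n, ∫ ξ, M ξ * 𝓕 (fR n) ξ = ∫ y, 𝓕 M y * fR n y := fun n =>
    (SchwartzMap.integral_fourier_mul_eq (hMc.toSchwartzMap hMs) ((hfRc n).toSchwartzMap (hfRs n))).symm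
  have hFM : Integrable (𝓕 M) := (𝓕 (hMc.toSchwartzMap hMs)).integrable (μ := volume)
  -- Dominated convergence: `𝓕 M` is Schwartz, and the truncations are bounded by `D` times the `L¹`
  -- norm of `h`.
  have hlim : Filter.Tendsto (fun n => ∫ y, 𝓕 M y * fR n y) Filter.atTop (nhds (∫ y, 𝓕 M y * f y)) := by
    apply tendsto_integral_of_dominated_convergence (fun y => ‖𝓕 M y‖ * (D * ∫ ξ, ‖h ξ‖))
    · intro n
      exact hFM.1.mul (hfRs n).continuous.aestronglyMeasurable
    · exact hFM.norm.mul_const _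
    · intro n
      refine Filter.Eventually.of_forall fun y => ?_
      rw [norm_mul]
      refine mul_le_mul_of_nonneg_left ?_ (norm_nonneg _)
      simp only [hfR, Pi.mul_apply, norm_mul]
      exact mul_le_mul (hDκ 0 (by norm_num) _).1 (norm_fourierInv_le y) (norm_nonneg _) hD.le
    · refine Filter.Eventually.of_forall fun y => ?_
      apply Filter.Tendsto.const_mul
      have h1 : Filter.Tendsto (fun n : ℕ => κ (((n : ℝ) + 1)⁻¹ • y)) Filter.atTop (nhds (κ ((0 : ℝ) • y))) := by
        have h2 : Filter.Tendsto (fun n : ℕ => ((n : ℝ) + 1)⁻¹) Filter.atTop (nhds 0) := by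
          simpa using tendsto_one_div_add_atTop_nhds_zero_nat (𝕜 := ℝ)
        exact (hκ.continuous.tendsto _).comp (h2.smul_const y)
      rw [zero_smul, hκ0] at h1
      simpa [hfR] using h1.mul_const (f y)
  have hfin : ∫ y, 𝓕 M y * f y = ∫ ξ, osc x t ξ * h ξ := by
    refine (integral_fourier_mul_fourierInv (hMc.toSchwartzMap hMs) hh).trans ?_
    congr 1; ext ξ
    change M ξ * h ξ = _
    simp only [hM]
    by_cases h0 : h ξ = 0
    · simp [h0]
    · rw [hhm ξ h0, mul_one]
  rw [hfin] at hlim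
  have h1 := (hlim.norm.const_mul (√(1 + t ^ 2)))
  refine (le_of_tendsto h1 (Filter.Eventually.of_forall fun n => ?_)).trans_eq
    (by ring : C * (32 * D * N) = _)
  rw [← hswap]
  exact hbd n

/-! ### From dyadic localizations to power weights -/

theorem locWeight_zero_zero (ψ : ℝ → ℝ) (r : ℝ) : locWeight ψ 0 0 r = ψ r := by
  simp [locWeight]

theorem locWeight_zero_of_pos (ψ : ℝ → ℝ) {L : ℕ} (hL : 1 ≤ L) (r : ℝ) :
    locWeight ψ 0 L r = ψ (((2 : ℝ) ^ L)⁻¹ * r) - ψ (2 * (((2 : ℝ) ^ L)⁻¹ * r)) := by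
  have h1 : -(0 : ℤ) + 1 ≤ (L : ℤ) := by simpa using hL
  rw [locWeight, if_pos h1, dyadic, zpow_neg, zpow_natCast]

/-- With `L = l + k`, the localization adapted to frequency `2^k` is the one at frequency 1 after
the dilation of space by `2^k`. -/
theorem locWeight_shift (ψ : ℝ → ℝ) (k : ℤ) (L : ℕ) (r : ℝ) :
    locWeight ψ k (L - k) r = locWeight ψ 0 L ((2 : ℝ) ^ k * r) := by
  have e : (2 : ℝ) ^ (-((L : ℤ) - k)) * r = (2 : ℝ) ^ (-(L : ℤ)) * ((2 : ℝ) ^ k * r) := by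
    rw [← mul_assoc, ← zpow_add₀ (by norm_num)]
    congr 2; ring
  unfold locWeight
  have h1 : (-k + 1 ≤ (L : ℤ) - k) ↔ (-(0 : ℤ) + 1 ≤ (L : ℤ)) := by omega
  have h2 : ((L : ℤ) - k = -k) ↔ ((L : ℤ) = -(0 : ℤ)) := by omega
  simp only [h1, h2, e]

theorem continuous_locWeight {ψ : ℝ → ℝ} (hψ : Continuous ψ) (L : ℕ) :
    Continuous (locWeight ψ 0 L) := by
  rcases Nat.eq_zero_or_pos L with rfl | hL
  · have : locWeight ψ 0 (0 : ℕ) = ψ := funext fun r => by simpa using locWeight_zero_zero ψ r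
    rw [this]; exact hψ
  · have : locWeight ψ 0 L = _ := funext fun r => locWeight_zero_of_pos ψ hL r
    rw [this]; fun_prop

/-- Take the least `L` with `r ≤ 1.8 · 2^L`. If `L = 0` the weight is 1. Otherwise, with `s =
r/2^{L-1}` in `(1.8, 3.6]`, the weight at `L` is `1 - ψ(s)`, while if `ψ(s) > 1/2` then `s < 2` and
the weight at `L - 1` is `ψ(s)`; one of the two is at least `1/2`. -/
theorem exists_half_le_locWeight {ψ : ℝ → ℝ} (hψ : IsRadialBump ψ) {r : ℝ} (hr : 0 ≤ r) :
    ∃ L : ℕ, 1 / 2 ≤ locWeight ψ 0 L r ∧ r ≤ 2 * 2 ^ L := by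
  have hex : ∃ L : ℕ, r ≤ 1.8 * 2 ^ L := by
    obtain ⟨L, hL⟩ := pow_unbounded_of_one_lt r (by norm_num : (1 : ℝ) < 2)
    refine ⟨L, ?_⟩
    have : (0 : ℝ) < 2 ^ L := by positivity
    linarith
  classical
  set L := Nat.find hex with hL
  have h1 : r ≤ 1.8 * 2 ^ L := Nat.find_spec hex
  have hp : (0 : ℝ) < 2 ^ L := by positivity
  have hone : ∀ s, 0 ≤ s → s ≤ 1.8 → ψ s = 1 := fun s h h' => hψ.eq_one s (by rwa [abs_of_nonneg h])
  have hzero : ∀ s, 2 ≤ s → ψ s = 0 := fun s h => hψ.eq_zero s (h.trans (le_abs_self s))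
  rcases Nat.eq_zero_or_pos L with h0 | h0
  · refine ⟨0, ?_, ?_⟩
    · rw [h0, pow_zero, mul_one] at h1
      have := locWeight_zero_zero ψ r
      rw [Nat.cast_zero, this, hone r hr h1]; norm_num
    · rw [h0] at h1; linarith
  · have h2 : 1.8 * 2 ^ (L - 1) < r := by
      have := Nat.find_min hex (Nat.sub_lt h0 one_pos)
      exact not_le.1 this
    obtain ⟨L', hL'⟩ : ∃ L', L = L' + 1 := ⟨L - 1, by omega⟩
    rw [hL', Nat.add_sub_cancel] at h2
    rw [hL', pow_succ] at h1
    have hp' : (0 : ℝ) < 2 ^ L' := by positivity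
    set s := (2 ^ L' : ℝ)⁻¹ * r with hs
    have hrs : r = 2 ^ L' * s := by rw [hs]; field_simp
    have hs1 : 1.8 < s := by
      rw [hrs] at h2
      nlinarith
    have hs2 : s ≤ 3.6 := by
      rw [hrs] at h1
      have : 2 ^ L' * s ≤ 2 ^ L' * 3.6 := by linarith
      exact le_of_mul_le_mul_left this hp'
    have hhalf : ((2 : ℝ) ^ L)⁻¹ * r = s / 2 := by
      rw [hL', hrs, pow_succ]; field_simp
    by_cases h3 : ψ s ≤ 1 / 2
    · refine ⟨L, ?_, by linarith [hp, hL' ▸ (pow_succ (2 : ℝ) L')]⟩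
      rw [locWeight_zero_of_pos ψ h0, hhalf, hone (s / 2) (by linarith) (by linarith),
        mul_div_cancel₀ s (by norm_num)]
      linarith
    · rw [not_le] at h3
      have hs3 : s < 2 := by
        by_contra hge
        rw [hzero s (not_lt.1 hge)] at h3
        linarith
      refine ⟨L', ?_, by rw [hrs]; nlinarith⟩
      rcases Nat.eq_zero_or_pos L' with h4 | h4
      · have hsr : s = r := by rw [hs, h4]; simp
        have := locWeight_zero_zero ψ r
        rw [h4, Nat.cast_zero, this, ← hsr]
        exact h3.le
      · rw [locWeight_zero_of_pos ψ h4, ← hs, hzero (2 * s) (by linarith)]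
        linarith

/-- A dyadic family of weighted `L²` bounds controls a power weight. -/
theorem exists_lintegral_power_weight_le {ψ : ℝ → ℝ} (hψ : IsRadialBump ψ) {β : ℝ} (hβ : 0 < β) :
    ∃ C : ℝ, 0 < C ∧ ∀ r : E3 → ℝ, Continuous r → (∀ x, 0 ≤ r x) → ∀ g : E3 → ℂ, Continuous g →
      ∀ B : ℝ≥0∞, (∀ L : ℕ, ∫⁻ x, ‖(locWeight ψ 0 L (r x) : ℂ) * g x‖ₑ ^ 2
        ≤ ENNReal.ofReal ((2 : ℝ) ^ (-(2 * (1 + β) * (L : ℝ)))) * B) →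
      ∫⁻ x, ENNReal.ofReal (2 * (1 + r x) ^ (2 + β)) * ‖g x‖ₑ ^ 2 ≤ ENNReal.ofReal C * B := by
  -- The ratio of the geometric series: `2^{(2+β)L}` from the power weight times `2^{-2(1+β)L}` from
  -- the energies is `2^{-βL}`.
  set q : ℝ := (2 : ℝ) ^ (-β) with hq
  have hq0 : 0 < q := by positivity
  have hq1 : q < 1 := Real.rpow_lt_one_of_one_lt_of_neg (by norm_num) (by linarith)
  -- The 8 is the prefactor 2 times 4, the inverse square of the lower bound `1/2` for the
  -- localization; the 3 comes from `1 + r ≤ 3 · 2^L`.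
  set c : ℝ := 8 * 3 ^ (2 + β) with hc
  have hc0 : 0 < c := by positivity
  refine ⟨c * (1 - q)⁻¹, by have : 0 < 1 - q := by linarith
                            positivity, ?_⟩
  intro r hr hr0 g hg B hB
  have hpt : ∀ x, ENNReal.ofReal (2 * (1 + r x) ^ (2 + β)) * ‖g x‖ₑ ^ 2
      ≤ ∑' L : ℕ, ENNReal.ofReal (c * (2 : ℝ) ^ ((2 + β) * (L : ℝ))) * ‖(locWeight ψ 0 L (r x) : ℂ) * g x‖ₑ ^ 2 := by
    intro x
    obtain ⟨L, hL1, hL2⟩ := exists_half_le_locWeight hψ (hr0 x)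
    refine le_trans ?_ (ENNReal.le_tsum L)
    rw [enorm_mul, mul_pow, ← mul_assoc]
    gcongr
    rw [← ofReal_norm, ← ENNReal.ofReal_pow (norm_nonneg _), ← ENNReal.ofReal_mul (by positivity)]
    apply ENNReal.ofReal_le_ofReal
    rw [Complex.norm_real, Real.norm_eq_abs, sq_abs]
    have h1 : 1 + r x ≤ 3 * 2 ^ L := by
      have : (1 : ℝ) ≤ 2 ^ L := one_le_pow₀ (by norm_num)
      linarith
    have h2 : (1 + r x) ^ (2 + β) ≤ 3 ^ (2 + β) * (2 : ℝ) ^ ((2 + β) * (L : ℝ)) := by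
      calc (1 + r x) ^ (2 + β) ≤ (3 * 2 ^ L) ^ (2 + β) := by
            apply Real.rpow_le_rpow (by linarith [hr0 x]) h1 (by linarith)
        _ = _ := by
          rw [Real.mul_rpow (by norm_num) (by positivity), ← Real.rpow_natCast, ← Real.rpow_mul (by norm_num),
            mul_comm (L : ℝ)]
    have h3 : (1 / 4 : ℝ) ≤ locWeight ψ 0 L (r x) ^ 2 := by nlinarith
    have h4 : 0 ≤ 3 ^ (2 + β) * (2 : ℝ) ^ ((2 + β) * (L : ℝ)) := by positivity
    rw [hc]
    nlinarith
  calc _ ≤ ∫⁻ x, ∑' L : ℕ, ENNReal.ofReal (c * (2 : ℝ) ^ ((2 + β) * (L : ℝ))) * ‖(locWeight ψ 0 L (r x) : ℂ) * g x‖ₑ ^ 2 :=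
        lintegral_mono hpt
    _ = ∑' L : ℕ, ENNReal.ofReal (c * (2 : ℝ) ^ ((2 + β) * (L : ℝ))) * ∫⁻ x, ‖(locWeight ψ 0 L (r x) : ℂ) * g x‖ₑ ^ 2 := by
        rw [lintegral_tsum]
        · congr 1; ext L
          rw [lintegral_const_mul']
          exact ENNReal.ofReal_ne_top
        · intro L
          have h1 := continuous_locWeight hψ.smooth.continuous L
          have h2 : Continuous fun x => (locWeight ψ 0 L (r x) : ℂ) * g x :=
            (Complex.continuous_ofReal.comp (h1.comp hr)).mul hg
          exact ((h2.enorm.measurable.pow_const 2).const_mul _).aemeasurable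
    _ ≤ ∑' L : ℕ, ENNReal.ofReal c * B * ENNReal.ofReal q ^ L := by
        apply ENNReal.tsum_le_tsum
        intro L
        refine (mul_le_mul_right (hB L) _).trans_eq ?_
        rw [← mul_assoc, ← ENNReal.ofReal_mul (by positivity), ← ENNReal.ofReal_pow hq0.le,
          mul_right_comm (ENNReal.ofReal c), ← ENNReal.ofReal_mul hc0.le]
        congr 2
        rw [mul_assoc c, ← Real.rpow_add (by norm_num), hq, ← Real.rpow_natCast, ← Real.rpow_mul (by norm_num)]
        congr 2; ring
    _ = _ := by
        rw [ENNReal.tsum_mul_left, ENNReal.tsum_geometric, mul_right_comm, ENNReal.ofReal_mul hc0.le,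
          ENNReal.ofReal_inv_of_pos (by linarith), ENNReal.ofReal_sub _ hq0.le, ENNReal.ofReal_one]

/-! ### Rescaling a dyadic piece to unit frequency -/

theorem lintegral_comp_smul_E3 {r : ℝ} (hr : 0 < r) (G : E3 → ℝ≥0∞) :
    ∫⁻ x, G (r • x) = ENNReal.ofReal ((r ^ 3)⁻¹) * ∫⁻ x, G x := by
  have h1 := Measure.map_addHaar_smul (volume : Measure E3) hr.ne'
  rw [finrank_euclideanSpace_fin, abs_of_pos (by positivity : 0 < (r ^ 3)⁻¹)] at h1
  have h2 := (Homeomorph.smulOfNeZero r hr.ne' : E3 ≃ₜ E3).measurableEmbedding.lintegral_map (μ := volume) G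
  have h3 : Measure.map (⇑(Homeomorph.smulOfNeZero r hr.ne' : E3 ≃ₜ E3)) volume = Measure.map (r • ·) volume := rfl
  rw [h3, h1, lintegral_smul_measure] at h2
  exact h2.symm

theorem eLpNorm_two_sq (f : E3 → ℂ) : eLpNorm f 2 volume ^ 2 = ∫⁻ x, ‖f x‖ₑ ^ 2 := by
  have := eLpNorm_nnreal_pow_eq_lintegral (f := f) (μ := volume) (p := 2) (by norm_num)
  have h : ((2 : NNReal) : ℝ) = ((2 : ℕ) : ℝ) := by norm_num
  simp only [h, ENNReal.rpow_natCast] at this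
  exact this

theorem Lam_smul {r : ℝ} (hr : 0 < r) (ξ : E3) : Lam (r • ξ) = Lam ξ := by
  rw [Lam, Lam, norm_smul, Real.norm_eq_abs, abs_of_pos hr, PiLp.smul_apply, smul_eq_mul]
  rw [mul_div_mul_left _ _ hr.ne']

theorem horiz_smul {r : ℝ} (hr : 0 < r) (ξ : E3) : horiz (r • ξ) = r * horiz ξ := by
  simp only [horiz, PiLp.smul_apply, smul_eq_mul]
  rw [show (r * ξ 0) ^ 2 + (r * ξ 1) ^ 2 = r ^ 2 * (ξ 0 ^ 2 + ξ 1 ^ 2) by ring,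
    Real.sqrt_mul (by positivity), Real.sqrt_sq hr.le]

/-- The substitution `ξ = 2πrη` cancels `(2π)⁻³` and leaves `r³`. It changes the normalization of
the transform and rescales space by `r` at the same time. -/
theorem invFourier_eq_scaled {r : ℝ} (hr : 0 < r) (h : E3 → ℂ) (x : E3) :
    invFourier h x = ∫ η : E3, Complex.exp (Complex.I * (inner ℝ ((2 * Real.pi) • (r • x)) η : ℝ)) *
      ((r ^ 3 : ℝ) * h ((2 * Real.pi * r) • η)) := by
  have hpi := Real.pi_pos
  have h1 := Measure.integral_comp_smul (volume : Measure E3)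
    (fun ξ => Complex.exp (Complex.I * (inner ℝ x ξ : ℝ)) * h ξ) (2 * Real.pi * r)
  rw [finrank_euclideanSpace_fin, abs_of_pos (by positivity)] at h1
  have e : ∀ η : E3, Complex.exp (Complex.I * (inner ℝ ((2 * Real.pi) • (r • x)) η : ℝ)) *
      ((r ^ 3 : ℝ) * h ((2 * Real.pi * r) • η)) = (r ^ 3 : ℝ) *
        (Complex.exp (Complex.I * (inner ℝ x ((2 * Real.pi * r) • η) : ℝ)) * h ((2 * Real.pi * r) • η)) := by
    intro η
    rw [inner_smul_left, inner_smul_left, inner_smul_right]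
    simp only [conj_trivial]
    rw [← mul_assoc (2 * Real.pi) r]
    ring
  simp only [e]
  rw [integral_const_mul, h1, invFourier, Complex.real_smul, ← mul_assoc, ← Complex.ofReal_mul]
  congr 2
  field_simp

theorem fourierInv_eq_integral (h : E3 → ℂ) (x : E3) :
    𝓕⁻ h x = ∫ η : E3, Complex.exp (Complex.I * (inner ℝ ((2 * Real.pi) • x) η : ℝ)) * h η := by
  rw [Real.fourierInv_eq']
  congr 1; ext η
  rw [smul_eq_mul, inner_smul_left, real_inner_comm]
  simp only [conj_trivial]
  rw [mul_comm Complex.I]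

set_option maxHeartbeats 1000000 in
/-- Frequency-localized dispersive decay, uniform in the dyadic frequency. -/
theorem exists_dyadic_decay {ψ : ℝ → ℝ} (hψ : IsRadialBump ψ) {β : ℝ} (hβ : 0 < β)
    {χ : E3 → ℝ} {m : E3 → ℂ} (hm : ContDiff ℝ (⊤ : ℕ∞) m) (hmc : HasCompactSupport m)
    {K : Set E3} (hK : IsClosed K) (hK0 : (0 : E3) ∉ K) (hmK : ∀ ξ, m ξ ≠ 0 → ξ ∈ K)
    (hχm : ∀ η, χ ((2 * Real.pi) • η) ≠ 0 → m η = 1)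
    {r : E3 → ℝ} (hr : Continuous r) (hr0 : ∀ x, 0 ≤ r x) (hrs : ∀ s > 0, ∀ x, r (s • x) = s * r x)
    {W : E3 → ℝ} (hW : Continuous W) (hW0 : ∀ x, 0 ≤ W x) (hWr : ∀ x, W x ≤ 2 * (1 + r x) ^ (2 + β))
    (hdecay : ∃ C : ℝ, 0 < C ∧ ∀ g : E3 → ℂ, ContDiff ℝ (⊤ : ℕ∞) g → HasCompactSupport g → ∀ N : ℝ, 0 < N →
      (∀ a ≤ 3, ∫ x : E3, W x * ‖(scal^[a] g) x‖ ^ 2 ≤ N ^ 2) →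
      ∀ (x : E3) (t : ℝ), √(1 + t ^ 2) * ‖∫ ξ, osc x t ξ * m ξ * 𝓕 g ξ‖ ≤ C * N) :
    ∃ C : ℝ, 0 < C ∧ ∀ (Fhat : E3 → ℂ) (k : ℤ) (n₁ : ℕ) (X : ℝ≥0∞),
      Integrable (fun ξ => (χ ((2 : ℝ) ^ (-k) • ξ) : ℂ) * Fhat ξ) → X ≠ ∞ →
      (∀ (L : ℕ), ∀ a ≤ 3, normWeight n₁ β k (L - k) * eLpNorm (fun x => (locWeight ψ k (L - k) (r x) : ℂ) *
        (scal^[a] (multiplier (fun ξ => (χ ((2 : ℝ) ^ (-k) • ξ) : ℂ)) Fhat)) x) 2 volume ≤ X) →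
      ∀ (x : E3) (t : ℝ), √(1 + t ^ 2) *
        ‖multiplier (fun ξ => (χ ((2 : ℝ) ^ (-k) • ξ) : ℂ)) (fun ξ => propagator t ξ * Fhat ξ) x‖
          ≤ C * ((2 : ℝ) ^ ((3 / 2 : ℝ) * (k : ℝ) - n₁ * max 0 (k : ℝ)) * X.toReal) := by
  obtain ⟨C, hC, hmain⟩ := decay_of_bandlimited hm hmc hK hK0 hmK hW hW0 hdecay
  obtain ⟨Cw, hCw, hweight⟩ := exists_lintegral_power_weight_le hψ hβ
  obtain ⟨R, hR, hmR⟩ := exists_pos_radius hmc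
  refine ⟨C * √Cw, by positivity, ?_⟩
  intro Fhat k n₁ X hI hX hnorm x t
  have hpi := Real.pi_pos
  set ρ : ℝ := (2 : ℝ) ^ k with hρ
  have hρ0 : 0 < ρ := by positivity
  have hinv : (2 : ℝ) ^ (-k) = ρ⁻¹ := by rw [zpow_neg]
  have hcancel : ∀ η : E3, (2 : ℝ) ^ (-k) • ((2 * Real.pi * ρ) • η) = (2 * Real.pi) • η := by
    intro η
    rw [hinv, smul_smul]
    congr 1; field_simp
  -- The rescaled spectrum: it lies where `m = 1`, and the dyadic piece of `F` is `x ↦ 𝓕⁻ h (ρ •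
  -- x)`.
  set h : E3 → ℂ := fun η => (ρ ^ 3 : ℝ) * ((χ ((2 * Real.pi) • η) : ℂ) * Fhat ((2 * Real.pi * ρ) • η)) with hh
  have hhi : Integrable h := by
    have h1 := (hI.comp_smul (R := 2 * Real.pi * ρ) (by positivity)).const_mul ((ρ ^ 3 : ℝ) : ℂ)
    simp only [hcancel] at h1
    exact h1
  have hhm : ∀ η, h η ≠ 0 → m η = 1 := fun η hη => hχm η fun h0 => hη (by simp [hh, h0])
  set f := 𝓕⁻ h with hf
  have hfs : ContDiff ℝ (⊤ : ℕ∞) f := contDiff_fourierInv hhi (R := R) (fun ξ hξ => hmR ξ (by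
    rw [hhm ξ hξ]; exact one_ne_zero))
  have hmf : multiplier (fun ξ => (χ ((2 : ℝ) ^ (-k) • ξ) : ℂ)) Fhat = fun x => f (ρ • x) := by
    ext x
    rw [multiplier, invFourier_eq_scaled hρ0, hf, fourierInv_eq_integral]
    simp only [hcancel, hh]
  -- `Λ` is invariant under dilations, so the same time `t` appears after rescaling.
  have hmp : multiplier (fun ξ => (χ ((2 : ℝ) ^ (-k) • ξ) : ℂ)) (fun ξ => propagator t ξ * Fhat ξ) x
      = ∫ η, osc ((2 * Real.pi) • (ρ • x)) t η * h η := by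
    rw [multiplier, invFourier_eq_scaled hρ0]
    congr 1; ext η
    simp only [hcancel, hh, propagator, osc, Lam_smul (by positivity : 0 < 2 * Real.pi * ρ)]
    rw [Complex.ofReal_add, mul_add, Complex.exp_add]
    ring
  rw [hmp]
  set b : ℝ := (2 : ℝ) ^ ((3 / 2 : ℝ) * (k : ℝ) - n₁ * max 0 (k : ℝ)) * X.toReal with hb
  have hb0 : 0 ≤ b := by positivity
  -- dyadic energies
  have hen : ∀ a ≤ 3, ∀ L : ℕ, ∫⁻ y, ‖(locWeight ψ 0 L (r y) : ℂ) * (scal^[a] f) y‖ₑ ^ 2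
      ≤ ENNReal.ofReal ((2 : ℝ) ^ (-(2 * (1 + β) * (L : ℝ)))) * ENNReal.ofReal (b ^ 2) := by
    intro a ha L
    have h1 := hnorm L a ha
    rw [hmf, iterate_scal_comp_smul hfs] at h1
    have h2 := pow_le_pow_left' h1 2
    rw [mul_pow, eLpNorm_two_sq] at h2
    have h3 : ∀ x, locWeight ψ k (L - k) (r x) = locWeight ψ 0 L (r (ρ • x)) := fun x => by
      rw [locWeight_shift, hrs ρ hρ0]
    simp only [h3] at h2
    rw [lintegral_comp_smul_E3 hρ0 (fun y => ‖(locWeight ψ 0 L (r y) : ℂ) * (scal^[a] f) y‖ₑ ^ 2)] at h2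
    generalize ∫⁻ y, ‖(locWeight ψ 0 L (r y) : ℂ) * (scal^[a] f) y‖ₑ ^ 2 = J at h2 ⊢
    rw [normWeight, ← ENNReal.ofReal_toReal hX, ← ENNReal.ofReal_pow (by positivity),
      ← ENNReal.ofReal_pow ENNReal.toReal_nonneg, ← mul_assoc, ← ENNReal.ofReal_mul (by positivity)] at h2
    -- The squared norm weight times the Jacobian `ρ⁻³`. Its inverse is `2^{3k - 2n₁k⁺}` times
    -- `2^{-2(1+β)L}`, which produces `b²`.
    set w := ((2 : ℝ) ^ ((n₁ : ℝ) * max 0 (k : ℝ) + (1 + β) * ((((L : ℤ) - k : ℤ) : ℝ) + (k : ℝ)))) ^ 2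
      * (ρ ^ 3)⁻¹ with hw
    have hw0 : 0 < w := by positivity
    have h4 : J ≤ ENNReal.ofReal (w⁻¹) * ENNReal.ofReal (X.toReal ^ 2) := by
      calc J = ENNReal.ofReal (w⁻¹) * (ENNReal.ofReal w * J) := by
            rw [← mul_assoc, ← ENNReal.ofReal_mul (by positivity), inv_mul_cancel₀ hw0.ne',
              ENNReal.ofReal_one, one_mul]
        _ ≤ _ := by gcongr
    refine h4.trans_eq ?_
    rw [← ENNReal.ofReal_mul (by positivity), ← ENNReal.ofReal_mul (by positivity)]
    congr 1
    rw [hb, mul_pow, ← mul_assoc]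
    congr 1
    have hρ3 : ρ ^ 3 = (2 : ℝ) ^ (3 * (k : ℝ)) := by
      rw [hρ, ← Real.rpow_intCast, ← Real.rpow_natCast, ← Real.rpow_mul (by norm_num)]
      congr 1; push_cast; ring
    rw [hw, hρ3, ← Real.rpow_natCast _ 2, ← Real.rpow_natCast _ 2, ← Real.rpow_mul (by norm_num),
      ← Real.rpow_mul (by norm_num), ← Real.rpow_neg (by norm_num), ← Real.rpow_add (by norm_num),
      ← Real.rpow_neg (by norm_num), ← Real.rpow_add (by norm_num)]
    congr 1
    push_cast
    ring
  have hE : ∀ a ≤ 3, ∫⁻ y, ENNReal.ofReal (W y) * ‖(scal^[a] f) y‖ₑ ^ 2 ≤ ENNReal.ofReal (Cw * b ^ 2) := by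
    intro a ha
    have h1 := hweight r hr hr0 (scal^[a] f) (contDiff_iterate_scal hfs a).continuous (ENNReal.ofReal (b ^ 2))
      (hen a ha)
    rw [← ENNReal.ofReal_mul hCw.le] at h1
    refine le_trans (lintegral_mono fun y => ?_) h1
    gcongr
    exact hWr y
  -- The energy level `N` must be positive, whereas `b` may vanish; `ε/C` is added and then removed.
  have hfinal : ∀ ε : ℝ, 0 < ε → √(1 + t ^ 2) * ‖∫ η, osc ((2 * Real.pi) • (ρ • x)) t η * h η‖
      ≤ C * √Cw * b + ε := by
    intro ε hε
    have h1 := hmain h hhi hhm (√Cw * b + ε / C) (by positivity) (fun a ha => (hE a ha).trans (by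
      apply ENNReal.ofReal_le_ofReal
      have h2 : (√Cw * b) ^ 2 = Cw * b ^ 2 := by rw [mul_pow, Real.sq_sqrt hCw.le]
      rw [← h2]
      have : 0 < ε / C := by positivity
      gcongr
      linarith)) ((2 * Real.pi) • (ρ • x)) t
    refine h1.trans_eq ?_
    field_simp
  exact le_of_forall_pos_le_add hfinal

/-! ### The frequency cut-offs and their supports -/

theorem exists_smooth_between {s u : Set E3} (hs : IsClosed s) (hu : IsOpen u) (hsu : s ⊆ u)
    (hb : Bornology.IsBounded u) : ∃ m : E3 → ℂ, ContDiff ℝ (⊤ : ℕ∞) m ∧ HasCompactSupport m ∧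
      (∀ ξ ∈ s, m ξ = 1) ∧ ∀ ξ, m ξ ≠ 0 → ξ ∈ u := by
  obtain ⟨f, hf, -, hfu, hfs⟩ := exists_contMDiff_support_eq_eq_one_iff (n := (⊤ : ℕ∞))
    (modelWithCornersSelf ℝ E3) hu hs hsu
  refine ⟨fun ξ => (f ξ : ℂ), Complex.ofRealCLM.contDiff.comp (contMDiff_iff_contDiff.1 hf), ?_, ?_, ?_⟩
  · have h1 : HasCompactSupport f := by
      rw [HasCompactSupport, tsupport, hfu]
      exact hb.isCompact_closure
    exact h1.comp_left (g := fun r : ℝ => (r : ℂ)) (by simp)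
  · intro ξ hξ
    have := (hfs ξ).1 hξ
    simp [this]
  · intro ξ hξ
    rw [← hfu]
    exact fun h => hξ (by simp [h])

theorem dyadic_bounds {ψ : ℝ → ℝ} (hψ : IsRadialBump ψ) {s : ℝ} (hs : 0 ≤ s) :
    0 ≤ dyadic ψ s ∧ dyadic ψ s ≤ 1 := by
  have h1 := hψ.antitone (Set.mem_Ici.2 hs) (Set.mem_Ici.2 (by linarith : 0 ≤ 2 * s)) (by linarith)
  have h2 := (hψ.mem_Icc s).2
  have h3 := (hψ.mem_Icc (2 * s)).1
  unfold dyadic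
  constructor <;> linarith

theorem dyadic_support {ψ : ℝ → ℝ} (hψ : IsRadialBump ψ) {s : ℝ} (hs : 0 ≤ s) (h : dyadic ψ s ≠ 0) :
    0.9 ≤ s ∧ s ≤ 2 := by
  constructor
  · by_contra hlt
    rw [not_le] at hlt
    apply h
    rw [dyadic, hψ.eq_one s (by rw [abs_of_nonneg hs]; linarith),
      hψ.eq_one (2 * s) (by rw [abs_of_nonneg (by linarith)]; linarith), sub_self]
  · by_contra hlt
    rw [not_le] at hlt
    apply h
    rw [dyadic, hψ.eq_zero s (by rw [abs_of_nonneg hs]; linarith),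
      hψ.eq_zero (2 * s) (by rw [abs_of_nonneg (by linarith)]; linarith), sub_self]

theorem continuous_dyadic {ψ : ℝ → ℝ} (hψ : IsRadialBump ψ) : Continuous (dyadic ψ) := by
  have := hψ.smooth.continuous
  unfold dyadic; fun_prop

theorem measurable_Lam : Measurable Lam := by
  unfold Lam
  exact (by fun_prop : Continuous fun ξ : E3 => ξ 2).measurable.div continuous_norm.measurable

theorem chiH_eq_smul (ψ ϕ : ℝ → ℝ) (k : ℤ) (ξ : E3) :
    chiH ψ ϕ k ξ = chiH ψ ϕ 0 ((2 : ℝ) ^ (-k) • ξ) := by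
  have h : (0 : ℝ) < (2 : ℝ) ^ (-k) := by positivity
  rw [chiH, chiH, Lam_smul h, horiz_smul h]
  simp

theorem chiV_eq_smul (ψ ϕ : ℝ → ℝ) (k : ℤ) (ξ : E3) :
    chiV ψ ϕ k ξ = chiV ψ ϕ 0 ((2 : ℝ) ^ (-k) • ξ) := by
  have h : (0 : ℝ) < (2 : ℝ) ^ (-k) := by positivity
  rw [chiV, chiV, Lam_smul h, PiLp.smul_apply, smul_eq_mul, abs_mul, abs_of_pos h]
  simp

theorem measurable_chiH {ψ ϕ : ℝ → ℝ} (hψ : IsRadialBump ψ) (hϕ : IsAngularCutoff ϕ) (k : ℤ) :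
    Measurable (chiH ψ ϕ k) := by
  unfold chiH
  refine (hϕ.smooth.continuous.measurable.comp measurable_Lam).mul ?_
  have := continuous_dyadic hψ
  exact (by fun_prop : Continuous fun ξ : E3 => dyadic ψ ((2 : ℝ) ^ (-k) * horiz ξ)).measurable

theorem measurable_chiV {ψ ϕ : ℝ → ℝ} (hψ : IsRadialBump ψ) (hϕ : IsAngularCutoff ϕ) (k : ℤ) :
    Measurable (chiV ψ ϕ k) := by
  unfold chiV
  refine ((hϕ.smooth.continuous.measurable.comp measurable_Lam).const_sub 1).mul ?_
  have := continuous_dyadic hψ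
  exact (by fun_prop : Continuous fun ξ : E3 => dyadic ψ ((2 : ℝ) ^ (-k) * |ξ 2|)).measurable

theorem chiH_bounds {ψ ϕ : ℝ → ℝ} (hψ : IsRadialBump ψ) (hϕ : IsAngularCutoff ϕ) (k : ℤ) (ξ : E3) :
    0 ≤ chiH ψ ϕ k ξ ∧ chiH ψ ϕ k ξ ≤ 1 := by
  have h1 := dyadic_bounds hψ (mul_nonneg (by positivity : (0 : ℝ) ≤ (2 : ℝ) ^ (-k)) (horiz_nonneg ξ))
  have h2 := hϕ.mem_Icc (Lam ξ)
  exact ⟨mul_nonneg h2.1 h1.1, mul_le_one₀ h2.2 h1.1 h1.2⟩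

theorem chiV_bounds {ψ ϕ : ℝ → ℝ} (hψ : IsRadialBump ψ) (hϕ : IsAngularCutoff ϕ) (k : ℤ) (ξ : E3) :
    0 ≤ chiV ψ ϕ k ξ ∧ chiV ψ ϕ k ξ ≤ 1 := by
  have h1 := dyadic_bounds hψ (mul_nonneg (by positivity : (0 : ℝ) ≤ (2 : ℝ) ^ (-k)) (abs_nonneg (ξ 2)))
  have h2 := hϕ.mem_Icc (Lam ξ)
  exact ⟨mul_nonneg (by linarith [h2.2]) h1.1, mul_le_one₀ (by linarith [h2.1]) h1.1 h1.2⟩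

theorem sq_two_eq_Lam (ξ : E3) : ξ 2 ^ 2 = Lam ξ ^ 2 * (horiz ξ ^ 2 + ξ 2 ^ 2) := by
  rw [horiz_sq, ← norm_sq_eq_sum]
  rcases eq_or_ne ξ 0 with rfl | h
  · simp
  · rw [Lam, div_pow, div_mul_cancel₀]
    exact pow_ne_zero _ (norm_ne_zero_iff.2 h)

/-- From `ξ₃² = Λ²(|ξ_h|² + ξ₃²)` and `|Λ| ≤ 0.6` one gets `|ξ₃| ≤ (3/4)|ξ_h|`: this piece stays
away from the vertical axis. -/
theorem chiH_support {ψ ϕ : ℝ → ℝ} (hψ : IsRadialBump ψ) (hϕ : IsAngularCutoff ϕ) {ξ : E3}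
    (h : chiH ψ ϕ 0 ξ ≠ 0) : 0.9 ≤ horiz ξ ∧ horiz ξ ≤ 2 ∧ |ξ 2| ≤ 2 := by
  have h1 := dyadic_support hψ (by simpa using horiz_nonneg ξ) (right_ne_zero_of_mul h)
  simp only [neg_zero, zpow_zero, one_mul] at h1
  refine ⟨h1.1, h1.2, ?_⟩
  have h2 : |Lam ξ| < 0.6 := by
    by_contra hge
    exact left_ne_zero_of_mul h (hϕ.eq_zero _ (not_lt.1 hge))
  have h3 : Lam ξ ^ 2 ≤ 0.36 := by
    rw [← sq_abs]; nlinarith [abs_nonneg (Lam ξ)]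
  have h4 := sq_two_eq_Lam ξ
  apply abs_le_of_sq_le_sq _ (by norm_num)
  nlinarith [horiz_nonneg ξ, mul_nonneg (sub_nonneg.2 h3) (add_nonneg (sq_nonneg (horiz ξ)) (sq_nonneg (ξ 2)))]

/-- The same identity with `|Λ| ≥ 0.55` bounds `|ξ_h|²` by less than `2.4 ξ₃²`: this piece stays
away from the horizontal plane. -/
theorem chiV_support {ψ ϕ : ℝ → ℝ} (hψ : IsRadialBump ψ) (hϕ : IsAngularCutoff ϕ) {ξ : E3}
    (h : chiV ψ ϕ 0 ξ ≠ 0) : 0.9 ≤ |ξ 2| ∧ |ξ 2| ≤ 2 ∧ horiz ξ ≤ 4 := by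
  have h1 := dyadic_support hψ (by simp) (right_ne_zero_of_mul h)
  simp only [neg_zero, zpow_zero, one_mul] at h1
  refine ⟨h1.1, h1.2, ?_⟩
  have h2 : 0.55 < |Lam ξ| := by
    by_contra hge
    exact left_ne_zero_of_mul h (by rw [hϕ.eq_one _ (not_lt.1 hge), sub_self])
  have h3 : 0.3025 ≤ Lam ξ ^ 2 := by
    rw [← sq_abs]; nlinarith
  have h4 := sq_two_eq_Lam ξ
  have h5 : ξ 2 ^ 2 ≤ 4 := by rw [← sq_abs]; nlinarith [abs_nonneg (ξ 2)]
  apply le_of_sq_le_sq _ (by norm_num)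
  nlinarith [mul_nonneg (sub_nonneg.2 h3) (add_nonneg (sq_nonneg (horiz ξ)) (sq_nonneg (ξ 2)))]

/-! ### The localized pieces `P^h_k F` and `P^v_k F` -/

/-- Local integrability of the Fourier transform. -/
theorem HasFourierTransform.integrable_mul {F : 𝓢'(E3, ℂ)} {Fhat : E3 → ℂ}
    (hF : HasFourierTransform F Fhat) {χ : E3 → ℝ} (hχ : Measurable χ) (hχ1 : ∀ ξ, |χ ξ| ≤ 1) {R : ℝ}
    (hR : ∀ ξ, χ ξ ≠ 0 → ‖ξ‖ ≤ R) : Integrable fun ξ => (χ ξ : ℂ) * Fhat ξ := by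
  -- A test function equal to 1 on the support of `χ` turns integrability against Schwartz functions
  -- into integrability of `χ Fhat`.
  obtain ⟨m, hm, hmc, hm1, -⟩ := exists_smooth_between (s := Metric.closedBall 0 R) (u := Metric.ball 0 (R + 1))
    Metric.isClosed_closedBall Metric.isOpen_ball (Metric.closedBall_subset_ball (by linarith)) Metric.isBounded_ball
  have hpi : 2 * Real.pi ≠ 0 := by positivity
  have hms : ContDiff ℝ (⊤ : ℕ∞) fun ξ : E3 => m ((2 * Real.pi) • ξ) := hm.comp (contDiff_const_smul _)
  have hmsc : HasCompactSupport fun ξ : E3 => m ((2 * Real.pi) • ξ) :=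
    hmc.comp_homeomorph (Homeomorph.smulOfNeZero _ hpi)
  have h1 := (hF (hmsc.toSchwartzMap hms)).1
  have h2 : Integrable fun ξ => Fhat ξ * m ξ := by
    have h3 := h1.comp_smul (R := (2 * Real.pi)⁻¹) (inv_ne_zero hpi)
    refine h3.congr (Filter.Eventually.of_forall fun ξ => ?_)
    change Fhat ((2 * Real.pi) • (2 * Real.pi)⁻¹ • ξ) * m ((2 * Real.pi) • (2 * Real.pi)⁻¹ • ξ) = _
    rw [smul_inv_smul₀ hpi]
  have h4 := h2.bdd_mul (f := fun ξ => (χ ξ : ℂ)) (c := 1)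
    (Complex.measurable_ofReal.comp hχ).aestronglyMeasurable
    (Filter.Eventually.of_forall fun ξ => by rw [Complex.norm_real]; exact hχ1 ξ)
  refine h4.congr (Filter.Eventually.of_forall fun ξ => ?_)
  by_cases h0 : χ ξ = 0
  · simp [h0]
  · simp only
    rw [hm1 ξ (by simpa using hR ξ h0), mul_one]

theorem norm_le_horiz_add (ξ : E3) : ‖ξ‖ ≤ horiz ξ + |ξ 2| := by
  apply le_of_sq_le_sq _ (add_nonneg (horiz_nonneg ξ) (abs_nonneg _))
  rw [norm_sq_eq_sum, ← horiz_sq]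
  nlinarith [sq_abs (ξ 2), mul_nonneg (horiz_nonneg ξ) (abs_nonneg (ξ 2))]

theorem integrable_chiH {ψ ϕ : ℝ → ℝ} (hψ : IsRadialBump ψ) (hϕ : IsAngularCutoff ϕ)
    {F : 𝓢'(E3, ℂ)} {Fhat : E3 → ℂ} (hF : HasFourierTransform F Fhat) (k : ℤ) :
    Integrable fun ξ => (chiH ψ ϕ k ξ : ℂ) * Fhat ξ := by
  have hk : (0 : ℝ) < (2 : ℝ) ^ k := by positivity
  apply hF.integrable_mul (measurable_chiH hψ hϕ k) (R := 2 ^ k * 4)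
  · intro ξ
    have := chiH_bounds hψ hϕ k ξ
    rw [abs_of_nonneg this.1]; exact this.2
  · intro ξ h
    rw [chiH_eq_smul] at h
    have h1 := chiH_support hψ hϕ h
    have h2 := norm_le_horiz_add ((2 : ℝ) ^ (-k) • ξ)
    rw [norm_smul, zpow_neg, norm_inv, Real.norm_eq_abs, abs_of_pos hk, inv_mul_le_iff₀ hk] at h2
    rw [zpow_neg] at h1
    refine h2.trans ?_
    gcongr
    linarith

theorem integrable_chiV {ψ ϕ : ℝ → ℝ} (hψ : IsRadialBump ψ) (hϕ : IsAngularCutoff ϕ)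
    {F : 𝓢'(E3, ℂ)} {Fhat : E3 → ℂ} (hF : HasFourierTransform F Fhat) (k : ℤ) :
    Integrable fun ξ => (chiV ψ ϕ k ξ : ℂ) * Fhat ξ := by
  have hk : (0 : ℝ) < (2 : ℝ) ^ k := by positivity
  apply hF.integrable_mul (measurable_chiV hψ hϕ k) (R := 2 ^ k * 6)
  · intro ξ
    have := chiV_bounds hψ hϕ k ξ
    rw [abs_of_nonneg this.1]; exact this.2
  · intro ξ h
    rw [chiV_eq_smul] at h
    have h1 := chiV_support hψ hϕ h
    have h2 := norm_le_horiz_add ((2 : ℝ) ^ (-k) • ξ)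
    rw [norm_smul, zpow_neg, norm_inv, Real.norm_eq_abs, abs_of_pos hk, inv_mul_le_iff₀ hk] at h2
    rw [zpow_neg] at h1
    refine h2.trans ?_
    gcongr
    linarith

/-- The off-axis estimate with distance `|x₃|`. Its weight `1 + x₃²` is below `2(1+|x₃|)^{2+β}`, the
weight that the dyadic `X` bounds control. -/
theorem exists_PH_decay {ψ ϕ : ℝ → ℝ} (hψ : IsRadialBump ψ) (hϕ : IsAngularCutoff ϕ) {β : ℝ} (hβ : 0 < β) :
    ∃ C : ℝ, 0 < C ∧ ∀ (F : 𝓢'(E3, ℂ)) (Fhat : E3 → ℂ), HasFourierTransform F Fhat →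
      ∀ (k : ℤ) (n₁ : ℕ), Xnorm ψ ϕ n₁ 3 β Fhat ≠ ∞ → ∀ (x : E3) (t : ℝ),
      √(1 + t ^ 2) * ‖PH ψ ϕ k (fun ξ => propagator t ξ * Fhat ξ) x‖
        ≤ C * ((2 : ℝ) ^ ((3 / 2 : ℝ) * (k : ℝ) - n₁ * max 0 (k : ℝ)) * (Xnorm ψ ϕ n₁ 3 β Fhat).toReal) := by
  have hpi := Real.pi_pos
  have hpi3 : Real.pi ≤ 4 := Real.pi_le_four
  have h2pi : 0 < 2 * Real.pi := by positivity
  -- In the variable `η = ξ/2π` the support of `χ^h_0` has `|η_h| ≥ 0.9/(2π) > 0.1`; `m` equals 1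
  -- there and lives in a slightly larger open set.
  obtain ⟨m, hm, hmc, hm1, hmu⟩ := exists_smooth_between
    (s := {η : E3 | 0.1 ≤ horiz η ∧ horiz η ≤ 2 ∧ |η 2| ≤ 2})
    (u := {η : E3 | 0.05 < horiz η ∧ horiz η < 3 ∧ |η 2| < 3})
    (by
      apply (isClosed_le continuous_const continuous_horiz).inter
      apply (isClosed_le continuous_horiz continuous_const).inter
      exact isClosed_le (f := fun ξ : E3 => |ξ 2|) (by fun_prop) continuous_const)
    (by
      apply (isOpen_lt continuous_const continuous_horiz).inter
      apply (isOpen_lt continuous_horiz continuous_const).inter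
      exact isOpen_lt (f := fun ξ : E3 => |ξ 2|) (by fun_prop) continuous_const)
    (fun η hη => ⟨by linarith [hη.1], by linarith [hη.2.1], by linarith [hη.2.2]⟩)
    (by
      rw [isBounded_iff_forall_norm_le]
      exact ⟨6, fun η hη => by linarith [norm_le_horiz_add η, hη.2.1, hη.2.2]⟩)
  have hdecay := exists_offAxis_decay hm hmc (c₁ := 0.05) (c₂ := 3) (c₃ := 3) (by norm_num) (by norm_num)
    (by norm_num) (fun ξ h => ⟨(hmu ξ h).1.le, (hmu ξ h).2.1.le, (hmu ξ h).2.2.le⟩)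
  obtain ⟨C, hC, hmain⟩ := exists_dyadic_decay hψ hβ (χ := chiH ψ ϕ 0) hm hmc
    (K := {η : E3 | 0.05 ≤ horiz η}) (isClosed_le continuous_const continuous_horiz)
    (by simp [horiz]; norm_num) (fun ξ h => (hmu ξ h).1.le)
    (fun η h => hm1 η (by
      have h1 := chiH_support hψ hϕ h
      rw [horiz_smul h2pi, PiLp.smul_apply, smul_eq_mul, abs_mul, abs_of_pos h2pi] at h1
      have h3 := Real.pi_gt_three
      have h0 := horiz_nonneg η
      have h0' := abs_nonneg (η 2)
      exact ⟨by nlinarith, by nlinarith, by nlinarith⟩))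
    (r := fun x => |x 2|) (by fun_prop) (fun x => abs_nonneg _)
    (fun s hs x => by simp [abs_mul, abs_of_pos hs]) (W := fun x => 1 + (x 2) ^ 2) (by fun_prop)
    (fun x => by positivity)
    (fun x => by
      have h1 : (1 : ℝ) ≤ 1 + |x 2| := by linarith [abs_nonneg (x 2)]
      have h2 := Real.rpow_le_rpow_of_exponent_le h1 (by linarith : (2 : ℝ) ≤ 2 + β)
      rw [Real.rpow_two] at h2
      nlinarith [sq_abs (x 2), abs_nonneg (x 2)]) hdecay
  refine ⟨C, hC, ?_⟩
  intro F Fhat hF k n₁ hX x t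
  have e : (fun ξ => (chiH ψ ϕ k ξ : ℂ)) = fun ξ => (chiH ψ ϕ 0 ((2 : ℝ) ^ (-k) • ξ) : ℂ) :=
    funext fun ξ => by rw [chiH_eq_smul]
  have hI := integrable_chiH hψ hϕ hF k
  simp only [chiH_eq_smul ψ ϕ k] at hI
  rw [PH, e]
  apply hmain Fhat k n₁ _ hI hX
  intro L a ha
  -- The terms of the norm with `b = 0`, that is scaling fields only, are the ones used.
  have h1 : normWeight n₁ β k (L - k) * eLpNorm (ZL ψ k (L - k) (scal^[a] (rot^[0] (PH ψ ϕ k Fhat)))) 2 volume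
      ≤ Xnorm ψ ϕ n₁ 3 β Fhat := by
    unfold Xnorm
    exact le_iSup_of_le k (le_iSup_of_le ((L : ℤ) - k) (le_iSup_of_le a (le_iSup_of_le 0
      (le_iSup_of_le (by omega) le_rfl))))
  rw [← e]
  exact h1

/-- The estimate for frequencies with `|ξ₃|` bounded below, near the axis and off it, with distance
`|x_h|`. Here the full power `2 + β` matters: the inverse weight must be integrable over the
horizontal plane. -/
theorem exists_PV_decay {ψ ϕ : ℝ → ℝ} (hψ : IsRadialBump ψ) (hϕ : IsAngularCutoff ϕ) {β : ℝ} (hβ : 0 < β) :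
    ∃ C : ℝ, 0 < C ∧ ∀ (F : 𝓢'(E3, ℂ)) (Fhat : E3 → ℂ), HasFourierTransform F Fhat →
      ∀ (k : ℤ) (n₁ : ℕ), Ynorm ψ ϕ n₁ 3 β Fhat ≠ ∞ → ∀ (x : E3) (t : ℝ),
      √(1 + t ^ 2) * ‖PV ψ ϕ k (fun ξ => propagator t ξ * Fhat ξ) x‖
        ≤ C * ((2 : ℝ) ^ ((3 / 2 : ℝ) * (k : ℝ) - n₁ * max 0 (k : ℝ)) * (Ynorm ψ ϕ n₁ 3 β Fhat).toReal) := by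
  have hpi := Real.pi_pos
  have hpi3 : Real.pi ≤ 4 := Real.pi_le_four
  have h2pi : 0 < 2 * Real.pi := by positivity
  obtain ⟨m, hm, hmc, hm1, hmu⟩ := exists_smooth_between
    (s := {η : E3 | 0.1 ≤ |η 2| ∧ |η 2| ≤ 2 ∧ horiz η ≤ 4})
    (u := {η : E3 | 0.05 < |η 2| ∧ |η 2| < 3 ∧ horiz η < 5})
    (by
      apply (isClosed_le (g := fun ξ : E3 => |ξ 2|) continuous_const (by fun_prop)).inter
      apply IsClosed.inter _ (isClosed_le continuous_horiz continuous_const)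
      exact isClosed_le (f := fun ξ : E3 => |ξ 2|) (by fun_prop) continuous_const)
    (by
      apply (isOpen_lt (g := fun ξ : E3 => |ξ 2|) continuous_const (by fun_prop)).inter
      apply IsOpen.inter _ (isOpen_lt continuous_horiz continuous_const)
      exact isOpen_lt (f := fun ξ : E3 => |ξ 2|) (by fun_prop) continuous_const)
    (fun η hη => ⟨by linarith [hη.1], by linarith [hη.2.1], by linarith [hη.2.2]⟩)
    (by
      rw [isBounded_iff_forall_norm_le]
      exact ⟨8, fun η hη => by linarith [norm_le_horiz_add η, hη.2.1, hη.2.2]⟩)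
  have hwpos : ∀ y : ℝ × ℝ, (0 : ℝ) < 1 + ‖y‖ := fun y => by positivity
  have hdecay := exists_nearAxis_decay hm hmc (c := 0.05) (by norm_num) (fun ξ h => (hmu ξ h).1.le)
    -- The norm on the plane is the maximum norm, which is below `|x_h|`; the factor 2 gives `1 +
    -- y₁² + y₂² ≤ w(y)`.
    (w := fun y => 2 * (1 + ‖y‖) ^ (2 + β))
    (by
      refine continuous_const.mul (Continuous.rpow_const (by fun_prop) fun y => Or.inl (hwpos y).ne'))
    (fun y => by
      have h1 : (1 : ℝ) ≤ 1 + ‖y‖ := by linarith [norm_nonneg y]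
      have h2 := Real.rpow_le_rpow_of_exponent_le h1 (by linarith : (2 : ℝ) ≤ 2 + β)
      rw [Real.rpow_two] at h2
      have h3 : |y.1| ≤ ‖y‖ := norm_fst_le y
      have h4 : |y.2| ≤ ‖y‖ := norm_snd_le y
      nlinarith [sq_abs y.1, sq_abs y.2, abs_nonneg y.1, abs_nonneg y.2])
    (by
      have h1 := (integrable_one_add_norm (μ := (volume : Measure (ℝ × ℝ))) (r := 2 + β)
        (by rw [Module.finrank_prod, Module.finrank_self]; push_cast; linarith)).const_mul (2⁻¹)
      refine h1.congr (Filter.Eventually.of_forall fun y => ?_)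
      simp only
      rw [mul_inv, Real.rpow_neg (hwpos y).le])
  obtain ⟨C, hC, hmain⟩ := exists_dyadic_decay hψ hβ (χ := chiV ψ ϕ 0) hm hmc
    (K := {η : E3 | 0.05 ≤ |η 2|}) (isClosed_le (g := fun ξ : E3 => |ξ 2|) continuous_const (by fun_prop))
    (by simp; norm_num) (fun ξ h => (hmu ξ h).1.le)
    (fun η h => hm1 η (by
      have h1 := chiV_support hψ hϕ h
      rw [horiz_smul h2pi, PiLp.smul_apply, smul_eq_mul, abs_mul, abs_of_pos h2pi] at h1
      have h3 := Real.pi_gt_three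
      have h0 := horiz_nonneg η
      have h0' := abs_nonneg (η 2)
      exact ⟨by nlinarith, by nlinarith, by nlinarith⟩))
    (r := horiz) continuous_horiz horiz_nonneg
    (fun s hs x => horiz_smul hs x) (W := fun x => 2 * (1 + ‖((x 0, x 1) : ℝ × ℝ)‖) ^ (2 + β))
    (continuous_const.mul (Continuous.rpow_const (by fun_prop) fun x => Or.inl (hwpos _).ne'))
    (fun x => by positivity)
    (fun x => by
      have h1 : ‖((x 0, x 1) : ℝ × ℝ)‖ ≤ horiz x := by
        rw [Prod.norm_def]
        apply max_le
        · exact Real.le_sqrt_of_sq_le (by simp only [Real.norm_eq_abs, sq_abs]; nlinarith [sq_nonneg (x 1)])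
        · exact Real.le_sqrt_of_sq_le (by simp only [Real.norm_eq_abs, sq_abs]; nlinarith [sq_nonneg (x 0)])
      gcongr) hdecay
  refine ⟨C, hC, ?_⟩
  intro F Fhat hF k n₁ hX x t
  have e : (fun ξ => (chiV ψ ϕ k ξ : ℂ)) = fun ξ => (chiV ψ ϕ 0 ((2 : ℝ) ^ (-k) • ξ) : ℂ) :=
    funext fun ξ => by rw [chiV_eq_smul]
  have hI := integrable_chiV hψ hϕ hF k
  simp only [chiV_eq_smul ψ ϕ k] at hI
  rw [PV, e]
  apply hmain Fhat k n₁ _ hI hX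
  intro L a ha
  have h1 : normWeight n₁ β k (L - k) * eLpNorm (HL ψ k (L - k) (scal^[a] (rot^[0] (PV ψ ϕ k Fhat)))) 2 volume
      ≤ Ynorm ψ ϕ n₁ 3 β Fhat := by
    unfold Ynorm
    exact le_iSup_of_le k (le_iSup_of_le ((L : ℤ) - k) (le_iSup_of_le a (le_iSup_of_le 0
      (le_iSup_of_le (by omega) le_rfl))))
  rw [← e]
  exact h1

/-! ### Summation over the dyadic frequencies -/

theorem hasSum_dyadic {ψ : ℝ → ℝ} (hψ : IsRadialBump ψ) {s : ℝ} (hs : 0 < s) :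
    HasSum (fun k : ℤ => dyadic ψ ((2 : ℝ) ^ (-k) * s)) 1 := by
  -- `n` is chosen so that `v = 2^{-n}s` lies in `(0.9, 1.8]`. Only `k = n` and `k = n - 1`
  -- contribute, and their sum telescopes to `ψ(v) - ψ(4v) = 1`.
  obtain ⟨n, hn1, hn2⟩ := exists_mem_Ioc_zpow (by positivity : 0 < s / 0.9) (by norm_num : (1 : ℝ) < 2)
  have hp : ∀ k : ℤ, (0 : ℝ) < (2 : ℝ) ^ k := fun k => by positivity
  set v := (2 : ℝ) ^ (-n) * s with hv
  have hsv : s = 2 ^ n * v := by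
    rw [hv, zpow_neg, mul_inv_cancel_left₀ (hp n).ne']
  have hv1 : 0.9 < v := by
    rw [lt_div_iff₀ (by norm_num), hsv] at hn1
    exact lt_of_mul_lt_mul_left hn1 (hp n).le
  have hv2 : v ≤ 1.8 := by
    rw [div_le_iff₀ (by norm_num), hsv, zpow_add₀ (by norm_num), zpow_one] at hn2
    have : 2 ^ n * v ≤ 2 ^ n * 1.8 := by linarith
    exact le_of_mul_le_mul_left this (hp n)
  have hone : ∀ s, 0 ≤ s → s ≤ 1.8 → ψ s = 1 := fun s h h' => hψ.eq_one s (by rwa [abs_of_nonneg h])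
  have hzero : ∀ s, 2 ≤ s → ψ s = 0 := fun s h => hψ.eq_zero s (h.trans (le_abs_self s))
  have hk : ∀ k : ℤ, (2 : ℝ) ^ (-k) * s = 2 ^ (n - k) * v := fun k => by
    rw [hsv, ← mul_assoc, ← zpow_add₀ (by norm_num)]
    congr 2; ring
  have h1 : ∑ k ∈ ({n, n - 1} : Finset ℤ), dyadic ψ ((2 : ℝ) ^ (-k) * s) = 1 := by
    rw [Finset.sum_pair (by omega), hk, hk, sub_self, zpow_zero, one_mul, sub_sub_cancel, zpow_one, dyadic,
      dyadic, hone v (by linarith) (by linarith), hzero (2 * (2 * v)) (by linarith)]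
    ring
  rw [← h1]
  apply hasSum_sum_of_ne_finset_zero
  intro k hkn
  simp only [Finset.mem_insert, Finset.mem_singleton, not_or] at hkn
  by_contra hne
  have h2 := dyadic_support hψ (by positivity) hne
  rw [hk] at h2
  rcases lt_or_ge n k with h3 | h3
  · have h4 : (2 : ℝ) ^ (n - k) ≤ 2 ^ (-1 : ℤ) := zpow_le_zpow_right₀ (by norm_num) (by omega)
    rw [zpow_neg_one] at h4
    have h5 : (2 : ℝ) ^ (n - k) * v ≤ 0.9 := by nlinarith
    have h6 : v = 1.8 := by nlinarith
    have h7 : (2 : ℝ) ^ (n - k) * v = 0.9 := le_antisymm h5 h2.1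
    apply hne
    rw [hk, h7, dyadic, hone 0.9 (by norm_num) (by norm_num), hone (2 * 0.9) (by norm_num) (by norm_num), sub_self]
  · have h4 : (2 : ℝ) ^ (2 : ℤ) ≤ 2 ^ (n - k) := zpow_le_zpow_right₀ (by norm_num) (by omega)
    norm_num at h4
    nlinarith

/-- The dyadic sums in `|ξ_h|` and in `|ξ₃|` are each 1 off the zero sets, and the angular weights
`ϕ(Λ)` and `1 - ϕ(Λ)` add up to 1. The excluded set is null. -/
theorem hasSum_chi {ψ ϕ : ℝ → ℝ} (hψ : IsRadialBump ψ) {ξ : E3} (h0 : ξ 0 ≠ 0) (h2 : ξ 2 ≠ 0) :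
    HasSum (fun k : ℤ => chi ψ ϕ k ξ) 1 := by
  have hh : 0 < horiz ξ := Real.sqrt_pos.2 (by positivity)
  have h := ((hasSum_dyadic hψ hh).mul_left (ϕ (Lam ξ))).add
    ((hasSum_dyadic hψ (abs_pos.2 h2)).mul_left (1 - ϕ (Lam ξ)))
  rw [show ϕ (Lam ξ) * 1 + (1 - ϕ (Lam ξ)) * 1 = 1 by ring] at h
  exact h

theorem ae_apply_ne_zero (i : Fin 3) : ∀ᵐ ξ : E3, ξ i ≠ 0 := by
  have h := Measure.addHaar_submodule (volume : Measure E3)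
    (LinearMap.ker (EuclideanSpace.proj i : E3 →L[ℝ] ℝ).toLinearMap) (by
      intro htop
      have : EuclideanSpace.single i (1 : ℝ) ∈ LinearMap.ker (EuclideanSpace.proj i : E3 →L[ℝ] ℝ).toLinearMap := by
        rw [htop]; trivial
      simp at this)
  rw [ae_iff]
  refine measure_mono_null (fun ξ hξ => ?_) h
  simpa using hξ

/-- The exponent is `-(3/2)|k|`: the weight `2^{3k⁺}` beats the growth `2^{3k/2}` at high frequency,
and the latter is itself summable at low frequency. -/
theorem summable_rpow_int : Summable fun k : ℤ => (2 : ℝ) ^ ((3 / 2 : ℝ) * (k : ℝ) - (3 : ℕ) * max 0 (k : ℝ)) := by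
  have hq : (2 : ℝ) ^ (-(3 / 2) : ℝ) < 1 := Real.rpow_lt_one_of_one_lt_of_neg (by norm_num) (by norm_num)
  have hs : Summable fun n : ℕ => ((2 : ℝ) ^ (-(3 / 2) : ℝ)) ^ n := summable_geometric_of_lt_one (by positivity) hq
  apply Summable.of_nat_of_neg
  · refine hs.congr fun n => ?_
    rw [← Real.rpow_natCast, ← Real.rpow_mul (by norm_num)]
    congr 1
    rw [Int.cast_natCast, max_eq_right (by positivity)]
    push_cast; ring
  · refine hs.congr fun n => ?_
    rw [← Real.rpow_natCast, ← Real.rpow_mul (by norm_num)]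
    congr 1
    rw [Int.cast_neg, Int.cast_natCast, max_eq_left (by simp)]
    push_cast; ring

theorem invFourier_eq_fourierInv (h : E3 → ℂ) : invFourier h = 𝓕⁻ (fun η => h ((2 * Real.pi) • η)) := by
  ext x
  rw [invFourier_eq_scaled one_pos, fourierInv_eq_integral]
  simp

theorem continuous_fourierInv {h : E3 → ℂ} (hh : Integrable h) : Continuous (𝓕⁻ h) := by
  have h1 : Continuous (𝓕 h) := VectorFourier.fourierIntegral_continuous (L := innerₗ E3)
    Real.continuous_fourierChar continuous_inner hh
  have h2 : 𝓕⁻ h = fun x => 𝓕 h (-x) := funext fun x => Real.fourierInv_eq_fourier_neg h x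
  rw [h2]
  exact h1.comp continuous_neg

theorem continuous_invFourier {h : E3 → ℂ} (hh : Integrable h) : Continuous (invFourier h) := by
  rw [invFourier_eq_fourierInv]
  exact continuous_fourierInv (hh.comp_smul (by positivity))

theorem invFourier_add {h₁ h₂ : E3 → ℂ} (hh₁ : Integrable h₁) (hh₂ : Integrable h₂) (x : E3) :
    invFourier (fun ξ => h₁ ξ + h₂ ξ) x = invFourier h₁ x + invFourier h₂ x := by
  have hi : ∀ h : E3 → ℂ, Integrable h → Integrable fun ξ => Complex.exp (Complex.I * (inner ℝ x ξ : ℝ)) * h ξ := by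
    intro h hh
    refine hh.bdd_mul (f := fun ξ : E3 => Complex.exp (Complex.I * (inner ℝ x ξ : ℝ))) (c := 1) ?_ ?_
    · exact (by fun_prop : Continuous fun ξ : E3 => Complex.exp (Complex.I * (inner ℝ x ξ : ℝ))).aestronglyMeasurable
    · refine Filter.Eventually.of_forall fun ξ => ?_
      rw [mul_comm, Complex.norm_exp_ofReal_mul_I]
  simp only [invFourier, mul_add]
  rw [integral_add (hi _ hh₁) (hi _ hh₂), mul_add]

theorem norm_propagator (t : ℝ) (ξ : E3) : ‖propagator t ξ‖ = 1 := by
  rw [propagator, mul_comm, Complex.norm_exp_ofReal_mul_I]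

theorem measurable_propagator (t : ℝ) : Measurable (propagator t) := by
  unfold propagator
  exact Complex.measurable_exp.comp
    ((Complex.measurable_ofReal.comp (measurable_Lam.const_mul t)).const_mul Complex.I)

theorem integrable_propagator_mul {h : E3 → ℂ} (hh : Integrable h) (t : ℝ) :
    Integrable fun ξ => propagator t ξ * h ξ :=
  hh.bdd_mul (c := 1) (measurable_propagator t).aestronglyMeasurable
    (Filter.Eventually.of_forall fun ξ => (norm_propagator t ξ).le)

theorem PLP_eq_add {ψ ϕ : ℝ → ℝ} {G : E3 → ℂ} {k : ℤ}
    (hH : Integrable fun ξ => (chiH ψ ϕ k ξ : ℂ) * G ξ) (hV : Integrable fun ξ => (chiV ψ ϕ k ξ : ℂ) * G ξ) (x : E3) :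
    PLP ψ ϕ k G x = PH ψ ϕ k G x + PV ψ ϕ k G x := by
  rw [PLP, PH, PV, multiplier, multiplier, multiplier, ← invFourier_add hH hV]
  congr 1; ext ξ
  rw [chi, Complex.ofReal_add, add_mul]

theorem integrable_chi_propagator {ψ ϕ : ℝ → ℝ} (hψ : IsRadialBump ψ) (hϕ : IsAngularCutoff ϕ)
    {F : 𝓢'(E3, ℂ)} {Fhat : E3 → ℂ} (hF : HasFourierTransform F Fhat) (k : ℤ) (t : ℝ) :
    (Integrable fun ξ => (chiH ψ ϕ k ξ : ℂ) * (propagator t ξ * Fhat ξ)) ∧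
    (Integrable fun ξ => (chiV ψ ϕ k ξ : ℂ) * (propagator t ξ * Fhat ξ)) ∧
    Integrable fun ξ => (chi ψ ϕ k ξ : ℂ) * (propagator t ξ * Fhat ξ) := by
  have h1 : Integrable fun ξ => (chiH ψ ϕ k ξ : ℂ) * (propagator t ξ * Fhat ξ) := by
    refine (integrable_propagator_mul (integrable_chiH hψ hϕ hF k) t).congr (Filter.Eventually.of_forall fun ξ => ?_)
    simp only; ring
  have h2 : Integrable fun ξ => (chiV ψ ϕ k ξ : ℂ) * (propagator t ξ * Fhat ξ) := by
    refine (integrable_propagator_mul (integrable_chiV hψ hϕ hF k) t).congr (Filter.Eventually.of_forall fun ξ => ?_)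
    simp only; ring
  refine ⟨h1, h2, (h1.add h2).congr (Filter.Eventually.of_forall fun ξ => ?_)⟩
  simp only [Pi.add_apply, chi, Complex.ofReal_add]; ring

theorem exists_PLP_decay {ψ ϕ : ℝ → ℝ} (hψ : IsRadialBump ψ) (hϕ : IsAngularCutoff ϕ) {β : ℝ} (hβ : 0 < β) :
    ∃ C : ℝ, 0 < C ∧ ∀ (F : 𝓢'(E3, ℂ)) (Fhat : E3 → ℂ), HasFourierTransform F Fhat →
      ∀ (k : ℤ) (n₁ : ℕ), Xnorm ψ ϕ n₁ 3 β Fhat ≠ ∞ → Ynorm ψ ϕ n₁ 3 β Fhat ≠ ∞ → ∀ (x : E3) (t : ℝ),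
      ‖PLP ψ ϕ k (fun ξ => propagator t ξ * Fhat ξ) x‖
        ≤ C * (bracket t)⁻¹ * (2 : ℝ) ^ ((3 / 2 : ℝ) * (k : ℝ) - n₁ * max 0 (k : ℝ)) *
          ((Xnorm ψ ϕ n₁ 3 β Fhat).toReal + (Ynorm ψ ϕ n₁ 3 β Fhat).toReal) := by
  obtain ⟨C₁, hC₁, h₁⟩ := exists_PH_decay hψ hϕ hβ
  obtain ⟨C₂, hC₂, h₂⟩ := exists_PV_decay hψ hϕ hβ
  refine ⟨C₁ + C₂, by positivity, ?_⟩
  intro F Fhat hF k n₁ hX hY x t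
  obtain ⟨i1, i2, -⟩ := integrable_chi_propagator hψ hϕ hF k t
  have hb : 0 < bracket t := Real.sqrt_pos.2 (by positivity)
  have b1 := h₁ F Fhat hF k n₁ hX x t
  have b2 := h₂ F Fhat hF k n₁ hY x t
  rw [PLP_eq_add i1 i2]
  have he0 : 0 < (2 : ℝ) ^ ((3 / 2 : ℝ) * (k : ℝ) - n₁ * max 0 (k : ℝ)) := by positivity
  have hX0 : 0 ≤ (Xnorm ψ ϕ n₁ 3 β Fhat).toReal := ENNReal.toReal_nonneg
  have hY0 : 0 ≤ (Ynorm ψ ϕ n₁ 3 β Fhat).toReal := ENNReal.toReal_nonneg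
  change bracket t * _ ≤ _ at b1
  change bracket t * _ ≤ _ at b2
  generalize (2 : ℝ) ^ ((3 / 2 : ℝ) * (k : ℝ) - n₁ * max 0 (k : ℝ)) = e at *
  generalize (Xnorm ψ ϕ n₁ 3 β Fhat).toReal = X at *
  generalize (Ynorm ψ ϕ n₁ 3 β Fhat).toReal = Y at *
  have h3 : bracket t * ‖PH ψ ϕ k (fun ξ => propagator t ξ * Fhat ξ) x
      + PV ψ ϕ k (fun ξ => propagator t ξ * Fhat ξ) x‖ ≤ (C₁ + C₂) * e * (X + Y) := by
    calc _ ≤ bracket t * (‖PH ψ ϕ k (fun ξ => propagator t ξ * Fhat ξ) x‖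
          + ‖PV ψ ϕ k (fun ξ => propagator t ξ * Fhat ξ) x‖) := by gcongr; exact norm_add_le _ _
      _ ≤ C₁ * (e * X) + C₂ * (e * Y) := by rw [mul_add]; exact add_le_add b1 b2
      _ ≤ _ := by
        have : 0 ≤ C₁ * (e * Y) + C₂ * (e * X) := by positivity
        linarith
  rw [← le_div_iff₀' hb] at h3
  refine h3.trans_eq ?_
  field_simp

theorem bracket_sign_mul {σ : ℝ} (hσ : σ = 1 ∨ σ = -1) (t : ℝ) : bracket (σ * t) = bracket t := by
  rcases hσ with rfl | rfl <;> simp [bracket]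

theorem eLpNorm_top_le {f : E3 → ℂ} {A : ℝ} {X Y : ℝ≥0∞} (hA : 0 ≤ A) (hX : X ≠ ∞) (hY : Y ≠ ∞)
    (h : ∀ᵐ x, ‖f x‖ ≤ A * (X.toReal + Y.toReal)) :
    eLpNorm f ∞ volume ≤ ENNReal.ofReal A * (X + Y) := by
  rw [eLpNorm_exponent_top]
  refine (eLpNormEssSup_le_of_ae_bound h).trans_eq ?_
  rw [ENNReal.ofReal_mul hA, ENNReal.ofReal_add ENNReal.toReal_nonneg ENNReal.toReal_nonneg,
    ENNReal.ofReal_toReal hX, ENNReal.ofReal_toReal hY]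

/-- Summation over dyadic frequencies: a bounded function that is the sum of the pieces. -/
theorem exists_Lp_hasFourierTransform {ψ ϕ : ℝ → ℝ} (hψ : IsRadialBump ψ) (hϕ : IsAngularCutoff ϕ)
    {F : 𝓢'(E3, ℂ)} {Fhat : E3 → ℂ} (hF : HasFourierTransform F Fhat) (t : ℝ) {b : ℤ → ℝ} (hb : Summable b)
    (hbd : ∀ k x, ‖PLP ψ ϕ k (fun ξ => propagator t ξ * Fhat ξ) x‖ ≤ b k) :
    ∃ u : Lp ℂ ∞ (volume : Measure E3),
      HasFourierTransform (u : 𝓢'(E3, ℂ)) (fun ξ => propagator t ξ * Fhat ξ) ∧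
      ∀ᵐ x, ‖u x‖ ≤ ∑' k, b k := by
  set G : E3 → ℂ := fun ξ => propagator t ξ * Fhat ξ with hG
  have hi : ∀ k, Integrable fun ξ => (chi ψ ϕ k ξ : ℂ) * G ξ := fun k =>
    (integrable_chi_propagator hψ hϕ hF k t).2.2
  have hi' : ∀ k, Integrable fun ξ : E3 => (chi ψ ϕ k ((2 * Real.pi) • ξ) : ℂ) * G ((2 * Real.pi) • ξ) := fun k =>
    (hi k).comp_smul (by positivity)
  have hPLP : ∀ k, PLP ψ ϕ k G = 𝓕⁻ fun ξ : E3 => (chi ψ ϕ k ((2 * Real.pi) • ξ) : ℂ) * G ((2 * Real.pi) • ξ) :=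
    fun k => by rw [PLP, multiplier, invFourier_eq_fourierInv]
  have hcont : ∀ k, Continuous (PLP ψ ϕ k G) := fun k => continuous_invFourier (hi k)
  -- The bounds on the pieces make this series converge uniformly. To identify its transform, the
  -- sum is paired with a test function and compared on the two sides of Plancherel.
  set v : E3 → ℂ := fun x => ∑' k, PLP ψ ϕ k G x with hv
  have hvc : Continuous v := continuous_tsum hcont hb hbd
  have hvb : ∀ x, ‖v x‖ ≤ ∑' k, b k := fun x => tsum_of_norm_bounded hb.hasSum fun k => hbd k x
  have hvm : MemLp v ∞ volume := memLp_top_of_bound hvc.aestronglyMeasurable _ (Filter.Eventually.of_forall hvb)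
  refine ⟨hvm.toLp v, ?_, ?_⟩
  swap
  · filter_upwards [hvm.coeFn_toLp] with x hx
    rw [hx]; exact hvb x
  intro g
  have hgi : Integrable fun ξ : E3 => G ((2 * Real.pi) • ξ) * g ξ := by
    have h1 := (hF g).1.bdd_mul (f := fun ξ : E3 => propagator t ((2 * Real.pi) • ξ)) (c := 1)
      ((measurable_propagator t).comp (measurable_const_smul _)).aestronglyMeasurable
      (Filter.Eventually.of_forall fun ξ => (norm_propagator t _).le)
    refine h1.congr (Filter.Eventually.of_forall fun ξ => ?_)
    simp only [hG]; ring
  refine ⟨hgi, ?_⟩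
  rw [TemperedDistribution.fourier_apply, Lp.toTemperedDistribution_apply]
  have e1 : ∫ x, (𝓕 g) x • (hvm.toLp v) x = ∫ x, (𝓕 g) x * v x := by
    apply integral_congr_ae
    filter_upwards [hvm.coeFn_toLp] with x hx
    rw [hx, smul_eq_mul]
  have hgF : Integrable (𝓕 g : 𝓢(E3, ℂ)) := (𝓕 g).integrable (μ := volume)
  -- physical side
  have s1 : HasSum (fun k => ∫ x, (𝓕 g) x * PLP ψ ϕ k G x) (∫ x, (𝓕 g) x * v x) := by
    apply hasSum_integral_of_dominated_convergence (fun k x => ‖(𝓕 g) x‖ * b k)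
    · intro k
      exact hgF.1.mul (hcont k).aestronglyMeasurable
    · intro k
      refine Filter.Eventually.of_forall fun x => ?_
      rw [norm_mul]
      exact mul_le_mul_of_nonneg_left (hbd k x) (norm_nonneg _)
    · exact Filter.Eventually.of_forall fun x => hb.mul_left _
    · simp only [tsum_mul_left]
      exact hgF.norm.mul_const _
    · refine Filter.Eventually.of_forall fun x => ?_
      exact (Summable.of_norm_bounded hb fun k => hbd k x).hasSum.mul_left _
  -- frequency side
  have s2 : HasSum (fun k => ∫ ξ : E3, g ξ * ((chi ψ ϕ k ((2 * Real.pi) • ξ) : ℂ) * G ((2 * Real.pi) • ξ)))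
      (∫ ξ : E3, G ((2 * Real.pi) • ξ) * g ξ) := by
    have hae : ∀ᵐ ξ : E3, HasSum (fun k => chi ψ ϕ k ((2 * Real.pi) • ξ)) 1 := by
      filter_upwards [ae_apply_ne_zero 0, ae_apply_ne_zero 2] with ξ h0 h2
      apply hasSum_chi hψ
      · simpa using h0
      · simpa using h2
    -- The cut-offs are nonnegative with sum 1 almost everywhere, so the dominating terms sum
    -- exactly to `‖G g‖`, which is integrable.
    apply hasSum_integral_of_dominated_convergence
      (fun k ξ => chi ψ ϕ k ((2 * Real.pi) • ξ) * ‖G ((2 * Real.pi) • ξ) * g ξ‖)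
    · intro k
      exact g.continuous.aestronglyMeasurable.mul (hi' k).1
    · intro k
      refine Filter.Eventually.of_forall fun ξ => ?_
      have h1 := (chiH_bounds hψ hϕ k ((2 * Real.pi) • ξ)).1
      have h2 := (chiV_bounds hψ hϕ k ((2 * Real.pi) • ξ)).1
      have h3 : 0 ≤ chi ψ ϕ k ((2 * Real.pi) • ξ) := add_nonneg h1 h2
      rw [norm_mul, norm_mul, Complex.norm_real, Real.norm_eq_abs, norm_mul (G _), abs_of_nonneg h3]
      exact le_of_eq (by ring)
    · filter_upwards [hae] with ξ hξ using hξ.summable.mul_right _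
    · refine hgi.norm.congr ?_
      filter_upwards [hae] with ξ hξ
      rw [tsum_mul_right, hξ.tsum_eq, one_mul]
    · filter_upwards [hae] with ξ hξ
      have h1 : HasSum (fun k => (chi ψ ϕ k ((2 * Real.pi) • ξ) : ℂ)) 1 := by
        have := Complex.hasSum_ofReal.2 hξ
        rwa [Complex.ofReal_one] at this
      have h2 := h1.mul_right (G ((2 * Real.pi) • ξ) * g ξ)
      rw [one_mul] at h2
      refine h2.congr_fun ?_
      intro k; ring
  have e2 : ∀ k, ∫ x, (𝓕 g) x * PLP ψ ϕ k G x
      = ∫ ξ : E3, g ξ * ((chi ψ ϕ k ((2 * Real.pi) • ξ) : ℂ) * G ((2 * Real.pi) • ξ)) := by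
    intro k
    rw [hPLP k, ← integral_fourier_mul_fourierInv g (hi' k)]
  simp only [e2] at s1
  rw [e1]
  exact s1.unique s2

end RotatingEuler

end

/-! ### The dispersive estimate -/

open RotatingEuler in
theorem corollary4p5 (ψ ϕ : ℝ → ℝ) (hψ : IsRadialBump ψ) (hϕ : IsAngularCutoff ϕ)
    (β : ℝ) (hβ : 0 < β) :
    ∃ C : ℝ, 0 < C ∧
      ∀ (F : 𝓢'(E3, ℂ)) (Fhat : E3 → ℂ), HasFourierTransform F Fhat →
      ∀ (σ : ℝ), (σ = 1 ∨ σ = -1) → ∀ t : ℝ,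
        -- the frequency-localized bound for `P_k e^{± i t Λ} F`
        (∀ k : ℤ,
          eLpNorm (PLP ψ ϕ k (fun ξ => propagator (σ * t) ξ * Fhat ξ)) ∞ volume
            ≤ ENNReal.ofReal (C * (bracket t)⁻¹ * (2 : ℝ) ^ ((3 / 2 : ℝ) * (k : ℝ)))
              * (Xnorm ψ ϕ 0 3 β Fhat + Ynorm ψ ϕ 0 3 β Fhat)) ∧
        -- if the right-hand side is finite, the distribution `e^{± i t Λ} F` is a bounded
        -- function `u` that satisfies the full bound
        (Xnorm ψ ϕ 3 3 β Fhat ≠ ∞ → Ynorm ψ ϕ 3 3 β Fhat ≠ ∞ →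
          ∃ u : Lp ℂ ∞ (volume : Measure E3),
            HasFourierTransform (u : 𝓢'(E3, ℂ)) (fun ξ => propagator (σ * t) ξ * Fhat ξ) ∧
            eLpNorm u ∞ volume
              ≤ ENNReal.ofReal (C * (bracket t)⁻¹)
                * (Xnorm ψ ϕ 3 3 β Fhat + Ynorm ψ ϕ 3 3 β Fhat)) := by
  obtain ⟨C, hC, hdecay⟩ := exists_PLP_decay hψ hϕ hβ
  set S := ∑' k : ℤ, (2 : ℝ) ^ ((3 / 2 : ℝ) * (k : ℝ) - (3 : ℕ) * max 0 (k : ℝ)) with hS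
  have hS0 : 0 ≤ S := tsum_nonneg fun k => by positivity
  -- One constant for both parts: a single frequency needs `C`, the sum over frequencies `C S`.
  refine ⟨C * (1 + S), by positivity, ?_⟩
  intro F Fhat hF σ hσ t
  have hbr : 0 < bracket t := Real.sqrt_pos.2 (by positivity)
  refine ⟨fun k => ?_, fun hX hY => ?_⟩
  · have hA : 0 < C * (1 + S) * (bracket t)⁻¹ * (2 : ℝ) ^ ((3 / 2 : ℝ) * (k : ℝ)) := by positivity
    -- If a norm is infinite, so is the right-hand side, because the constant in front is positive.
    by_cases hX : Xnorm ψ ϕ 0 3 β Fhat = ∞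
    · rw [hX, top_add, ENNReal.mul_top (ENNReal.ofReal_pos.2 hA).ne']
      exact le_top
    by_cases hY : Ynorm ψ ϕ 0 3 β Fhat = ∞
    · rw [hY, add_top, ENNReal.mul_top (ENNReal.ofReal_pos.2 hA).ne']
      exact le_top
    refine eLpNorm_top_le hA.le hX hY (Filter.Eventually.of_forall fun x => ?_)
    have h1 := hdecay F Fhat hF k 0 hX hY x (σ * t)
    rw [bracket_sign_mul hσ, Nat.cast_zero, zero_mul, sub_zero] at h1
    refine h1.trans ?_
    gcongr
    exact le_mul_of_one_le_right hC.le (by linarith)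
  · have hbd : ∀ k x, ‖PLP ψ ϕ k (fun ξ => propagator (σ * t) ξ * Fhat ξ) x‖ ≤
        C * (bracket t)⁻¹ * ((Xnorm ψ ϕ 3 3 β Fhat).toReal + (Ynorm ψ ϕ 3 3 β Fhat).toReal) *
          (2 : ℝ) ^ ((3 / 2 : ℝ) * (k : ℝ) - (3 : ℕ) * max 0 (k : ℝ)) := by
      intro k x
      have h1 := hdecay F Fhat hF k 3 hX hY x (σ * t)
      rw [bracket_sign_mul hσ] at h1
      refine h1.trans_eq (by ring)
    obtain ⟨u, hu, hub⟩ := exists_Lp_hasFourierTransform hψ hϕ hF (σ * t) (summable_rpow_int.mul_left _) hbd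
    refine ⟨u, hu, eLpNorm_top_le (by positivity) hX hY ?_⟩
    filter_upwards [hub] with x hx
    rw [tsum_mul_left, ← hS] at hx
    refine hx.trans ?_
    have h2 : 0 ≤ C * (bracket t)⁻¹ * ((Xnorm ψ ϕ 3 3 β Fhat).toReal + (Ynorm ψ ϕ 3 3 β Fhat).toReal) :=
      mul_nonneg (mul_nonneg hC.le (inv_nonneg.2 hbr.le)) (add_nonneg ENNReal.toReal_nonneg ENNReal.toReal_nonneg)
    calc _ ≤ C * (bracket t)⁻¹ * ((Xnorm ψ ϕ 3 3 β Fhat).toReal + (Ynorm ψ ϕ 3 3 β Fhat).toReal) * (1 + S) :=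
          mul_le_mul_of_nonneg_left (by linarith) h2
      _ = _ := by ring
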